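/- Consider the equation \[ u_t+xu_y=x^3u_{xx} \tag{1} \] for a real function $u=u(t,x,y)$. A point transformation is a $C^\infty$-diffeomorphism $\Phi$ between two open subsets of the space $\mathbb R^4$ of the variables $(t,x,y,u)$. It is a point symmetry of (1) if it preserves the solution set: whenever $\Phi$ maps the graph of a smooth function $u$ over an open set $W\subseteq\mathbb R^3$ onto the graph of a smooth function $\tilde u$ over an open set $\widetilde W\subseteq\mathbb R^3$, then $u$ solves (1) on $W$ if and only if $\tilde u$ solves (1) on $\widetilde W$. The point symmetry pseudogroup $G_3$ of (1) is the set of all point symmetries of (1). **Theorem.** The point symmetry pseudogroup $G_3$ of (1) consists of the point transformations of the form \[ \tilde t=\frac{\alpha t+\beta}{\gamma t+\delta},\quad \tilde x=\frac{(\gamma t+\delta)^2}{\alpha\delta-\beta\gamma}\,x,\quad \tilde y=y+\lambda,\quad \tilde u=\sigma\,\frac{(\gamma t+\delta)^2}{\alpha\delta-\beta\gamma}\, \exp\!\left(\frac{\gamma x^{-1}}{\gamma t+\delta}\right)\bigl(u+f(t,x,y)\bigr), \tag{2} \] where $\alpha,\beta,\gamma,\delta$ are arbitrary real constants with $\alpha\delta-\beta\gamma=\pm1$,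 defined up to a simultaneous change of their signs, $\lambda$ and $\sigma$ are arbitrary real constants with $\sigma\neq0$, and $f$ is an arbitrary (smooth) solution of (1). The formulas (2) are considered where $\gamma t+\delta\ne0$ and, unless $\gamma=0$, $x\neq0$ (for $\gamma=0$ the exponential factor equals $1$). Precisely: 1. A homeomorphism $\Phi$ between open subsets of $\mathbb R^4$ belongs to $G_3$ if and only if every point of its domain has an open neighbourhood $\Omega$ in the domain on which $\Phi$ is of the form (2), for some constants and some solution $f$ on the projection of $\Omega$ to $\mathbb R^3_{t,x,y}$. 2. If the domain $D$ of $\Phi$ is connected and all its fibres $\{u:(t,x,y,u)\in D\}$ are connected, then $\Phi\in G_3$ if and only if $\Phi$ is of the form (2) on all of $D$, with a single tuple of constants and a single solution $f$ on the projection of $D$. 3. Conversely, for all constants as above, every open subset $W$ of $\mathbb R^3_{t,x,y}$ on which $\gamma t+\delta\neq0$ and ($\gamma=0$ or $x\ne0$), and every solution $f$ of (1) on $W$, the formulas (2) define an element of $G_3$ with domain $W\times\mathbb R$. 4. On a nonempty open set, two tuples of data $(\alpha,\beta,\gamma,\delta,\lambda,\sigma,f)$ and $(\alpha',\beta',\gamma',\delta',\lambda',\sigma',f')$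 define the same transformation (2) if and only if $(\alpha',\beta',\gamma',\delta')=\pm(\alpha,\beta,\gamma,\delta)$, $\lambda'=\lambda$, $\sigma'=\sigma$ and $f'=f$ on the projection of this set. -/

import Mathlib

open scoped ContDiff

namespace KolmogorovCubic

/-- The space of the independent variables `(t, x, y)`. -/
abbrev Base : Type := ℝ × ℝ × ℝ

/-- The space of all variables `((t, x, y), u)`. -/
abbrev Total : Type := Base × ℝ

/-- `u` is a (smooth) solution of `u_t + x u_y = x ^ 3 u_xx` on the open set `W`. -/
def IsSolutionOn (u : Base → ℝ) (W : Set Base) : Prop :=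
  IsOpen W ∧ ContDiffOn ℝ ∞ u W ∧
    ∀ t x y : ℝ, (t, x, y) ∈ W →
      deriv (fun s => u (s, x, y)) t + x * deriv (fun s => u (t, x, s)) y
        = x ^ 3 * deriv (deriv (fun s => u (t, s, y))) x

/-- The graph of `u` over `W`, a subset of the space of all variables. -/
def graphOver (u : Base → ℝ) (W : Set Base) : Set Total :=
  (fun z => (z, u z)) '' W

/-- A point transformation: a smooth diffeomorphism between two open subsets of the space of
all variables. -/
def IsPointTransformation (Φ : OpenPartialHomeomorph Total Total) : Prop :=
  ContDiffOn ℝ ∞ Φ Φ.source ∧ ContDiffOn ℝ ∞ Φ.symm Φ.target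

/-- `Φ` preserves the solution set: whenever `Φ` maps the graph of a smooth function `u` over an
open set `W` onto the graph of a smooth function `v` over an open set `V`, then `u` is a solution
on `W` if and only if `v` is a solution on `V`. -/
def PreservesSolutions (Φ : OpenPartialHomeomorph Total Total) : Prop :=
  ∀ (u v : Base → ℝ) (W V : Set Base), IsOpen W → IsOpen V →
    ContDiffOn ℝ ∞ u W → ContDiffOn ℝ ∞ v V →
    graphOver u W ⊆ Φ.source → Φ '' graphOver u W = graphOver v V →
    (IsSolutionOn u W ↔ IsSolutionOn v V)

/-- The point symmetry pseudogroup of the equation `u_t + x u_y = x ^ 3 u_xx`: all point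
transformations (with arbitrary open domains) that preserve the solution set. -/
def symmetryPseudogroup : Set (OpenPartialHomeomorph Total Total) :=
  {Φ | IsPointTransformation Φ ∧ PreservesSolutions Φ}

/-- The explicit formulas for the transformed variables. -/
noncomputable def symmetryMap (α β γ δ lam σ : ℝ) (f : Base → ℝ) : Total → Total :=
  fun ((t, x, y), u) =>
    (((α * t + β) / (γ * t + δ),
      (γ * t + δ) ^ 2 / (α * δ - β * γ) * x,
      y + lam),
     σ * ((γ * t + δ) ^ 2 / (α * δ - β * γ)) * Real.exp (γ * x⁻¹ / (γ * t + δ))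
        * (u + f (t, x, y)))

/-- The constraints on the constants. -/
def AdmissibleConstants (α β γ δ σ : ℝ) : Prop :=
  (α * δ - β * γ = 1 ∨ α * δ - β * γ = -1) ∧ σ ≠ 0

/-- The natural domain of the formulas in the independent variables: the denominator `γ t + δ`
does not vanish, and neither does `x` unless `γ = 0`, in which case the exponential factor is the
constant `1` and there is no singularity at `x = 0`. -/
def naturalDomain (γ δ : ℝ) : Set Base :=
  {z | γ * z.1 + δ ≠ 0 ∧ (γ = 0 ∨ z.2.1 ≠ 0)}

/-- On the set `Ω`, the map `Φ` is given by the explicit formulas with the constants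
`α, β, γ, δ, lam, σ` and with `f` a solution on the projection of `Ω` to the space of the
independent variables. -/
def HasSymmetryForm (Φ : Total → Total) (Ω : Set Total) (α β γ δ lam σ : ℝ) (f : Base → ℝ) :
    Prop :=
  AdmissibleConstants α β γ δ σ ∧
    Prod.fst '' Ω ⊆ naturalDomain γ δ ∧
    IsSolutionOn f (Prod.fst '' Ω) ∧
    Set.EqOn Φ (symmetryMap α β γ δ lam σ f) Ω

end KolmogorovCubic

/-! Write `Φ = (T, X, Y, U)`. Necessity is an elimination with jets. At a point with `x ≠ 0`
solutions attain every value and gradient; their `u_xx` is then forced, while `u_tt` and `u_yy` stay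
free (`exists_solution_jet`). A symmetry carries a solution whose image is transversal to the fibres
to a solution `v`, and the jets of the two are tied by differentiating `v ∘ F = G`, where `(F, G)`
is `Φ` along the graph (`exists_image_jet`). Where neither `x` nor `X` vanishes, varying `u_tt` and
`u_yy` shows that `T` and `Y` do not depend on `x` and `u` (`vertical_derivatives`). Varying `u_t`
and `u_y` gives `X_u = 0` and makes `X` linear fractional in `x` with coefficients from `DT` and
`DY`; combined with its own `x`-derivative this becomes a polynomial identity in `x`, which leaves
only `T_y = Y_t = 0`, `Y_y = 1`, `X = x / T_t` (`base_derivatives`). What remains is polynomial in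
the slope `u_x`; its coefficients make `U` affine in `u`. Density of the regular points extends all
this to the whole domain (`determining_equations`).

Integration: let `τ = T` and `m = τ'' / (2 τ')`. The coefficient `a = U_u` satisfies `x³ a_x = m x
a`, so `a = k exp (-m / x)` off `x = 0`, with `k` independent of `x`. Its second equation is then a
quadratic in `x`, that is, `m' = m²`, `k_t = -2 m k`, `k_y = 0`. The first says that the Schwarzian
of `τ` vanishes, so `τ` is linear fractional (`exists_mobius`), and `k` is a constant times `(γ t +
δ)²`. Near `x = 0` smoothness forces `m = 0`, hence `γ = 0`. Dividing the part of `U` free of `u` by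
`a` yields a solution, which is `f` up to a constant.

Sufficiency: the pullback by the base map followed by division by the factor of `u` turns the
operator into a nonvanishing multiple of itself (`gaugedOp_comp_baseMap`, `gaugedOp_mul`).
Uniqueness compares coefficients on an interval of `t`. Globally, uniqueness propagates the
constants along a connected domain, and connected fibres let `f` descend to the base. -/

namespace KolmogorovCubic

open Filter Topology Set

/-! ### Second-order chain rules and functions constant in one direction -/

section Calculus

variable {E F G : Type*} [NormedAddCommGroup E] [NormedSpace ℝ E] [NormedAddCommGroup F]
  [NormedSpace ℝ F] [NormedAddCommGroup G] [NormedSpace ℝ G]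

theorem contDiffAt_fderiv {h : E → F} {x : E} (hh : ContDiffAt ℝ 2 h x) :
    ContDiffAt ℝ 1 (fderiv ℝ h) x :=
  hh.fderiv_right (by norm_num)

theorem eventually_differentiableAt {h : E → F} {x : E} (hh : ContDiffAt ℝ 2 h x) :
    ∀ᶠ y in 𝓝 x, DifferentiableAt ℝ h y :=
  (hh.eventually (by simp)).mono fun _ hy => hy.differentiableAt (by simp)

/-- The chain rule for second derivatives. -/
theorem fderiv_fderiv_comp {h : F → G} {g : E → F} {x : E} (hh : ContDiffAt ℝ 2 h (g x))
    (hg : ContDiffAt ℝ 2 g x) (v w : E) :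
    fderiv ℝ (fderiv ℝ (fun y => h (g y))) x v w =
      fderiv ℝ (fderiv ℝ h) (g x) (fderiv ℝ g x v) (fderiv ℝ g x w)
        + fderiv ℝ h (g x) (fderiv ℝ (fderiv ℝ g) x v w) := by
  have h1 : fderiv ℝ (fun y => h (g y)) =ᶠ[𝓝 x]
      fun y => (fderiv ℝ h (g y)).comp (fderiv ℝ g y) := by
    filter_upwards [eventually_differentiableAt hg,
      hg.continuousAt.eventually (eventually_differentiableAt hh)] with y hy1 hy2
    exact fderiv_comp y hy2 hy1
  have hg' := hg.differentiableAt (by simp)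
  have hdg := ((contDiffAt_fderiv hg).differentiableAt (by simp)).hasFDerivAt
  have hdh : HasFDerivAt (fun y => fderiv ℝ h (g y))
      ((fderiv ℝ (fderiv ℝ h) (g x)).comp (fderiv ℝ g x)) x :=
    (((contDiffAt_fderiv hh).differentiableAt (by simp)).hasFDerivAt).comp x hg'.hasFDerivAt
  rw [h1.fderiv_eq, (hdh.clm_comp hdg).fderiv]
  simp [add_comm]

theorem fderiv_fderiv_symm {h : E → F} {x : E} (hh : ContDiffAt ℝ 2 h x) (v w : E) :
    fderiv ℝ (fderiv ℝ h) x v w = fderiv ℝ (fderiv ℝ h) x w v :=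
  hh.isSymmSndFDerivAt (by simp) v w

theorem fderiv_fderiv_apply {h : E → F} {x : E} (hh : ContDiffAt ℝ 2 h x) (v w : E) :
    fderiv ℝ (fun y => fderiv ℝ h y w) x v = fderiv ℝ (fderiv ℝ h) x v w := by
  have hd := ((contDiffAt_fderiv hh).differentiableAt (by simp)).hasFDerivAt
  rw [(hd.clm_apply (hasFDerivAt_const w x)).fderiv]
  simp

theorem fderiv_fderiv_clm_comp {h : E → F} {x : E} (hh : ContDiffAt ℝ 2 h x) (L : F →L[ℝ] G)
    (v w : E) :
    fderiv ℝ (fderiv ℝ (fun y => L (h y))) x v w = L (fderiv ℝ (fderiv ℝ h) x v w) := by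
  rw [fderiv_fderiv_comp (h := L) L.contDiff.contDiffAt hh]
  have : fderiv ℝ (L : F → G) = fun _ => L := by ext1 y; exact L.fderiv
  simp [this]

/-- Derivatives along a straight line. -/
theorem deriv_comp_line {h : E → F} {c : ℝ → E} {w : E} {s : ℝ} (hc : HasDerivAt c w s)
    (hh : DifferentiableAt ℝ h (c s)) :
    deriv (fun r => h (c r)) s = fderiv ℝ h (c s) w :=
  (hh.hasFDerivAt.comp_hasDerivAt s hc).deriv

theorem deriv_deriv_comp_line {h : E → F} {c : ℝ → E} {w : E} {s : ℝ}
    (hc : ∀ r, HasDerivAt c w r) (hh : ContDiffAt ℝ 2 h (c s)) :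
    deriv (deriv (fun r => h (c r))) s = fderiv ℝ (fderiv ℝ h) (c s) w w := by
  have h1 : deriv (fun r => h (c r)) =ᶠ[𝓝 s] fun r => fderiv ℝ h (c r) w := by
    filter_upwards [(hc s).continuousAt.eventually (eventually_differentiableAt hh)] with r hr
    exact deriv_comp_line (hc r) hr
  rw [h1.deriv_eq, deriv_comp_line (h := fun p => fderiv ℝ h p w) (hc s),
    fderiv_fderiv_apply hh]
  exact ((contDiffAt_fderiv hh).differentiableAt (by simp)).clm_apply
    (differentiableAt_const w)

/-- A function whose derivative in the direction `e` vanishes is constant along segments in this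
direction. -/
theorem eq_of_fderiv_apply_eq_zero {h : E → F} {O : Set E} (hO : Convex ℝ O)
    (hd : ∀ p ∈ O, DifferentiableAt ℝ h p) {p p' : E} (hp : p ∈ O) (hp' : p' ∈ O)
    (hz : ∀ q ∈ O, fderiv ℝ h q (p' - p) = 0) : h p' = h p := by
  have hseg : ∀ r ∈ Icc (0 : ℝ) 1, p + r • (p' - p) ∈ O := fun r hr =>
    hO.add_smul_sub_mem hp hp' hr
  have hder : ∀ r ∈ Icc (0 : ℝ) 1, HasDerivAt (fun r : ℝ => h (p + r • (p' - p))) 0 r := by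
    intro r hr
    have hc : HasDerivAt (fun r : ℝ => p + r • (p' - p)) (p' - p) r := by
      simpa using ((hasDerivAt_id r).smul_const (p' - p)).const_add p
    have := (hd _ (hseg r hr)).hasFDerivAt.comp_hasDerivAt r hc
    rwa [hz _ (hseg r hr)] at this
  have := constant_of_has_deriv_right_zero (f := fun r : ℝ => h (p + r • (p' - p)))
    (fun r hr => (hder r hr).continuousAt.continuousWithinAt)
    (fun r hr => (hder r (Ico_subset_Icc_self hr)).hasDerivWithinAt) 1 (by simp)
  simpa using this

/-- If the derivative in the direction `e` vanishes on an open set, then so does the derivative of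
the derivative in this direction. -/
theorem fderiv_fderiv_eq_zero {h : E → F} {O : Set E} (hO : IsOpen O)
    (hh : ∀ p ∈ O, ContDiffAt ℝ 2 h p) {e : E} (he : ∀ p ∈ O, fderiv ℝ h p e = 0) {p : E}
    (hp : p ∈ O) : fderiv ℝ (fderiv ℝ h) p e = 0 := by
  ext w
  -- By symmetry, the second derivative at `(e, w)` is the derivative along `w` of the function `y ↦
  -- fderiv ℝ h y e`, which vanishes near `p`.
  rw [fderiv_fderiv_symm (hh p hp), ← fderiv_fderiv_apply (hh p hp)]
  have : (fun y => fderiv ℝ h y e) =ᶠ[𝓝 p] fun _ => 0 := by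
    filter_upwards [hO.mem_nhds hp] with q hq using he q hq
  rw [this.fderiv_eq]
  simp

/-- If the derivative in the direction `e` vanishes on an open convex set, then the derivative is
constant along segments in this direction. -/
theorem fderiv_eq_of_fderiv_apply_eq_zero {h : E → F} {O : Set E} (hO : IsOpen O)
    (hOc : Convex ℝ O) (hh : ∀ p ∈ O, ContDiffAt ℝ 2 h p) {e : E}
    (he : ∀ p ∈ O, fderiv ℝ h p e = 0) {p p' : E} (hp : p ∈ O) (hp' : p' ∈ O) {c : ℝ}
    (hc : p' - p = c • e) : fderiv ℝ h p' = fderiv ℝ h p := by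
  refine eq_of_fderiv_apply_eq_zero hOc
    (fun q hq => (contDiffAt_fderiv (hh q hq)).differentiableAt (by simp)) hp hp' ?_
  intro q hq
  rw [hc, map_smul, fderiv_fderiv_eq_zero hO hh he hq, smul_zero]

/-- Order-connectedness keeps the interval of integration inside `I`, so `k` may be singular
elsewhere; it is applied to powers of `1 / x` on a half-line. -/
theorem exists_primitive {I : Set ℝ} (hI : IsOpen I) (hc : I.OrdConnected) {k : ℝ → ℝ}
    (hk : ContDiffOn ℝ ∞ k I) {x₀ : ℝ} (hx : x₀ ∈ I) :
    ∃ g : ℝ → ℝ, ContDiffOn ℝ ∞ g I ∧ (∀ x ∈ I, HasDerivAt g (k x) x) ∧ g x₀ = 0 := by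
  have hd : ∀ x ∈ I, HasDerivAt (fun x => ∫ s in x₀..x, k s) (k x) x := by
    intro x hxI
    apply intervalIntegral.integral_hasDerivAt_right
    · exact (hk.continuousOn.mono (hc.uIcc_subset hx hxI)).intervalIntegrable
    · exact hk.continuousOn.stronglyMeasurableAtFilter hI x hxI
    · exact hk.continuousOn.continuousAt (hI.mem_nhds hxI)
  refine ⟨_, ?_, hd, by simp⟩
  rw [contDiffOn_infty_iff_deriv_of_isOpen hI]
  exact ⟨fun x hxI => (hd x hxI).differentiableAt.differentiableWithinAt,
    hk.congr fun x hxI => (hd x hxI).deriv⟩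

end Calculus

/-! ### The equation in terms of Fréchet derivatives -/

/-- The operator `u ↦ u_t + x u_y - x ^ 3 u_xx` in terms of Fréchet derivatives. -/
noncomputable def kolmogorovOp (u : Base → ℝ) (z : Base) : ℝ :=
  fderiv ℝ u z (1, 0, z.2.1) - z.2.1 ^ 3 * fderiv ℝ (fderiv ℝ u) z (0, 1, 0) (0, 1, 0)

theorem hasDerivAt_lineT (x y s : ℝ) :
    HasDerivAt (fun s : ℝ => ((s, x, y) : Base)) (1, 0, 0) s :=
  (hasDerivAt_id s).prodMk ((hasDerivAt_const s x).prodMk (hasDerivAt_const s y))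

theorem hasDerivAt_lineX (t y s : ℝ) :
    HasDerivAt (fun s : ℝ => ((t, s, y) : Base)) (0, 1, 0) s :=
  (hasDerivAt_const s t).prodMk ((hasDerivAt_id s).prodMk (hasDerivAt_const s y))

theorem hasDerivAt_lineY (t x s : ℝ) :
    HasDerivAt (fun s : ℝ => ((t, x, s) : Base)) (0, 0, 1) s :=
  (hasDerivAt_const s t).prodMk ((hasDerivAt_const s x).prodMk (hasDerivAt_id s))

theorem contDiffAt_two {E F : Type*} [NormedAddCommGroup E] [NormedSpace ℝ E]
    [NormedAddCommGroup F] [NormedSpace ℝ F] {h : E → F} {x : E} (hh : ContDiffAt ℝ ∞ h x) :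
    ContDiffAt ℝ 2 h x :=
  contDiffAt_infty.1 hh 2

theorem base_decomp (L : Base →L[ℝ] ℝ) (z : Base) :
    L z = z.1 * L (1, 0, 0) + z.2.1 * L (0, 1, 0) + z.2.2 * L (0, 0, 1) := by
  have : z = z.1 • (1, 0, 0) + z.2.1 • (0, 1, 0) + z.2.2 • (0, 0, 1) := by
    ext <;> simp
  conv_lhs => rw [this]
  simp only [map_add, map_smul, smul_eq_mul]

theorem kolmogorovOp_eq {u : Base → ℝ} {t x y : ℝ} (hu : ContDiffAt ℝ 2 u (t, x, y)) :
    kolmogorovOp u (t, x, y) =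
      deriv (fun s => u (s, x, y)) t + x * deriv (fun s => u (t, x, s)) y
        - x ^ 3 * deriv (deriv (fun s => u (t, s, y))) x := by
  have hd : DifferentiableAt ℝ u (t, x, y) := hu.differentiableAt (by simp)
  rw [deriv_comp_line (hasDerivAt_lineT x y t) hd, deriv_comp_line (hasDerivAt_lineY t x y) hd,
    deriv_deriv_comp_line (c := fun s => ((t, s, y) : Base)) (hasDerivAt_lineX t y) hu,
    kolmogorovOp, base_decomp]
  simp

theorem isSolutionOn_iff {u : Base → ℝ} {W : Set Base} :
    IsSolutionOn u W ↔ IsOpen W ∧ ContDiffOn ℝ ∞ u W ∧ ∀ z ∈ W, kolmogorovOp u z = 0 := by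
  refine and_congr_right fun hW => and_congr_right fun hu => ?_
  have key : ∀ z ∈ W, ContDiffAt ℝ 2 u z := fun z hz =>
    contDiffAt_two (hu.contDiffAt (hW.mem_nhds hz))
  constructor
  · rintro h ⟨t, x, y⟩ hz
    rw [kolmogorovOp_eq (key _ hz), h t x y hz, sub_self]
  · intro h t x y hz
    have := h _ hz
    rwa [kolmogorovOp_eq (key _ hz), sub_eq_zero] at this

theorem kolmogorovOp_congr {u v : Base → ℝ} {z : Base} (h : u =ᶠ[𝓝 z] v) :
    kolmogorovOp u z = kolmogorovOp v z := by
  rw [kolmogorovOp, kolmogorovOp, h.fderiv_eq, h.fderiv.fderiv_eq]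

theorem fderiv_fderiv_add {u v : Base → ℝ} {z : Base} (hu : ContDiffAt ℝ 2 u z)
    (hv : ContDiffAt ℝ 2 v z) :
    fderiv ℝ (fderiv ℝ (fun y => u y + v y)) z
      = fderiv ℝ (fderiv ℝ u) z + fderiv ℝ (fderiv ℝ v) z := by
  have : fderiv ℝ (fun y => u y + v y) =ᶠ[𝓝 z] fun y => fderiv ℝ u y + fderiv ℝ v y := by
    filter_upwards [eventually_differentiableAt hu, eventually_differentiableAt hv] with y h1 h2
    exact fderiv_add h1 h2
  rw [this.fderiv_eq]
  exact fderiv_add ((contDiffAt_fderiv hu).differentiableAt (by simp))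
    ((contDiffAt_fderiv hv).differentiableAt (by simp))

theorem fderiv_fderiv_mul {u v : Base → ℝ} {z : Base} (hu : ContDiffAt ℝ 2 u z)
    (hv : ContDiffAt ℝ 2 v z) (w : Base) :
    fderiv ℝ (fderiv ℝ (fun y => u y * v y)) z w w
      = u z * fderiv ℝ (fderiv ℝ v) z w w + 2 * (fderiv ℝ u z w * fderiv ℝ v z w)
        + v z * fderiv ℝ (fderiv ℝ u) z w w := by
  have h1 : fderiv ℝ (fun y => u y * v y) =ᶠ[𝓝 z]
      fun y => u y • fderiv ℝ v y + v y • fderiv ℝ u y := by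
    filter_upwards [eventually_differentiableAt hu, eventually_differentiableAt hv] with y h1 h2
    exact fderiv_mul h1 h2
  have du := (hu.differentiableAt (by simp)).hasFDerivAt
  have dv := (hv.differentiableAt (by simp)).hasFDerivAt
  have ddu := ((contDiffAt_fderiv hu).differentiableAt (by simp)).hasFDerivAt
  have ddv := ((contDiffAt_fderiv hv).differentiableAt (by simp)).hasFDerivAt
  rw [h1.fderiv_eq]
  refine (congrArg (fun L => L w w) ((du.smul ddv).add (dv.smul ddu)).fderiv).trans ?_
  simp
  ring

theorem kolmogorovOp_add {u v : Base → ℝ} {z : Base} (hu : ContDiffAt ℝ 2 u z)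
    (hv : ContDiffAt ℝ 2 v z) :
    kolmogorovOp (fun y => u y + v y) z = kolmogorovOp u z + kolmogorovOp v z := by
  have h1 : fderiv ℝ (fun y => u y + v y) z = fderiv ℝ u z + fderiv ℝ v z :=
    fderiv_add (hu.differentiableAt (by simp)) (hv.differentiableAt (by simp))
  simp only [kolmogorovOp, fderiv_fderiv_add hu hv, h1, add_apply]
  ring

theorem IsSolutionOn.add {u v : Base → ℝ} {W : Set Base} (hu : IsSolutionOn u W)
    (hv : IsSolutionOn v W) : IsSolutionOn (fun z => u z + v z) W := by
  rw [isSolutionOn_iff] at *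
  refine ⟨hu.1, hu.2.1.add hv.2.1, fun z hz => ?_⟩
  have hn := hu.1.mem_nhds hz
  rw [kolmogorovOp_add (contDiffAt_two (hu.2.1.contDiffAt hn))
    (contDiffAt_two (hv.2.1.contDiffAt hn)), hu.2.2 z hz, hv.2.2 z hz, add_zero]

theorem IsSolutionOn.congr {u v : Base → ℝ} {W : Set Base} (hu : IsSolutionOn u W)
    (h : Set.EqOn v u W) : IsSolutionOn v W := by
  rw [isSolutionOn_iff] at *
  refine ⟨hu.1, hu.2.1.congr h, fun z hz => ?_⟩
  rw [← hu.2.2 z hz]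
  exact kolmogorovOp_congr (h.eventuallyEq_of_mem (hu.1.mem_nhds hz))

theorem IsSolutionOn.mono {u : Base → ℝ} {W W' : Set Base} (hu : IsSolutionOn u W)
    (h : W' ⊆ W) (hW' : IsOpen W') : IsSolutionOn u W' :=
  ⟨hW', hu.2.1.mono h, fun t x y hz => hu.2.2 t x y (h hz)⟩

/-! ### Solutions with prescribed jets at a point -/

/-- The coordinate functionals on the base. -/
noncomputable def dT : Base →L[ℝ] ℝ := ContinuousLinearMap.fst ℝ ℝ (ℝ × ℝ)

noncomputable def dX : Base →L[ℝ] ℝ :=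
  (ContinuousLinearMap.fst ℝ ℝ ℝ).comp (ContinuousLinearMap.snd ℝ ℝ (ℝ × ℝ))

noncomputable def dY : Base →L[ℝ] ℝ :=
  (ContinuousLinearMap.snd ℝ ℝ ℝ).comp (ContinuousLinearMap.snd ℝ ℝ (ℝ × ℝ))

@[simp] theorem dT_apply (z : Base) : dT z = z.1 := rfl

@[simp] theorem dX_apply (z : Base) : dX z = z.2.1 := rfl

@[simp] theorem dY_apply (z : Base) : dY z = z.2.2 := rfl

/-- The half-space of the points on the same side of `x = 0` as `x₀`. -/
def sameSide (x₀ : ℝ) : Set Base := {z | 0 < z.2.1 * x₀}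

theorem isOpen_sameSide (x₀ : ℝ) : IsOpen (sameSide x₀) :=
  isOpen_lt (by fun_prop) (by fun_prop)

theorem exists_second_primitive {I : Set ℝ} (hI : IsOpen I) (hc : I.OrdConnected) {k : ℝ → ℝ}
    (hk : ContDiffOn ℝ ∞ k I) {x₀ : ℝ} (hx : x₀ ∈ I) :
    ∃ g g' : ℝ → ℝ, ContDiffOn ℝ ∞ g I ∧ (∀ x ∈ I, HasDerivAt g (g' x) x) ∧
      (∀ x ∈ I, HasDerivAt g' (k x) x) ∧ g x₀ = 0 ∧ g' x₀ = 0 := by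
  obtain ⟨g', h1, h2, h3⟩ := exists_primitive hI hc hk hx
  obtain ⟨g, h4, h5, h6⟩ := exists_primitive hI hc h1 hx
  exact ⟨g, g', h4, h5, h2, h6, h3⟩

/-- Solutions that are quadratic polynomials in a linear functional of `(t, y)` with coefficients
depending on `x`. -/
theorem exists_quadratic_solution (l : Base →L[ℝ] ℝ) (hl : l (0, 1, 0) = 0) {z₀ : Base}
    (hz₀ : z₀.2.1 ≠ 0) (b c : ℝ) {k : ℝ → ℝ}
    (hk : ContDiffOn ℝ ∞ k {x | 0 < x * z₀.2.1})
    (hlk : ∀ x : ℝ, 0 < x * z₀.2.1 → l (1, 0, x) = x ^ 3 * k x) :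
    ∃ u : Base → ℝ, IsSolutionOn u (sameSide z₀.2.1) ∧ u z₀ = 0 ∧ fderiv ℝ u z₀ = b • l ∧
      ∀ P : Base, fderiv ℝ (fderiv ℝ u) z₀ P P = b * (k z₀.2.1 * P.2.1 ^ 2) + c * l P ^ 2 := by
  set I : Set ℝ := {x | 0 < x * z₀.2.1} with hIdef
  have hI : IsOpen I := isOpen_lt (by fun_prop) (by fun_prop)
  have hc : I.OrdConnected := by
    refine ⟨fun x hx y hy w hw => ?_⟩
    simp only [hIdef, mem_ofPred_eq] at *
    rcases lt_or_gt_of_ne hz₀ with h | h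
    · nlinarith [hw.2]
    · nlinarith [hw.1]
  have hx₀ : z₀.2.1 ∈ I := mul_self_pos.2 hz₀
  obtain ⟨g₁, d₁, hg₁, hd₁, hdd₁, hg₁0, hd₁0⟩ := exists_second_primitive hI hc hk hx₀
  obtain ⟨g₂, d₂, hg₂, hd₂, hdd₂, hg₂0, hd₂0⟩ :=
    exists_second_primitive hI hc (hk.mul hg₁) hx₀
  -- The operator sends `l` to `x³ k`, so `g₁'' = k` and `g₂'' = k g₁` correct `l` and `l² / 2` to
  -- the solutions `l + g₁` and `l² / 2 + l g₁ + g₂`. Since `g₁` and `g₂` vanish at `z₀` together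
  -- with their first derivatives, the only trace they leave in the 2-jet there is `g₁'' = k`.
  set u : Base → ℝ := fun z => b * (l (z - z₀) + g₁ z.2.1)
    + c * (l (z - z₀) ^ 2 / 2 + l (z - z₀) * g₁ z.2.1 + g₂ z.2.1) with hu
  have hx' : ∀ z : Base, HasFDerivAt (fun z : Base => z.2.1) dX z := fun z => dX.hasFDerivAt
  have hl' : ∀ z : Base, HasFDerivAt (fun z : Base => l (z - z₀)) l z := fun z =>
    (l.hasFDerivAt (x := z - z₀)).comp z ((hasFDerivAt_id z).sub_const z₀)
  have hder : ∀ z ∈ sameSide z₀.2.1, HasFDerivAt u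
      ((b + c * (l (z - z₀) + g₁ z.2.1)) • l
        + (b * d₁ z.2.1 + c * (l (z - z₀) * d₁ z.2.1 + d₂ z.2.1)) • dX) z := by
    intro z hz
    have a1 := (hd₁ z.2.1 hz).comp_hasFDerivAt z (hx' z)
    have a2 := (hd₂ z.2.1 hz).comp_hasFDerivAt z (hx' z)
    have := (((hl' z).add a1).const_mul b).add
      ((((((hl' z).pow 2).const_mul (1 / 2)).add ((hl' z).mul a1)).add a2).const_mul c)
    refine (this.congr_fderiv ?_).congr_of_eventuallyEq (Eventually.of_forall fun w => ?_)
    · refine ContinuousLinearMap.ext fun w => ?_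
      simp
      ring
    · simp only [hu, Pi.add_apply, Pi.mul_apply, Function.comp_apply]
      ring
  have hder2 : ∀ z ∈ sameSide z₀.2.1, ∀ v w : Base, fderiv ℝ (fderiv ℝ u) z v w =
      c * (l v + d₁ z.2.1 * v.2.1) * l w + (b * (k z.2.1 * v.2.1)
        + c * (l v * d₁ z.2.1 + l (z - z₀) * (k z.2.1 * v.2.1)
          + k z.2.1 * g₁ z.2.1 * v.2.1)) * w.2.1 := by
    intro z hz v w
    have e1 : fderiv ℝ u =ᶠ[𝓝 z] fun z => (b + c * (l (z - z₀) + g₁ z.2.1)) • l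
        + (b * d₁ z.2.1 + c * (l (z - z₀) * d₁ z.2.1 + d₂ z.2.1)) • dX := by
      filter_upwards [(isOpen_sameSide z₀.2.1).mem_nhds hz] with z' hz' using (hder z' hz').fderiv
    have a1 := (hd₁ z.2.1 hz).comp_hasFDerivAt z (hx' z)
    have a1' := (hdd₁ z.2.1 hz).comp_hasFDerivAt z (hx' z)
    have a2' := (hdd₂ z.2.1 hz).comp_hasFDerivAt z (hx' z)
    have := ((((hl' z).add a1).const_mul c).const_add b).smul_const l |>.add
      (((a1'.const_mul b).add ((((hl' z).mul a1').add a2').const_mul c)).smul_const dX)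
    rw [e1.fderiv_eq]
    refine (congrArg (fun L => L v w) this.fderiv).trans ?_
    simp
    ring
  refine ⟨u, ?_, ?_, ?_, ?_⟩
  · rw [isSolutionOn_iff]
    refine ⟨isOpen_sameSide _, ?_, fun z hz => ?_⟩
    · have hm : MapsTo (fun z : Base => z.2.1) (sameSide z₀.2.1) I := fun z hz => hz
      have b1 : ContDiffOn ℝ ∞ (fun z : Base => g₁ z.2.1) (sameSide z₀.2.1) :=
        hg₁.comp (by fun_prop) hm
      have b2 : ContDiffOn ℝ ∞ (fun z : Base => g₂ z.2.1) (sameSide z₀.2.1) :=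
        hg₂.comp (by fun_prop) hm
      have b3 : ContDiffOn ℝ ∞ (fun z : Base => l (z - z₀)) (sameSide z₀.2.1) := by fun_prop
      exact (contDiffOn_const.mul (b3.add b1)).add (contDiffOn_const.mul
        ((((b3.pow 2).div_const 2).add (b3.mul b1)).add b2))
    · rw [kolmogorovOp, (hder z hz).fderiv, hder2 z hz]
      have := hlk z.2.1 hz
      simp only [add_apply, smul_apply, dX_apply, hl, smul_eq_mul, this]
      ring
  · simp [hu, hg₁0, hg₂0]
  · rw [(hder z₀ hx₀).fderiv]
    simp [hg₁0, hd₁0, hd₂0]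
  · intro P
    rw [hder2 z₀ hx₀]
    simp [hg₁0, hd₁0]
    ring

/-- Here `l (1, 0, x) = 1`, which dictates `k = x⁻³`; for `dY` the value is `x`, and `k = x⁻²`. -/
theorem exists_quadratic_solution_t {z₀ : Base} (hz₀ : z₀.2.1 ≠ 0) (b c : ℝ) :
    ∃ u : Base → ℝ, IsSolutionOn u (sameSide z₀.2.1) ∧ u z₀ = 0 ∧ fderiv ℝ u z₀ = b • dT ∧
      ∀ P : Base, fderiv ℝ (fderiv ℝ u) z₀ P P
        = b * ((z₀.2.1 ^ 3)⁻¹ * P.2.1 ^ 2) + c * P.1 ^ 2 := by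
  have hne : ∀ x ∈ {x | 0 < x * z₀.2.1}, x ^ 3 ≠ 0 := fun x hx =>
    pow_ne_zero 3 (left_ne_zero_of_mul (ne_of_gt hx))
  refine exists_quadratic_solution dT (by simp) hz₀ b c (k := fun x => (x ^ 3)⁻¹) ?_ ?_
  · exact ContDiffOn.inv (by fun_prop) hne
  · intro x hx
    have := hne x hx
    simp [this]

theorem exists_quadratic_solution_y {z₀ : Base} (hz₀ : z₀.2.1 ≠ 0) (b c : ℝ) :
    ∃ u : Base → ℝ, IsSolutionOn u (sameSide z₀.2.1) ∧ u z₀ = 0 ∧ fderiv ℝ u z₀ = b • dY ∧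
      ∀ P : Base, fderiv ℝ (fderiv ℝ u) z₀ P P
        = b * ((z₀.2.1 ^ 2)⁻¹ * P.2.1 ^ 2) + c * P.2.2 ^ 2 := by
  have hne : ∀ x ∈ {x | 0 < x * z₀.2.1}, x ≠ 0 := fun x hx =>
    left_ne_zero_of_mul (ne_of_gt hx)
  refine exists_quadratic_solution dY (by simp) hz₀ b c (k := fun x => (x ^ 2)⁻¹) ?_ ?_
  · exact ContDiffOn.inv (by fun_prop) fun x hx => pow_ne_zero 2 (hne x hx)
  · intro x hx
    have := hne x hx
    simp
    field_simp

theorem isSolutionOn_affine (a b x₀ : ℝ) {W : Set Base} (hW : IsOpen W) :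
    IsSolutionOn (fun z => a + b * (z.2.1 - x₀)) W := by
  refine ⟨hW, by fun_prop, fun t x y _ => ?_⟩
  have h1 : (deriv fun s : ℝ => a + b * (s - x₀)) = fun _ => b := by
    ext s
    simp
  simp [h1]

/-- Solutions with arbitrary value and gradient at a point with `x ≠ 0`; the second derivatives
in the directions of `t` and `y` are arbitrary, too. -/
theorem exists_solution_jet {z₀ : Base} (hz₀ : z₀.2.1 ≠ 0) (u₀ : ℝ) (q : Base →L[ℝ] ℝ)
    (a b : ℝ) :
    ∃ u : Base → ℝ, IsSolutionOn u (sameSide z₀.2.1) ∧ u z₀ = u₀ ∧ fderiv ℝ u z₀ = q ∧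
      ∀ P : Base, fderiv ℝ (fderiv ℝ u) z₀ P P
        = q (1, 0, z₀.2.1) / z₀.2.1 ^ 3 * P.2.1 ^ 2 + a * P.1 ^ 2 + b * P.2.2 ^ 2 := by
  -- `v`, `w` and an affine function of `x` supply the `t`-, `y`- and `x`-components of the
  -- gradient. The coefficient `q_t / x³ + q_y / x²` of `P.2.1 ^ 2` is `q (1, 0, x) / x³`, as the
  -- equation demands.
  obtain ⟨v, hv, hv0, hv1, hv2⟩ := exists_quadratic_solution_t hz₀ (q (1, 0, 0)) a
  obtain ⟨w, hw, hw0, hw1, hw2⟩ := exists_quadratic_solution_y hz₀ (q (0, 0, 1)) b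
  have hs := isSolutionOn_affine u₀ (q (0, 1, 0)) z₀.2.1 (isOpen_sameSide z₀.2.1)
  have hx₀ : z₀ ∈ sameSide z₀.2.1 := mul_self_pos.2 hz₀
  have hn := (isOpen_sameSide z₀.2.1).mem_nhds hx₀
  have cv := contDiffAt_two (hv.2.1.contDiffAt hn)
  have cw := contDiffAt_two (hw.2.1.contDiffAt hn)
  have cs := contDiffAt_two (hs.2.1.contDiffAt hn)
  have hds : ∀ z, HasFDerivAt (fun z : Base => u₀ + q (0, 1, 0) * (z.2.1 - z₀.2.1))
      (q (0, 1, 0) • dX) z := fun z =>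
    (((dX.hasFDerivAt (x := z)).sub_const z₀.2.1).const_mul (q (0, 1, 0))).const_add u₀
  have hds' : fderiv ℝ (fun z : Base => u₀ + q (0, 1, 0) * (z.2.1 - z₀.2.1))
      = fun _ => q (0, 1, 0) • dX := funext fun z => (hds z).fderiv
  refine ⟨_, (hs.add hv).add hw, by simp [hv0, hw0], ?_, fun P => ?_⟩
  · have d1 := ((hds z₀).add (cv.differentiableAt (by simp)).hasFDerivAt).add
      (cw.differentiableAt (by simp)).hasFDerivAt
    refine d1.fderiv.trans ?_
    rw [hv1, hw1]
    refine ContinuousLinearMap.ext fun z => ?_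
    rw [base_decomp q z]
    simp
    ring
  · rw [fderiv_fderiv_add (cs.add cv) cw, fderiv_fderiv_add cs cv, hds']
    simp only [add_apply, hv2, hw2]
    rw [base_decomp q (1, 0, z₀.2.1)]
    simp
    field_simp
    ring

/-! ### Transport of solutions and of their 2-jets -/

section PointTransformation

variable {Φ : OpenPartialHomeomorph Total Total}

theorem IsPointTransformation.contDiffAt (hΦ : IsPointTransformation Φ) {p : Total}
    (hp : p ∈ Φ.source) : ContDiffAt ℝ ∞ Φ p :=
  hΦ.1.contDiffAt (Φ.open_source.mem_nhds hp)

theorem IsPointTransformation.differentiableAt (hΦ : IsPointTransformation Φ) {p : Total}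
    (hp : p ∈ Φ.source) : DifferentiableAt ℝ Φ p :=
  (hΦ.contDiffAt hp).differentiableAt (by simp)

/-- Surjectivity of `DΦ` with an explicit preimage, on which the nondegeneracy arguments rest. -/
theorem IsPointTransformation.fderiv_symm_apply (hΦ : IsPointTransformation Φ) {p : Total}
    (hp : p ∈ Φ.source) (w : Total) :
    fderiv ℝ Φ p (fderiv ℝ Φ.symm (Φ p) w) = w := by
  have hq := Φ.map_source hp
  have h1 : HasFDerivAt Φ.symm (fderiv ℝ Φ.symm (Φ p)) (Φ p) :=
    ((hΦ.2.contDiffAt (Φ.open_target.mem_nhds hq)).differentiableAt (by simp)).hasFDerivAt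
  have h2 : HasFDerivAt Φ (fderiv ℝ Φ p) (Φ.symm (Φ p)) := by
    rw [Φ.left_inv hp]
    exact (hΦ.differentiableAt hp).hasFDerivAt
  have h3 : HasFDerivAt (fun q => q) ((fderiv ℝ Φ p).comp (fderiv ℝ Φ.symm (Φ p))) (Φ p) := by
    refine (h2.comp (Φ p) h1).congr_of_eventuallyEq ?_
    filter_upwards [Φ.open_target.mem_nhds hq] with q hq' using (Φ.right_inv hq').symm
  have h4 := h3.unique (hasFDerivAt_id (Φ p))
  exact congrArg (fun L : Total →L[ℝ] Total => L w) h4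

theorem contDiffOn_graphMap {u : Base → ℝ} {W : Set Base} (hu : ContDiffOn ℝ ∞ u W) :
    ContDiffOn ℝ ∞ (fun z => ((z, u z) : Total)) W :=
  contDiffOn_id.prodMk hu

theorem hasFDerivAt_graphMap {u : Base → ℝ} {z : Base} (hu : DifferentiableAt ℝ u z) :
    HasFDerivAt (fun z => ((z, u z) : Total))
      ((ContinuousLinearMap.id ℝ Base).prod (fderiv ℝ u z)) z :=
  (hasFDerivAt_id z).prodMk hu.hasFDerivAt

/-- A point symmetry maps the graph of a solution, if it is transversal to the fibres, locally
to the graph of a solution. -/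
theorem exists_image_solution (hΦ : Φ ∈ symmetryPseudogroup) {s : Base → ℝ} {W₀ : Set Base}
    (hs : IsSolutionOn s W₀) {z₀ : Base} (hz₀ : z₀ ∈ W₀) (hp : (z₀, s z₀) ∈ Φ.source)
    (hinj : ∀ ζ : Base, (fderiv ℝ Φ (z₀, s z₀) (ζ, fderiv ℝ s z₀ ζ)).1 = 0 → ζ = 0) :
    ∃ v : Base → ℝ, ContDiffAt ℝ ∞ v (Φ (z₀, s z₀)).1 ∧ kolmogorovOp v (Φ (z₀, s z₀)).1 = 0 ∧
      ∀ᶠ z in 𝓝 z₀, v (Φ (z, s z)).1 = (Φ (z, s z)).2 := by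
  obtain ⟨hΦs, hpres⟩ := hΦ
  set g : Base → Total := fun z => (z, s z) with hgdef
  set N : Set Base := W₀ ∩ g ⁻¹' Φ.source with hN
  have hgW := contDiffOn_graphMap hs.2.1
  have hNo : IsOpen N := hgW.continuousOn.isOpen_inter_preimage hs.1 Φ.open_source
  have hz₀N : z₀ ∈ N := ⟨hz₀, hp⟩
  have hΦg : ContDiffOn ℝ ∞ (fun z => Φ (g z)) N :=
    hΦs.1.comp (hgW.mono inter_subset_left) fun z hz => hz.2
  set F : Base → Base := fun z => (Φ (g z)).1 with hF
  set G : Base → ℝ := fun z => (Φ (g z)).2 with hG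
  have hFN : ContDiffOn ℝ ∞ F N := hΦg.fst
  have hGN : ContDiffOn ℝ ∞ G N := hΦg.snd
  have hFz := hFN.contDiffAt (hNo.mem_nhds hz₀N)
  have hds := (hs.2.1.contDiffAt (hs.1.mem_nhds hz₀)).differentiableAt (by simp)
  have hdF : ∀ ζ, fderiv ℝ F z₀ ζ = (fderiv ℝ Φ (z₀, s z₀) (ζ, fderiv ℝ s z₀ ζ)).1 := by
    intro ζ
    have h2 := ((hΦs.differentiableAt hp).hasFDerivAt.comp z₀ (hasFDerivAt_graphMap hds)).fst
    exact congrArg (fun L => L ζ) h2.fderiv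
  have hinj' : Function.Injective (fderiv ℝ F z₀ : Base →ₗ[ℝ] Base) := by
    rw [injective_iff_map_eq_zero]
    intro ζ hζ
    exact hinj ζ ((hdF ζ).symm.trans hζ)
  let L : Base ≃L[ℝ] Base :=
    (LinearEquiv.ofInjectiveEndo (fderiv ℝ F z₀ : Base →ₗ[ℝ] Base) hinj').toContinuousLinearEquiv
  have hL : (L : Base →L[ℝ] Base) = fderiv ℝ F z₀ := ContinuousLinearMap.ext fun ζ => rfl
  have hFd : HasFDerivAt F (L : Base →L[ℝ] Base) z₀ := by
    rw [hL]
    exact (hFz.differentiableAt (by simp)).hasFDerivAt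
  let e := hFz.toOpenPartialHomeomorph F hFd (by simp)
  have heF : ∀ z, e z = F z := fun z => rfl
  -- The local inverse `e.symm` is smooth at the points where `DF` is invertible. Restricting to
  -- this open set makes `v` smooth on all of `e '' W`, as the definition of preserving solutions
  -- requires.
  set R : Set Base := N ∩ fderiv ℝ F ⁻¹' range ((↑) : (Base ≃L[ℝ] Base) → Base →L[ℝ] Base)
  have hR : IsOpen R := (hFN.continuousOn_fderiv_of_isOpen hNo (by simp)).isOpen_inter_preimage
    hNo ContinuousLinearEquiv.isOpen
  set W : Set Base := e.source ∩ R with hWdef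
  have hW : IsOpen W := e.open_source.inter hR
  have hz₀W : z₀ ∈ W :=
    ⟨hFz.mem_toOpenPartialHomeomorph_source hFd (by simp), hz₀N, ⟨L, hL⟩⟩
  have hV : IsOpen (e '' W) := e.isOpen_image_of_subset_source hW inter_subset_left
  set v : Base → ℝ := fun z => G (e.symm z) with hv
  have hvF : ∀ z ∈ W, v (F z) = G z := by
    intro z hz
    rw [hv, ← heF]
    simp only [e.left_inv hz.1]
  have hvV : ContDiffOn ℝ ∞ v (e '' W) := by
    rintro _ ⟨z, hz, rfl⟩
    obtain ⟨L', hL'⟩ := hz.2.2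
    have hzz : e.symm (e z) = z := e.left_inv hz.1
    have hFz' := hFN.contDiffAt (hNo.mem_nhds hz.2.1)
    have h1 : ContDiffAt ℝ ∞ e.symm (e z) := by
      refine e.contDiffAt_symm (f₀' := L') (e.map_source hz.1) ?_ ?_
      · rw [hzz]
        change HasFDerivAt F (L' : Base →L[ℝ] Base) z
        rw [hL']
        exact (hFz'.differentiableAt (by simp)).hasFDerivAt
      · rw [hzz]
        exact hFz'
    have h2 : ContDiffAt ℝ ∞ G (e.symm (e z)) := by
      rw [hzz]
      exact hGN.contDiffAt (hNo.mem_nhds hz.2.1)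
    exact (h2.comp (e z) h1).contDiffWithinAt
  have hsub : graphOver s W ⊆ Φ.source := by
    rintro _ ⟨z, hz, rfl⟩
    exact hz.2.1.2
  have himg : Φ '' graphOver s W = graphOver v (e '' W) := by
    rw [graphOver, graphOver, image_image, image_image]
    refine image_congr fun z hz => ?_
    exact Prod.ext rfl (hvF z hz).symm
  have hWW : W ⊆ W₀ := fun z hz => hz.2.1.1
  have hsol := (hpres s v W (e '' W) hW hV (hs.2.1.mono hWW) hvV hsub himg).1 (hs.mono hWW hW)
  have hmem : F z₀ ∈ e '' W := ⟨z₀, hz₀W, rfl⟩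
  refine ⟨v, hvV.contDiffAt (hV.mem_nhds hmem), (isSolutionOn_iff.1 hsol).2.2 _ hmem, ?_⟩
  filter_upwards [hW.mem_nhds hz₀W] with z hz using hvF z hz

theorem fderiv_fderiv_graphMap {s : Base → ℝ} {z : Base} (hs : ContDiffAt ℝ 2 s z) (P : Base) :
    fderiv ℝ (fderiv ℝ (fun z => ((z, s z) : Total))) z P P
      = (0, fderiv ℝ (fderiv ℝ s) z P P) := by
  have hg : ContDiffAt ℝ 2 (fun z => ((z, s z) : Total)) z := contDiffAt_id.prodMk hs
  have h1 := fderiv_fderiv_clm_comp hg (ContinuousLinearMap.fst ℝ Base ℝ) P P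
  have h2 := fderiv_fderiv_clm_comp hg (ContinuousLinearMap.snd ℝ Base ℝ) P P
  have h3 : fderiv ℝ (fun z : Base => z) = fun _ => ContinuousLinearMap.id ℝ Base :=
    funext fun z => fderiv_fun_id
  refine Prod.ext ?_ ?_
  · refine h1.symm.trans ?_
    change fderiv ℝ (fderiv ℝ (fun z : Base => z)) z P P = 0
    simp [h3]
  · exact h2.symm

/-- The relation between the second-order jets of a solution and of its image. -/
theorem exists_image_jet (hΦ : Φ ∈ symmetryPseudogroup) {s : Base → ℝ} {W₀ : Set Base}
    (hs : IsSolutionOn s W₀) {z₀ : Base} (hz₀ : z₀ ∈ W₀) {p : Total} (hps : p = (z₀, s z₀))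
    (hp : p ∈ Φ.source) {q : Base →L[ℝ] ℝ} (hq : fderiv ℝ s z₀ = q)
    (hinj : ∀ ζ : Base, (fderiv ℝ Φ p (ζ, q ζ)).1 = 0 → ζ = 0) :
    ∃ Dv : Base →L[ℝ] ℝ,
      (∀ ζ : Base, Dv (fderiv ℝ Φ p (ζ, q ζ)).1 = (fderiv ℝ Φ p (ζ, q ζ)).2) ∧
      (fderiv ℝ Φ p (0, 1)).2 - Dv (fderiv ℝ Φ p (0, 1)).1 ≠ 0 ∧
      ∀ P : Base, (fderiv ℝ Φ p (P, q P)).1 = (0, 1, 0) →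
        Dv (1, 0, (Φ p).1.2.1) = (Φ p).1.2.1 ^ 3 *
          ((fderiv ℝ (fderiv ℝ Φ) p (P, q P) (P, q P)).2
              - Dv (fderiv ℝ (fderiv ℝ Φ) p (P, q P) (P, q P)).1
            + fderiv ℝ (fderiv ℝ s) z₀ P P
              * ((fderiv ℝ Φ p (0, 1)).2 - Dv (fderiv ℝ Φ p (0, 1)).1)) := by
  subst hps hq
  obtain ⟨v, hv, hv0, hvF⟩ := exists_image_solution hΦ hs hz₀ hp hinj
  set p : Total := (z₀, s z₀) with hpdef
  have cs := contDiffAt_two (hs.2.1.contDiffAt (hs.1.mem_nhds hz₀))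
  have cg : ContDiffAt ℝ 2 (fun z => ((z, s z) : Total)) z₀ := contDiffAt_id.prodMk cs
  have cΦ : ContDiffAt ℝ 2 Φ p := contDiffAt_two (hΦ.1.contDiffAt hp)
  have cΦg : ContDiffAt ℝ 2 (fun z => Φ (z, s z)) z₀ := cΦ.comp z₀ cg
  have cF : ContDiffAt ℝ 2 (fun z => (Φ (z, s z)).1) z₀ := cΦg.fst
  have cv := contDiffAt_two hv
  have dg : ∀ ζ, fderiv ℝ (fun z => ((z, s z) : Total)) z₀ ζ = (ζ, fderiv ℝ s z₀ ζ) := fun ζ =>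
    congrArg (fun L => L ζ) (hasFDerivAt_graphMap (cs.differentiableAt (by simp))).fderiv
  have hdΦg := (cΦ.differentiableAt (by simp)).hasFDerivAt.comp z₀
    (hasFDerivAt_graphMap (cs.differentiableAt (by simp)))
  have dF : ∀ ζ, fderiv ℝ (fun z => (Φ (z, s z)).1) z₀ ζ
      = (fderiv ℝ Φ p (ζ, fderiv ℝ s z₀ ζ)).1 := fun ζ =>
    congrArg (fun L => L ζ) hdΦg.fst.fderiv
  have dG : ∀ ζ, fderiv ℝ (fun z => (Φ (z, s z)).2) z₀ ζ
      = (fderiv ℝ Φ p (ζ, fderiv ℝ s z₀ ζ)).2 := fun ζ =>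
    congrArg (fun L => L ζ) hdΦg.snd.fderiv
  have d2 : ∀ P, fderiv ℝ (fderiv ℝ (fun z => Φ (z, s z))) z₀ P P
      = fderiv ℝ (fderiv ℝ Φ) p (P, fderiv ℝ s z₀ P) (P, fderiv ℝ s z₀ P)
        + fderiv ℝ (fderiv ℝ s) z₀ P P • fderiv ℝ Φ p (0, 1) := by
    intro P
    rw [fderiv_fderiv_comp (g := fun z => ((z, s z) : Total)) cΦ cg, dg,
      fderiv_fderiv_graphMap cs, ← map_smul]
    simp [hpdef]
  have d2F : ∀ P, fderiv ℝ (fderiv ℝ (fun z => (Φ (z, s z)).1)) z₀ P P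
      = (fderiv ℝ (fderiv ℝ (fun z => Φ (z, s z))) z₀ P P).1 := fun P =>
    fderiv_fderiv_clm_comp cΦg (ContinuousLinearMap.fst ℝ Base ℝ) P P
  have d2G : ∀ P, fderiv ℝ (fderiv ℝ (fun z => (Φ (z, s z)).2)) z₀ P P
      = (fderiv ℝ (fderiv ℝ (fun z => Φ (z, s z))) z₀ P P).2 := fun P =>
    fderiv_fderiv_clm_comp cΦg (ContinuousLinearMap.snd ℝ Base ℝ) P P
  have hvF' : (fun z => v (Φ (z, s z)).1) =ᶠ[𝓝 z₀] fun z => (Φ (z, s z)).2 := hvF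
  have hfirst : ∀ ζ : Base, fderiv ℝ v (Φ p).1 (fderiv ℝ Φ p (ζ, fderiv ℝ s z₀ ζ)).1
      = (fderiv ℝ Φ p (ζ, fderiv ℝ s z₀ ζ)).2 := by
    intro ζ
    rw [← dF, ← dG, ← hvF'.fderiv_eq]
    have := (cv.differentiableAt (by simp)).hasFDerivAt.comp z₀
      (cF.differentiableAt (by simp)).hasFDerivAt
    exact (congrArg (fun L => L ζ) this.fderiv).symm
  refine ⟨fderiv ℝ v (Φ p).1, hfirst, fun hκ => ?_, fun P hP => ?_⟩
  -- The functional `w ↦ w.2 - Dv w.1` kills the tangent space of the image graph. If it killed `DΦ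
  -- (0, 1)` too, it would vanish on the range of `DΦ`, which contains `(0, 1)`.
  · obtain ⟨⟨ζ, c⟩, hw⟩ : ∃ w, fderiv ℝ Φ p w = (0, 1) := ⟨_, hΦ.1.fderiv_symm_apply hp (0, 1)⟩
    have hdec : ((ζ, c) : Total)
        = (ζ, fderiv ℝ s z₀ ζ) + (c - fderiv ℝ s z₀ ζ) • ((0, 1) : Total) := by
      ext <;> simp
    rw [hdec, map_add, map_smul] at hw
    have h1 := congrArg (fun w : Total => w.2 - fderiv ℝ v (Φ p).1 w.1) hw
    simp only [Prod.fst_add, Prod.snd_add, Prod.smul_fst, Prod.smul_snd, map_add, map_smul,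
      hfirst, smul_eq_mul, map_zero] at h1
    have : (c - fderiv ℝ s z₀ ζ) * ((fderiv ℝ Φ p (0, 1)).2
        - fderiv ℝ v (Φ p).1 (fderiv ℝ Φ p (0, 1)).1) = 1 := by linarith
    rw [hκ] at this
    simp at this
  -- The second derivative of `v ∘ F = G` along `P`. As `DF P` is the `x`-direction, `v` enters to
  -- second order only through `v_xx`, which its equation expresses by first derivatives.
  · have h2 : fderiv ℝ (fderiv ℝ (fun z => (Φ (z, s z)).2)) z₀ P P
        = fderiv ℝ (fderiv ℝ v) (Φ p).1 (0, 1, 0) (0, 1, 0)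
          + fderiv ℝ v (Φ p).1 (fderiv ℝ (fderiv ℝ (fun z => (Φ (z, s z)).1)) z₀ P P) := by
      rw [← hvF'.fderiv.fderiv_eq, 
        fderiv_fderiv_comp (h := v) (g := fun z => (Φ (z, s z)).1) cv cF, dF, hP]
    rw [d2G, d2F, d2] at h2
    have h3 := hv0
    rw [kolmogorovOp, sub_eq_zero] at h3
    rw [h3]
    congr 1
    simp only [Prod.fst_add, Prod.snd_add, Prod.smul_fst, Prod.smul_snd, map_add, map_smul,
      smul_eq_mul] at h2
    linarith

end PointTransformation

/-! ### Coordinates of the total space and components of a map -/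

/-- The coordinate vectors of the space of all variables. -/
abbrev bT : Total := ((1, 0, 0), 0)

abbrev bX : Total := ((0, 1, 0), 0)

abbrev bY : Total := ((0, 0, 1), 0)

abbrev bU : Total := ((0, 0, 0), 1)

/-- The components of a map of the space of all variables. -/
def compT (Φ : Total → Total) (p : Total) : ℝ := (Φ p).1.1

def compX (Φ : Total → Total) (p : Total) : ℝ := (Φ p).1.2.1

def compY (Φ : Total → Total) (p : Total) : ℝ := (Φ p).1.2.2

def compU (Φ : Total → Total) (p : Total) : ℝ := (Φ p).2

theorem total_decomp {E : Type*} [NormedAddCommGroup E] [NormedSpace ℝ E] (L : Total →L[ℝ] E)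
    (w : Total) :
    L w = w.1.1 • L bT + w.1.2.1 • L bX + w.1.2.2 • L bY + w.2 • L bU := by
  have : w = w.1.1 • bT + w.1.2.1 • bX + w.1.2.2 • bY + w.2 • bU := by
    ext <;> simp
  conv_lhs => rw [this]
  simp only [map_add, map_smul]

section Components

variable {Φ : Total → Total} {p : Total}

/-- The coordinate functionals on the space of all variables. -/
noncomputable def tT : Total →L[ℝ] ℝ := dT.comp (ContinuousLinearMap.fst ℝ Base ℝ)

noncomputable def tX : Total →L[ℝ] ℝ := dX.comp (ContinuousLinearMap.fst ℝ Base ℝ)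

noncomputable def tY : Total →L[ℝ] ℝ := dY.comp (ContinuousLinearMap.fst ℝ Base ℝ)

noncomputable def tU : Total →L[ℝ] ℝ := ContinuousLinearMap.snd ℝ Base ℝ

theorem fderiv_clm_comp {E F G : Type*} [NormedAddCommGroup E] [NormedSpace ℝ E]
    [NormedAddCommGroup F] [NormedSpace ℝ F] [NormedAddCommGroup G] [NormedSpace ℝ G]
    {h : E → F} {x : E} (hh : DifferentiableAt ℝ h x) (L : F →L[ℝ] G) (w : E) :
    fderiv ℝ (fun y => L (h y)) x w = L (fderiv ℝ h x w) :=
  congrArg (fun M => M w) (L.hasFDerivAt.comp x hh.hasFDerivAt).fderiv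

theorem fderiv_compT (h : DifferentiableAt ℝ Φ p) (w : Total) :
    fderiv ℝ (compT Φ) p w = (fderiv ℝ Φ p w).1.1 := fderiv_clm_comp h tT w

theorem fderiv_compX (h : DifferentiableAt ℝ Φ p) (w : Total) :
    fderiv ℝ (compX Φ) p w = (fderiv ℝ Φ p w).1.2.1 := fderiv_clm_comp h tX w

theorem fderiv_compY (h : DifferentiableAt ℝ Φ p) (w : Total) :
    fderiv ℝ (compY Φ) p w = (fderiv ℝ Φ p w).1.2.2 := fderiv_clm_comp h tY w

theorem fderiv_compU (h : DifferentiableAt ℝ Φ p) (w : Total) :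
    fderiv ℝ (compU Φ) p w = (fderiv ℝ Φ p w).2 := fderiv_clm_comp h tU w

theorem fderiv_fderiv_compT (h : ContDiffAt ℝ 2 Φ p) (v w : Total) :
    fderiv ℝ (fderiv ℝ (compT Φ)) p v w = (fderiv ℝ (fderiv ℝ Φ) p v w).1.1 :=
  fderiv_fderiv_clm_comp h tT v w

theorem fderiv_fderiv_compX (h : ContDiffAt ℝ 2 Φ p) (v w : Total) :
    fderiv ℝ (fderiv ℝ (compX Φ)) p v w = (fderiv ℝ (fderiv ℝ Φ) p v w).1.2.1 :=
  fderiv_fderiv_clm_comp h tX v w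

theorem fderiv_fderiv_compY (h : ContDiffAt ℝ 2 Φ p) (v w : Total) :
    fderiv ℝ (fderiv ℝ (compY Φ)) p v w = (fderiv ℝ (fderiv ℝ Φ) p v w).1.2.2 :=
  fderiv_fderiv_clm_comp h tY v w

theorem fderiv_fderiv_compU (h : ContDiffAt ℝ 2 Φ p) (v w : Total) :
    fderiv ℝ (fderiv ℝ (compU Φ)) p v w = (fderiv ℝ (fderiv ℝ Φ) p v w).2 :=
  fderiv_fderiv_clm_comp h tU v w

theorem contDiffOn_compT {s : Set Total} (h : ContDiffOn ℝ ∞ Φ s) :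
    ContDiffOn ℝ ∞ (compT Φ) s := tT.contDiff.comp_contDiffOn h

theorem contDiffOn_compX {s : Set Total} (h : ContDiffOn ℝ ∞ Φ s) :
    ContDiffOn ℝ ∞ (compX Φ) s := tX.contDiff.comp_contDiffOn h

theorem contDiffOn_compY {s : Set Total} (h : ContDiffOn ℝ ∞ Φ s) :
    ContDiffOn ℝ ∞ (compY Φ) s := tY.contDiff.comp_contDiffOn h

theorem contDiffOn_compU {s : Set Total} (h : ContDiffOn ℝ ∞ Φ s) :
    ContDiffOn ℝ ∞ (compU Φ) s := tU.contDiff.comp_contDiffOn h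

end Components

/-! ### Elimination, first stage: `T` and `Y`, and the equations for image jets -/

section Determining

variable {Φ : OpenPartialHomeomorph Total Total}

/-- The points of the domain where neither `x` nor its image vanishes. -/
def regularSet (Φ : OpenPartialHomeomorph Total Total) : Set Total :=
  {p | p ∈ Φ.source ∧ p.1.2.1 ≠ 0 ∧ (Φ p).1.2.1 ≠ 0}

theorem isOpen_regularSet (Φ : OpenPartialHomeomorph Total Total) : IsOpen (regularSet Φ) := by
  have h1 : IsOpen {p : Total | p.1.2.1 ≠ 0} := isOpen_ne_fun (by fun_prop) (by fun_prop)
  have h2 := Φ.isOpen_inter_preimage h1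
  have h3 : regularSet Φ = (Φ.source ∩ Φ ⁻¹' {p : Total | p.1.2.1 ≠ 0})
      ∩ {p : Total | p.1.2.1 ≠ 0} := by
    ext p
    simp only [regularSet, mem_ofPred_eq, mem_inter_iff, mem_preimage]
    tauto
  rw [h3]
  exact h2.inter h1

/-- A transversal gradient and a direction mapped to the direction of the `x`-axis. -/
theorem direction_eq (hΦ : Φ ∈ symmetryPseudogroup) {p : Total} (hp : p ∈ regularSet Φ)
    {q : Base →L[ℝ] ℝ} (hinj : ∀ ζ : Base, (fderiv ℝ Φ p (ζ, q ζ)).1 = 0 → ζ = 0) :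
    (fderiv ℝ Φ p (bX + q (0, 1, 0) • bU)).1.1 = 0 ∧
      (fderiv ℝ Φ p (bX + q (0, 1, 0) • bU)).1.2.2 = 0 := by
  obtain ⟨hps, hx, hX⟩ := hp
  let M : Base →L[ℝ] Base := (ContinuousLinearMap.fst ℝ Base ℝ).comp
    ((fderiv ℝ Φ p).comp ((ContinuousLinearMap.id ℝ Base).prod q))
  have hM : ∀ ζ, M ζ = (fderiv ℝ Φ p (ζ, q ζ)).1 := fun ζ => rfl
  have hMi : Function.Injective (M : Base →ₗ[ℝ] Base) := by
    rw [injective_iff_map_eq_zero]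
    exact fun ζ hζ => hinj ζ hζ
  have hMs : Function.Surjective (M : Base →ₗ[ℝ] Base) := LinearMap.injective_iff_surjective.1 hMi
  obtain ⟨P, hP⟩ := hMs (0, 1, 0)
  replace hP : (fderiv ℝ Φ p (P, q P)).1 = (0, 1, 0) := hP
  have hmem : p.1 ∈ sameSide p.1.2.1 := mul_self_pos.2 hx
  -- Two solutions with the same 1-jet at `p` have images with the same gradient, so the left sides
  -- of the two second-order relations agree. Their difference is `a P_t² + b P_y²` times nonzero
  -- factors, for arbitrary `a` and `b`.
  have key : ∀ a b : ℝ, a * P.1 ^ 2 + b * P.2.2 ^ 2 = 0 := by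
    intro a b
    obtain ⟨s, hs, hs0, hs1, hs2⟩ := exists_solution_jet hx p.2 q 0 0
    obtain ⟨s', hs', hs0', hs1', hs2'⟩ := exists_solution_jet hx p.2 q a b
    obtain ⟨D, h1, h2, h3⟩ := exists_image_jet (p := p) hΦ hs hmem (Prod.ext rfl hs0.symm) hps hs1 hinj
    obtain ⟨D', h1', h2', h3'⟩ :=
      exists_image_jet (p := p) hΦ hs' hmem (Prod.ext rfl hs0'.symm) hps hs1' hinj
    have hDD : D' = D := by
      refine ContinuousLinearMap.ext fun z => ?_
      obtain ⟨ζ, rfl⟩ := hMs z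
      exact (h1' ζ).trans (h1 ζ).symm
    subst hDD
    have e1 := h3 P hP
    have e2 := h3' P hP
    rw [hs2] at e1
    rw [hs2', e1] at e2
    have e3 := mul_left_cancel₀ (pow_ne_zero 3 hX) e2
    have e4 : (a * P.1 ^ 2 + b * P.2.2 ^ 2) * ((fderiv ℝ Φ p (0, 1)).2
        - D' (fderiv ℝ Φ p (0, 1)).1) = 0 := by linear_combination -e3
    exact (mul_eq_zero.1 e4).resolve_right h2
  have hPt : P.1 = 0 := by simpa using key 1 0
  have hPy : P.2.2 = 0 := by simpa using key 0 1
  have hPe : ((P, q P) : Total) = P.2.1 • (bX + q (0, 1, 0) • bU) := by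
    have : q P = P.2.1 * q (0, 1, 0) := by
      rw [base_decomp q P, hPt, hPy]
      ring
    refine Prod.ext (Prod.ext ?_ (Prod.ext ?_ ?_)) ?_ <;> simp [hPt, hPy, this]
  rw [hPe, map_smul] at hP
  have c1 := congrArg (fun z : Base => z.1) hP
  have c2 := congrArg (fun z : Base => z.2.1) hP
  have c3 := congrArg (fun z : Base => z.2.2) hP
  simp only [Prod.smul_fst, Prod.smul_snd, smul_eq_mul] at c1 c2 c3
  have hne : P.2.1 ≠ 0 := by
    intro h
    rw [h] at c2
    simp at c2
  exact ⟨(mul_eq_zero.1 c1).resolve_left hne, (mul_eq_zero.1 c3).resolve_left hne⟩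

/-- Two transversal gradients that differ by a multiple of `dx`. -/
theorem exists_transversal (hΦ : IsPointTransformation Φ) {p : Total} (hp : p ∈ Φ.source) :
    ∃ (q : Base →L[ℝ] ℝ) (ε : ℝ), ε ≠ 0 ∧
      (∀ ζ : Base, (fderiv ℝ Φ p (ζ, q ζ)).1 = 0 → ζ = 0) ∧
      (∀ ζ : Base, (fderiv ℝ Φ p (ζ, (q + ε • dX) ζ)).1 = 0 → ζ = 0) := by
  set n : Total := fderiv ℝ Φ.symm (Φ p) (0, 1) with hn
  have hn1 : fderiv ℝ Φ p n = (0, 1) := hΦ.fderiv_symm_apply hp (0, 1)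
  have hinjective : ∀ w, fderiv ℝ Φ p w = 0 → w = 0 := by
    have hs : Function.Surjective (fderiv ℝ Φ p : Total →ₗ[ℝ] Total) := fun w =>
      ⟨_, hΦ.fderiv_symm_apply hp w⟩
    have hi := LinearMap.injective_iff_surjective.2 hs
    exact fun w hw => (injective_iff_map_eq_zero _).1 hi w hw
  -- `n` spans the direction that `DΦ` makes vertical; transversality can fail only if the tangent
  -- space of the graph contains `n`.
  have good : ∀ q : Base →L[ℝ] ℝ, q n.1 ≠ n.2 →
      ∀ ζ : Base, (fderiv ℝ Φ p (ζ, q ζ)).1 = 0 → ζ = 0 := by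
    intro q hq ζ hζ
    set c := (fderiv ℝ Φ p (ζ, q ζ)).2
    have h1 : fderiv ℝ Φ p ((ζ, q ζ) - c • n) = 0 := by
      rw [map_sub, map_smul, hn1]
      refine Prod.ext ?_ ?_
      · simp [hζ]
      · simp [c]
    have h2 := sub_eq_zero.1 (hinjective _ h1)
    have h3 : ζ = c • n.1 := congrArg Prod.fst h2
    have h4 : q ζ = c * n.2 := congrArg Prod.snd h2
    rw [h3, map_smul, smul_eq_mul] at h4
    have h5 : c = 0 := by
      by_contra hc
      exact hq (mul_left_cancel₀ hc h4)
    rw [h3, h5, zero_smul]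
  obtain ⟨q, hq⟩ : ∃ q : Base →L[ℝ] ℝ, q n.1 ≠ n.2 := by
    by_contra! h
    have h0 := h 0
    have h1 := h dT
    have h2 := h dX
    have h3 := h dY
    simp only [zero_apply, dT_apply, dX_apply, dY_apply] at h0 h1 h2 h3
    have hn0 : n = 0 :=
      Prod.ext (Prod.ext (h1.trans h0.symm) (Prod.ext (h2.trans h0.symm) (h3.trans h0.symm)))
        h0.symm
    rw [hn0, map_zero] at hn1
    simpa using congrArg Prod.snd hn1
  -- The condition `(q + ε • dX) n.1 = n.2` is affine in `ε` and fails at `ε = 0`, so it cannot hold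
  -- for both `ε = 1` and `ε = 2`.
  by_cases h1 : (q + (1 : ℝ) • dX) n.1 = n.2
  · refine ⟨q, 2, two_ne_zero, good q hq, good _ fun h2 => hq ?_⟩
    simp only [add_apply, smul_apply, smul_eq_mul, dX_apply] at h1 h2
    linarith
  · exact ⟨q, 1, one_ne_zero, good q hq, good _ h1⟩

/-- The new variables `t` and `y` depend only on the old ones. -/
theorem vertical_derivatives (hΦ : Φ ∈ symmetryPseudogroup) {p : Total}
    (hp : p ∈ regularSet Φ) :
    fderiv ℝ (compT Φ) p bX = 0 ∧ fderiv ℝ (compT Φ) p bU = 0 ∧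
      fderiv ℝ (compY Φ) p bX = 0 ∧ fderiv ℝ (compY Φ) p bU = 0 := by
  have hd := hΦ.1.differentiableAt hp.1
  simp only [fderiv_compT hd, fderiv_compY hd]
  obtain ⟨q, ε, hε, h1, h2⟩ := exists_transversal hΦ.1 hp.1
  obtain ⟨a1, a2⟩ := direction_eq hΦ hp h1
  obtain ⟨b1, b2⟩ := direction_eq hΦ hp h2
  simp only [map_add, map_smul, Prod.fst_add, Prod.snd_add, Prod.smul_fst, Prod.smul_snd,
    smul_eq_mul, add_apply, smul_apply, dX_apply, mul_one] at a1 a2 b1 b2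
  have c1 : (fderiv ℝ Φ p bU).1.1 = 0 := by
    refine (mul_eq_zero.1 (?_ : ε * _ = 0)).resolve_left hε
    linear_combination b1 - a1
  have c2 : (fderiv ℝ Φ p bU).1.2.2 = 0 := by
    refine (mul_eq_zero.1 (?_ : ε * _ = 0)).resolve_left hε
    linear_combination b2 - a2
  rw [c1] at a1
  rw [c2] at a2
  exact ⟨by linarith, c1, by linarith, c2⟩

/-- The Jacobian of `(t, y)` does not vanish. -/
theorem jacobian_ne_zero (hΦ : IsPointTransformation Φ) {p : Total} (hp : p ∈ Φ.source)
    (h : fderiv ℝ (compT Φ) p bX = 0 ∧ fderiv ℝ (compT Φ) p bU = 0 ∧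
      fderiv ℝ (compY Φ) p bX = 0 ∧ fderiv ℝ (compY Φ) p bU = 0) :
    fderiv ℝ (compT Φ) p bT * fderiv ℝ (compY Φ) p bY
      - fderiv ℝ (compT Φ) p bY * fderiv ℝ (compY Φ) p bT ≠ 0 := by
  have hd := hΦ.differentiableAt hp
  obtain ⟨h1, h2, h3, h4⟩ := h
  have key : ∀ w : Total, ∃ a b : ℝ,
      a * fderiv ℝ (compT Φ) p bT + b * fderiv ℝ (compT Φ) p bY = w.1.1 ∧
      a * fderiv ℝ (compY Φ) p bT + b * fderiv ℝ (compY Φ) p bY = w.1.2.2 := by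
    intro w
    set v := fderiv ℝ Φ.symm (Φ p) w
    have hv : fderiv ℝ Φ p v = w := hΦ.fderiv_symm_apply hp w
    have e1 := total_decomp (fderiv ℝ (compT Φ) p) v
    have e2 := total_decomp (fderiv ℝ (compY Φ) p) v
    rw [fderiv_compT hd, hv, h1, h2] at e1
    rw [fderiv_compY hd, hv, h3, h4] at e2
    refine ⟨v.1.1, v.1.2.2, ?_, ?_⟩
    · rw [e1]; simp
    · rw [e2]; simp
  obtain ⟨a, b, k1, k2⟩ := key bT
  obtain ⟨c, d, k3, k4⟩ := key bY
  intro h0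
  have : (a * d - b * c) * (fderiv ℝ (compT Φ) p bT * fderiv ℝ (compY Φ) p bY
      - fderiv ℝ (compT Φ) p bY * fderiv ℝ (compY Φ) p bT) = 1 := by
    simp only at k1 k2 k3 k4
    generalize fderiv ℝ (compT Φ) p bT = A at *
    generalize fderiv ℝ (compT Φ) p bY = B at *
    generalize fderiv ℝ (compY Φ) p bT = C at *
    generalize fderiv ℝ (compY Φ) p bY = D at *
    linear_combination (c * C + d * D) * k1 + k4 - (c * A + d * B) * k2
  rw [h0, mul_zero] at this
  exact zero_ne_one this

/-- The equations for the first derivatives of the image of a solution. -/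
theorem image_jet_equations (hΦ : Φ ∈ symmetryPseudogroup) {p : Total} (hp : p ∈ regularSet Φ)
    (qt qx qy : ℝ) (hE : fderiv ℝ (compX Φ) p bX + qx * fderiv ℝ (compX Φ) p bU ≠ 0) :
    ∃ vT vX vY : ℝ,
      vT * fderiv ℝ (compT Φ) p bT + vX * (fderiv ℝ (compX Φ) p bT + qt * fderiv ℝ (compX Φ) p bU)
        + vY * fderiv ℝ (compY Φ) p bT = fderiv ℝ (compU Φ) p bT + qt * fderiv ℝ (compU Φ) p bU ∧
      vX * (fderiv ℝ (compX Φ) p bX + qx * fderiv ℝ (compX Φ) p bU)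
        = fderiv ℝ (compU Φ) p bX + qx * fderiv ℝ (compU Φ) p bU ∧
      vT * fderiv ℝ (compT Φ) p bY + vX * (fderiv ℝ (compX Φ) p bY + qy * fderiv ℝ (compX Φ) p bU)
        + vY * fderiv ℝ (compY Φ) p bY = fderiv ℝ (compU Φ) p bY + qy * fderiv ℝ (compU Φ) p bU ∧
      fderiv ℝ (compU Φ) p bU - vX * fderiv ℝ (compX Φ) p bU ≠ 0 ∧
      (fderiv ℝ (compX Φ) p bX + qx * fderiv ℝ (compX Φ) p bU) ^ 2 * (vT + compX Φ p * vY)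
        = compX Φ p ^ 3 *
          (fderiv ℝ (fderiv ℝ (compU Φ)) p (bX + qx • bU) (bX + qx • bU)
            - vX * fderiv ℝ (fderiv ℝ (compX Φ)) p (bX + qx • bU) (bX + qx • bU)
            + (qt + p.1.2.1 * qy) / p.1.2.1 ^ 3
              * (fderiv ℝ (compU Φ) p bU - vX * fderiv ℝ (compX Φ) p bU)) := by
  have hd := hΦ.1.differentiableAt hp.1
  have hc := contDiffAt_two (hΦ.1.contDiffAt hp.1)
  have hO := isOpen_regularSet Φ
  have hcO : ∀ p' ∈ regularSet Φ, ContDiffAt ℝ 2 Φ p' := fun p' hp' =>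
    contDiffAt_two (hΦ.1.contDiffAt hp'.1)
  have hcT : ∀ p' ∈ regularSet Φ, ContDiffAt ℝ 2 (compT Φ) p' := fun p' hp' =>
    tT.contDiff.contDiffAt.comp p' (hcO p' hp')
  have hcY : ∀ p' ∈ regularSet Φ, ContDiffAt ℝ 2 (compY Φ) p' := fun p' hp' =>
    tY.contDiff.contDiffAt.comp p' (hcO p' hp')
  have hTX := fderiv_fderiv_eq_zero hO hcT (fun p' h => (vertical_derivatives hΦ h).1) hp
  have hTU := fderiv_fderiv_eq_zero hO hcT (fun p' h => (vertical_derivatives hΦ h).2.1) hp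
  have hYX := fderiv_fderiv_eq_zero hO hcY (fun p' h => (vertical_derivatives hΦ h).2.2.1) hp
  have hYU := fderiv_fderiv_eq_zero hO hcY (fun p' h => (vertical_derivatives hΦ h).2.2.2) hp
  have hv := vertical_derivatives hΦ hp
  have hJ := jacobian_ne_zero hΦ.1 hp.1 hv
  obtain ⟨v1, v2, v3, v4⟩ := hv
  obtain ⟨hps, hx, hX⟩ := hp
  set q : Base →L[ℝ] ℝ := qt • dT + qx • dX + qy • dY with hqdef
  have hq : ∀ ζ, q ζ = qt * ζ.1 + qx * ζ.2.1 + qy * ζ.2.2 := fun ζ => by simp [hqdef]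
  have comps : ∀ w : Total,
      (fderiv ℝ Φ p w).1.1
        = w.1.1 * fderiv ℝ (compT Φ) p bT + w.1.2.2 * fderiv ℝ (compT Φ) p bY ∧
      (fderiv ℝ Φ p w).1.2.1
        = w.1.1 * fderiv ℝ (compX Φ) p bT + w.1.2.1 * fderiv ℝ (compX Φ) p bX
          + w.1.2.2 * fderiv ℝ (compX Φ) p bY + w.2 * fderiv ℝ (compX Φ) p bU ∧
      (fderiv ℝ Φ p w).1.2.2
        = w.1.1 * fderiv ℝ (compY Φ) p bT + w.1.2.2 * fderiv ℝ (compY Φ) p bY ∧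
      (fderiv ℝ Φ p w).2
        = w.1.1 * fderiv ℝ (compU Φ) p bT + w.1.2.1 * fderiv ℝ (compU Φ) p bX
          + w.1.2.2 * fderiv ℝ (compU Φ) p bY + w.2 * fderiv ℝ (compU Φ) p bU := by
    intro w
    rw [← fderiv_compT hd, ← fderiv_compX hd, ← fderiv_compY hd, ← fderiv_compU hd,
      total_decomp (fderiv ℝ (compT Φ) p), total_decomp (fderiv ℝ (compX Φ) p),
      total_decomp (fderiv ℝ (compY Φ) p), total_decomp (fderiv ℝ (compU Φ) p), v1, v2, v3, v4]
    simp only [smul_eq_mul]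
    refine ⟨by ring, trivial, by ring, trivial⟩
  have hinj : ∀ ζ : Base, (fderiv ℝ Φ p (ζ, q ζ)).1 = 0 → ζ = 0 := by
    intro ζ hζ
    obtain ⟨c1, c2, c3, -⟩ := comps (ζ, q ζ)
    rw [hζ] at c1 c2 c3
    simp only [Prod.fst_zero, Prod.snd_zero, hq] at c1 c2 c3
    have z1 : ζ.1 = 0 := by
      refine (mul_eq_zero.1 (?_ : ζ.1 * _ = 0)).resolve_right hJ
      linear_combination -fderiv ℝ (compY Φ) p bY * c1 + fderiv ℝ (compT Φ) p bY * c3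
    have z3 : ζ.2.2 = 0 := by
      refine (mul_eq_zero.1 (?_ : ζ.2.2 * _ = 0)).resolve_right hJ
      linear_combination fderiv ℝ (compY Φ) p bT * c1 - fderiv ℝ (compT Φ) p bT * c3
    rw [z1, z3] at c2
    have z2 : ζ.2.1 = 0 := by
      refine (mul_eq_zero.1 (?_ : ζ.2.1 * _ = 0)).resolve_right hE
      linear_combination -c2
    exact Prod.ext z1 (Prod.ext z2 z3)
  obtain ⟨s, hs, hs0, hs1, hs2⟩ := exists_solution_jet hx p.2 q 0 0
  have hmem : p.1 ∈ sameSide p.1.2.1 := mul_self_pos.2 hx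
  obtain ⟨D, h1, h2, h3⟩ := exists_image_jet (p := p) hΦ hs hmem (Prod.ext rfl hs0.symm) hps hs1 hinj
  have hD : ∀ w : Total, D (fderiv ℝ Φ p w).1 =
      (fderiv ℝ Φ p w).1.1 * D (1, 0, 0) + (fderiv ℝ Φ p w).1.2.1 * D (0, 1, 0)
        + (fderiv ℝ Φ p w).1.2.2 * D (0, 0, 1) := fun w => base_decomp D _
  refine ⟨D (1, 0, 0), D (0, 1, 0), D (0, 0, 1), ?_, ?_, ?_, ?_, ?_⟩
  · have := h1 (1, 0, 0)
    rw [hD] at this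
    obtain ⟨c1, c2, c3, c4⟩ := comps ((1, 0, 0), q (1, 0, 0))
    rw [c1, c2, c3, c4, hq] at this
    linear_combination this
  · have := h1 (0, 1, 0)
    rw [hD] at this
    obtain ⟨c1, c2, c3, c4⟩ := comps ((0, 1, 0), q (0, 1, 0))
    rw [c1, c2, c3, c4, hq] at this
    linear_combination this
  · have := h1 (0, 0, 1)
    rw [hD] at this
    obtain ⟨c1, c2, c3, c4⟩ := comps ((0, 0, 1), q (0, 0, 1))
    rw [c1, c2, c3, c4, hq] at this
    linear_combination this
  · intro h0
    apply h2
    obtain ⟨c1, c2, c3, c4⟩ := comps (0, 1)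
    rw [hD, c1, c2, c3, c4]
    simp only [Prod.fst_zero, Prod.snd_zero]
    linear_combination h0
  -- The lift `∂x + qx ∂u` of the `x`-direction leaves `T` and `Y` unchanged and moves `X` at rate
  -- `E`, so `P = (0, E⁻¹, 0)` is the direction needed. The second derivatives of `T` and `Y` along
  -- this lift vanish as well.
  · set E := fderiv ℝ (compX Φ) p bX + qx * fderiv ℝ (compX Φ) p bU with hEdef
    have hη : (((0, E⁻¹, 0), q (0, E⁻¹, 0)) : Total) = E⁻¹ • (bX + qx • bU) := by
      rw [hq]
      refine Prod.ext (Prod.ext ?_ (Prod.ext ?_ ?_)) ?_ <;> simp [mul_comm]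
    have hP : (fderiv ℝ Φ p ((0, E⁻¹, 0), q (0, E⁻¹, 0))).1 = (0, 1, 0) := by
      obtain ⟨c1, c2, c3, c4⟩ := comps ((0, E⁻¹, 0), q (0, E⁻¹, 0))
      refine Prod.ext ?_ (Prod.ext ?_ ?_)
      · rw [c1]; simp
      · rw [c2, hq]
        simp only
        field_simp
        rw [hEdef]
        ring
      · rw [c3]; simp
    have h4 := h3 (0, E⁻¹, 0) hP
    obtain ⟨c1, c2, c3, c4⟩ := comps (0, 1)
    rw [hη, base_decomp D, base_decomp D (fderiv ℝ (fderiv ℝ Φ) p _ _).1, hs2, hD, c1, c2, c3, c4,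
      ← fderiv_fderiv_compT hc, ← fderiv_fderiv_compX hc, ← fderiv_fderiv_compY hc,
      ← fderiv_fderiv_compU hc] at h4
    have zT : fderiv ℝ (fderiv ℝ (compT Φ)) p (E⁻¹ • (bX + qx • bU)) = 0 := by
      rw [map_smul, map_add, map_smul, hTX, hTU]; simp
    have zY : fderiv ℝ (fderiv ℝ (compY Φ)) p (E⁻¹ • (bX + qx • bU)) = 0 := by
      rw [map_smul, map_add, map_smul, hYX, hYU]; simp
    rw [zT, zY] at h4
    generalize hη' : (bX + qx • bU : Total) = η at *
    simp only [map_smul, smul_apply, zero_apply, hq, smul_eq_mul, Prod.fst_zero,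
      Prod.snd_zero] at h4
    have hXX : (Φ p).1.2.1 = compX Φ p := rfl
    rw [hXX] at h4
    rw [show D (1, 0, 0) + compX Φ p * D (0, 0, 1)
      = 1 * D (1, 0, 0) + 0 * D (0, 1, 0) + compX Φ p * D (0, 0, 1) by ring, h4]
    field_simp
    ring

end Determining

/-! ### Elimination, second stage: the form of `X` and the equation for `U` -/

section Determining

variable {Φ : OpenPartialHomeomorph Total Total}

/-- If both vanished, a preimage of `bX` under `DΦ` would have zero `t`- and `y`-components by the
Jacobian of `(T, Y)`, and then its image would have no `x`-component. -/
theorem compX_bX_or_bU_ne_zero (hΦ : IsPointTransformation Φ) {p : Total} (hp : p ∈ Φ.source)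
    (h : fderiv ℝ (compT Φ) p bX = 0 ∧ fderiv ℝ (compT Φ) p bU = 0 ∧
      fderiv ℝ (compY Φ) p bX = 0 ∧ fderiv ℝ (compY Φ) p bU = 0) :
    fderiv ℝ (compX Φ) p bX ≠ 0 ∨ fderiv ℝ (compX Φ) p bU ≠ 0 := by
  have hJ := jacobian_ne_zero hΦ hp h
  have hd := hΦ.differentiableAt hp
  obtain ⟨h1, h2, h3, h4⟩ := h
  by_contra! h0
  set v := fderiv ℝ Φ.symm (Φ p) bX
  have hv : fderiv ℝ Φ p v = bX := hΦ.fderiv_symm_apply hp bX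
  have e1 := total_decomp (fderiv ℝ (compT Φ) p) v
  have e2 := total_decomp (fderiv ℝ (compY Φ) p) v
  have e3 := total_decomp (fderiv ℝ (compX Φ) p) v
  rw [fderiv_compT hd, hv, h1, h2] at e1
  rw [fderiv_compY hd, hv, h3, h4] at e2
  rw [fderiv_compX hd, hv, h0.1, h0.2] at e3
  simp only [smul_eq_mul, mul_zero, add_zero] at e1 e2 e3
  have z1 : v.1.1 = 0 := by
    refine (mul_eq_zero.1 (?_ : v.1.1 * _ = 0)).resolve_right hJ
    linear_combination -fderiv ℝ (compY Φ) p bY * e1 + fderiv ℝ (compT Φ) p bY * e2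
  have z2 : v.1.2.2 = 0 := by
    refine (mul_eq_zero.1 (?_ : v.1.2.2 * _ = 0)).resolve_right hJ
    linear_combination fderiv ℝ (compY Φ) p bT * e1 - fderiv ℝ (compT Φ) p bT * e2
  rw [z1, z2] at e3
  simp at e3

/-- The conditions obtained by varying the derivatives of a solution in `t` and `y`. -/
theorem image_x_relations (hΦ : Φ ∈ symmetryPseudogroup) {p : Total} (hp : p ∈ regularSet Φ)
    (q : ℝ) (hE : fderiv ℝ (compX Φ) p bX + q * fderiv ℝ (compX Φ) p bU ≠ 0) :
    (fderiv ℝ (compY Φ) p bY - compX Φ p * fderiv ℝ (compT Φ) p bY)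
        * (fderiv ℝ (compX Φ) p bX + q * fderiv ℝ (compX Φ) p bU) ^ 2 * p.1.2.1 ^ 3
      = compX Φ p ^ 3 * (fderiv ℝ (compT Φ) p bT * fderiv ℝ (compY Φ) p bY
        - fderiv ℝ (compT Φ) p bY * fderiv ℝ (compY Φ) p bT) ∧
    (compX Φ p * fderiv ℝ (compT Φ) p bT - fderiv ℝ (compY Φ) p bT)
        * (fderiv ℝ (compX Φ) p bX + q * fderiv ℝ (compX Φ) p bU) ^ 2 * p.1.2.1 ^ 3
      = compX Φ p ^ 3 * p.1.2.1 * (fderiv ℝ (compT Φ) p bT * fderiv ℝ (compY Φ) p bY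
        - fderiv ℝ (compT Φ) p bY * fderiv ℝ (compY Φ) p bT) := by
  -- Three jets with equal `u_x`, hence with equal `vX`. Their differences remove the second
  -- derivatives of `U` and `X`; Cramer's rule for the differences of `vT` and `vY` and cancellation
  -- of `κ ≠ 0` give the relations.
  obtain ⟨vT, vX, vY, a1, a2, a3, a4, a5⟩ := image_jet_equations hΦ hp 0 q 0 hE
  obtain ⟨vT', vX', vY', b1, b2, b3, b4, b5⟩ := image_jet_equations hΦ hp 1 q 0 hE
  obtain ⟨vT'', vX'', vY'', c1, c2, c3, c4, c5⟩ := image_jet_equations hΦ hp 0 q 1 hE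
  have hx := hp.2.1
  have e1 : vX' = vX := mul_right_cancel₀ hE (b2.trans a2.symm)
  have e2 : vX'' = vX := mul_right_cancel₀ hE (c2.trans a2.symm)
  subst e1 e2
  generalize fderiv ℝ (fderiv ℝ (compU Φ)) p (bX + q • bU) (bX + q • bU) = M at *
  generalize fderiv ℝ (fderiv ℝ (compX Φ)) p (bX + q • bU) (bX + q • bU) = N at *
  generalize fderiv ℝ (compX Φ) p bX + q * fderiv ℝ (compX Φ) p bU = E at *
  generalize fderiv ℝ (compT Φ) p bT = Tt at *
  generalize fderiv ℝ (compT Φ) p bY = Ty at *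
  generalize fderiv ℝ (compY Φ) p bT = Yt at *
  generalize fderiv ℝ (compY Φ) p bY = Yy at *
  generalize compX Φ p = X at *
  generalize p.1.2.1 = x at *
  set κ := fderiv ℝ (compU Φ) p bU - vX'' * fderiv ℝ (compX Φ) p bU with hκ
  have f1 : (vT' - vT) * Tt + (vY' - vY) * Yt = κ := by linear_combination b1 - a1
  have f2 : (vT' - vT) * Ty + (vY' - vY) * Yy = 0 := by linear_combination b3 - a3
  have f3 : E ^ 2 * ((vT' - vT) + X * (vY' - vY)) * x ^ 3 = X ^ 3 * κ := by
    field_simp at a5 b5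
    linear_combination b5 - a5
  have g1 : (vT'' - vT) * Tt + (vY'' - vY) * Yt = 0 := by linear_combination c1 - a1
  have g2 : (vT'' - vT) * Ty + (vY'' - vY) * Yy = κ := by linear_combination c3 - a3
  have g3 : E ^ 2 * ((vT'' - vT) + X * (vY'' - vY)) * x ^ 3 = X ^ 3 * κ * x := by
    field_simp at a5 c5
    linear_combination c5 - a5
  constructor
  · apply mul_left_cancel₀ a4
    linear_combination (Tt * Yy - Ty * Yt) * f3 - E ^ 2 * x ^ 3 * (Yy - X * Ty) * f1
      + E ^ 2 * x ^ 3 * (Yt - X * Tt) * f2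
  · apply mul_left_cancel₀ a4
    linear_combination (Tt * Yy - Ty * Yt) * g3 - E ^ 2 * x ^ 3 * (Yy - X * Ty) * g1
      + E ^ 2 * x ^ 3 * (Yt - X * Tt) * g2

/-- If `X_u ≠ 0`, the slope `q` can give `E = X_x + q X_u` any value. The first of
`image_x_relations` has a right side free of `E`, so `E = 1` and `E = 2` together make that side
zero. -/
theorem compX_bU_eq_zero (hΦ : Φ ∈ symmetryPseudogroup) {p : Total} (hp : p ∈ regularSet Φ) :
    fderiv ℝ (compX Φ) p bU = 0 := by
  have hJ := jacobian_ne_zero hΦ.1 hp.1 (vertical_derivatives hΦ hp)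
  by_contra hb
  have hE : ∀ e : ℝ, fderiv ℝ (compX Φ) p bX
      + (e - fderiv ℝ (compX Φ) p bX) / fderiv ℝ (compX Φ) p bU * fderiv ℝ (compX Φ) p bU = e := by
    intro e
    field_simp
    ring
  have h1 := (image_x_relations hΦ hp _ (by rw [hE 1]; exact one_ne_zero)).1
  have h2 := (image_x_relations hΦ hp _ (by rw [hE 2]; exact two_ne_zero)).1
  rw [hE] at h1 h2
  have h3 : compX Φ p ^ 3 * (fderiv ℝ (compT Φ) p bT * fderiv ℝ (compY Φ) p bY
        - fderiv ℝ (compT Φ) p bY * fderiv ℝ (compY Φ) p bT) = 0 := by linarith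
  exact mul_ne_zero (pow_ne_zero 3 hp.2.2) hJ h3

/-- The first identity is the quotient of the two relations: `X` is a linear fractional function of
`x` with coefficients from `DT` and `DY`. -/
theorem image_x_mobius (hΦ : Φ ∈ symmetryPseudogroup) {p : Total} (hp : p ∈ regularSet Φ) :
    compX Φ p * (fderiv ℝ (compT Φ) p bT + p.1.2.1 * fderiv ℝ (compT Φ) p bY)
        = fderiv ℝ (compY Φ) p bT + p.1.2.1 * fderiv ℝ (compY Φ) p bY ∧
    (fderiv ℝ (compY Φ) p bY - compX Φ p * fderiv ℝ (compT Φ) p bY)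
        * fderiv ℝ (compX Φ) p bX ^ 2 * p.1.2.1 ^ 3
      = compX Φ p ^ 3 * (fderiv ℝ (compT Φ) p bT * fderiv ℝ (compY Φ) p bY
        - fderiv ℝ (compT Φ) p bY * fderiv ℝ (compY Φ) p bT) := by
  have h0 := compX_bU_eq_zero hΦ hp
  have hne : fderiv ℝ (compX Φ) p bX ≠ 0 :=
    (compX_bX_or_bU_ne_zero hΦ.1 hp.1 (vertical_derivatives hΦ hp)).resolve_right (not_not.2 h0)
  obtain ⟨h1, h2⟩ := image_x_relations hΦ hp 0 (by simpa using hne)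
  rw [zero_mul, add_zero] at h1 h2
  refine ⟨?_, h1⟩
  have hne' := mul_ne_zero (pow_ne_zero 2 hne) (pow_ne_zero 3 hp.2.1)
  apply mul_right_cancel₀ hne'
  linear_combination h2 - p.1.2.1 * h1

-- Valid on an interval, the identity is one of polynomials. Its right side vanishes only at `x =
-- 0`, so no linear factor on the left has a nonzero root; this excludes everything except `b³ c² x³
-- = c² b² x³`, apart from a case settled by parity.
open Polynomial in
theorem coefficients_of_mobius_identity {a b c d x₀ r : ℝ} (hr : 0 < r) (hD : c * b - d * a ≠ 0)
    (h : ∀ x, |x - x₀| < r →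
      (a + b * x) ^ 3 * (c + d * x) ^ 2 = (c * b - d * a) ^ 2 * x ^ 3) :
    a = 0 ∧ d = 0 ∧ b = 1 := by
  have hall : ∀ x : ℝ, (a + b * x) ^ 3 * (c + d * x) ^ 2 = (c * b - d * a) ^ 2 * x ^ 3 := by
    have hP : ((C a + C b * X) ^ 3 * (C c + C d * X) ^ 2 : ℝ[X])
        = C ((c * b - d * a) ^ 2) * X ^ 3 := by
      refine Polynomial.eq_of_infinite_eval_eq _ _ (Set.Infinite.mono ?_
        (Set.Ioo_infinite (show x₀ - r < x₀ + r by linarith)))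
      intro x hx
      have := h x (abs_lt.2 ⟨by linarith [hx.1], by linarith [hx.2]⟩)
      simpa using this
    intro x
    simpa using congrArg (Polynomial.eval x) hP
  have ha : a = 0 := by
    by_contra ha
    have hc : c = 0 := by
      have := hall 0
      simpa [ha] using this
    subst hc
    have hb : b = 0 := by
      by_contra hb
      have := hall (-a / b)
      have e : a + b * (-a / b) = 0 := by field_simp; ring
      rw [e] at this
      have h1 : (-a / b) ^ 3 ≠ 0 := pow_ne_zero 3 (div_ne_zero (neg_ne_zero.2 ha) hb)
      have h2 := mul_ne_zero (pow_ne_zero 2 hD) h1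
      apply h2
      rw [← this]
      ring
    subst hb
    -- With `b = c = 0` the identity is `a³ d² x² = d² a² x³`: even against odd in `x`.
    have h1 := hall 1
    have h2 := hall (-1)
    apply pow_ne_zero 2 hD
    linear_combination (-1 / 2) * h1 + (1 / 2) * h2
  subst ha
  have hcb : c * b ≠ 0 := by simpa using hD
  have hb := right_ne_zero_of_mul hcb
  have hc := left_ne_zero_of_mul hcb
  have hd : d = 0 := by
    by_contra hd
    have := hall (-c / d)
    have e : c + d * (-c / d) = 0 := by field_simp; ring
    rw [e] at this
    have h1 : (-c / d) ^ 3 ≠ 0 := pow_ne_zero 3 (div_ne_zero (neg_ne_zero.2 hc) hd)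
    have h2 := mul_ne_zero (pow_ne_zero 2 hD) h1
    apply h2
    rw [← this]
    ring
  subst hd
  refine ⟨rfl, rfl, ?_⟩
  have h1 := hall 1
  have h2 : b ^ 2 * c ^ 2 ≠ 0 := mul_ne_zero (pow_ne_zero 2 hb) (pow_ne_zero 2 hc)
  apply mul_left_cancel₀ h2
  linear_combination h1

theorem contDiffAt_compT (hΦ : IsPointTransformation Φ) {p : Total} (hp : p ∈ Φ.source) :
    ContDiffAt ℝ ∞ (compT Φ) p := tT.contDiff.contDiffAt.comp p (hΦ.contDiffAt hp)

theorem contDiffAt_compX (hΦ : IsPointTransformation Φ) {p : Total} (hp : p ∈ Φ.source) :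
    ContDiffAt ℝ ∞ (compX Φ) p := tX.contDiff.contDiffAt.comp p (hΦ.contDiffAt hp)

theorem contDiffAt_compY (hΦ : IsPointTransformation Φ) {p : Total} (hp : p ∈ Φ.source) :
    ContDiffAt ℝ ∞ (compY Φ) p := tY.contDiff.contDiffAt.comp p (hΦ.contDiffAt hp)

theorem contDiffAt_compU (hΦ : IsPointTransformation Φ) {p : Total} (hp : p ∈ Φ.source) :
    ContDiffAt ℝ ∞ (compU Φ) p := tU.contDiff.contDiffAt.comp p (hΦ.contDiffAt hp)

/-- Along the `x`-line through `p` the derivatives `DT` and `DY` are constant, so the linear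
fractional relation for `X` has constant coefficients there and can be differentiated: `X_x = J / (c
+ d x)²`. Inserting this in the second relation of `image_x_mobius` gives the identity of
`coefficients_of_mobius_identity`. -/
theorem base_derivatives (hΦ : Φ ∈ symmetryPseudogroup) {p : Total} (hp : p ∈ regularSet Φ) :
    fderiv ℝ (compY Φ) p bT = 0 ∧ fderiv ℝ (compT Φ) p bY = 0 ∧ fderiv ℝ (compY Φ) p bY = 1 := by
  obtain ⟨r, hr, hball⟩ := Metric.isOpen_iff.1 (isOpen_regularSet Φ) p hp
  have hO := Metric.isOpen_ball (x := p) (ε := r)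
  have hOc := convex_ball p r
  have hmem : ∀ τ : ℝ, |τ| < r → p + τ • bX ∈ Metric.ball p r := by
    intro τ hτ
    rw [mem_ball_iff_norm, add_sub_cancel_left]
    simpa [norm_smul, Prod.norm_def] using hτ
  have hT : ∀ τ : ℝ, |τ| < r → fderiv ℝ (compT Φ) (p + τ • bX) = fderiv ℝ (compT Φ) p :=
    fun τ hτ => fderiv_eq_of_fderiv_apply_eq_zero hO hOc
      (fun q hq => contDiffAt_two (contDiffAt_compT hΦ.1 (hball hq).1))
      (fun q hq => (vertical_derivatives hΦ (hball hq)).1) (Metric.mem_ball_self hr) (hmem τ hτ)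
      (add_sub_cancel_left _ _)
  have hY : ∀ τ : ℝ, |τ| < r → fderiv ℝ (compY Φ) (p + τ • bX) = fderiv ℝ (compY Φ) p :=
    fun τ hτ => fderiv_eq_of_fderiv_apply_eq_zero hO hOc
      (fun q hq => contDiffAt_two (contDiffAt_compY hΦ.1 (hball hq).1))
      (fun q hq => (vertical_derivatives hΦ (hball hq)).2.2.1) (Metric.mem_ball_self hr)
      (hmem τ hτ) (add_sub_cancel_left _ _)
  have hJ := jacobian_ne_zero hΦ.1 hp.1 (vertical_derivatives hΦ hp)
  refine coefficients_of_mobius_identity (c := fderiv ℝ (compT Φ) p bT) (x₀ := p.1.2.1) hr hJ ?_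
  intro x hx
  set τ := x - p.1.2.1 with hτ
  have hreg := hball (hmem τ hx)
  obtain ⟨e1, e2⟩ := image_x_mobius hΦ hreg
  have hcoord : (p + τ • bX).1.2.1 = x := by simp [hτ]
  have hlin : HasDerivAt (fun s : ℝ => p + s • bX) bX τ := by
    simpa using ((hasDerivAt_id τ).smul_const bX).const_add p
  have hX : HasDerivAt (fun s : ℝ => compX Φ (p + s • bX))
      (fderiv ℝ (compX Φ) (p + τ • bX) bX) τ :=
    HasFDerivAt.comp_hasDerivAt (f := fun s : ℝ => p + s • bX) τ
      ((contDiffAt_compX hΦ.1 hreg.1).differentiableAt (by simp)).hasFDerivAt hlin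
  have hsx : HasDerivAt (fun s : ℝ => p.1.2.1 + s) 1 τ := (hasDerivAt_id τ).const_add _
  have d1 := hX.mul ((hsx.mul_const (fderiv ℝ (compT Φ) p bY)).const_add
    (fderiv ℝ (compT Φ) p bT))
  have d2 := (hsx.mul_const (fderiv ℝ (compY Φ) p bY)).const_add (fderiv ℝ (compY Φ) p bT)
  have heq : (fun s : ℝ => fderiv ℝ (compY Φ) p bT + (p.1.2.1 + s) * fderiv ℝ (compY Φ) p bY)
      =ᶠ[𝓝 τ] fun s => compX Φ (p + s • bX)
        * (fderiv ℝ (compT Φ) p bT + (p.1.2.1 + s) * fderiv ℝ (compT Φ) p bY) := by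
    have : ∀ᶠ s in 𝓝 τ, |s| < r := continuous_abs.continuousAt.eventually (gt_mem_nhds hx)
    filter_upwards [this] with s hs
    have := (image_x_mobius hΦ (hball (hmem s hs))).1
    rw [hT s hs, hY s hs] at this
    simpa using this.symm
  have d3 := (d1.congr_of_eventuallyEq heq).unique d2
  rw [hT τ hx, hY τ hx, hcoord] at e1 e2
  have hxx : p.1.2.1 + τ = x := by simp [hτ]
  simp only [hxx] at d3
  have hX0 : compX Φ (p + τ • bX) ≠ 0 := hreg.2.2
  generalize fderiv ℝ (compX Φ) (p + τ • bX) bX = ξ' at *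
  generalize compX Φ (p + τ • bX) = ξ at *
  generalize fderiv ℝ (compT Φ) p bT = c at *
  generalize fderiv ℝ (compT Φ) p bY = d at *
  generalize fderiv ℝ (compY Φ) p bT = a at *
  generalize fderiv ℝ (compY Φ) p bY = b at *
  -- A zero of the denominator would be a zero of the numerator too, against the nonvanishing
  -- Jacobian.
  have k0 : c + d * x ≠ 0 := by
    intro h0
    have h1 : a + b * x = 0 := by linear_combination -e1 + ξ * h0
    apply hJ
    by_cases hd : d = 0
    · have hc : c = 0 := by rw [hd] at h0; simpa using h0
      rw [hc, hd]; ring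
    · apply mul_left_cancel₀ hd
      linear_combination (b * d) * h0 - d * d * h1
  have k1 : ξ' * (c + d * x) = b - ξ * d := by linear_combination d3
  have k2 : ξ' * (c + d * x) ^ 2 = c * b - d * a := by
    linear_combination (c + d * x) * k1 - d * e1
  have k3 : (c + d * x) ^ 3 * ξ ^ 3 = (a + b * x) ^ 3 := by
    rw [← mul_pow]
    congr 1
    linear_combination e1
  apply mul_left_cancel₀ hJ
  have k4 : (b - ξ * d) * ξ' ^ 2 * x ^ 3 * (c + d * x) ^ 5 = (c * b - d * a) ^ 3 * x ^ 3 := by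
    rw [← k1, ← k2]
    ring
  rw [e2] at k4
  linear_combination k4 - (c * b - d * a) * (c + d * x) ^ 2 * k3

theorem compX_eq (hΦ : Φ ∈ symmetryPseudogroup) {p : Total} (hp : p ∈ regularSet Φ) :
    compX Φ p * fderiv ℝ (compT Φ) p bT = p.1.2.1 := by
  have h := (image_x_mobius hΦ hp).1
  obtain ⟨h1, h2, h3⟩ := base_derivatives hΦ hp
  rw [h1, h2, h3] at h
  linear_combination h

/-- The determining equations for the component `u`. -/
theorem compU_equation (hΦ : Φ ∈ symmetryPseudogroup) {p : Total} (hp : p ∈ regularSet Φ)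
    (q : ℝ) :
    fderiv ℝ (compU Φ) p bT + compX Φ p * fderiv ℝ (fderiv ℝ (compT Φ)) p bT bT
        * (fderiv ℝ (compU Φ) p bX + q * fderiv ℝ (compU Φ) p bU)
        + p.1.2.1 * fderiv ℝ (compU Φ) p bY
      = p.1.2.1 ^ 3 * fderiv ℝ (fderiv ℝ (compU Φ)) p (bX + q • bU) (bX + q • bU) := by
  have hO := isOpen_regularSet Φ
  have cT : ∀ p ∈ regularSet Φ, ContDiffAt ℝ 2 (compT Φ) p := fun p hp =>
    contDiffAt_two (contDiffAt_compT hΦ.1 hp.1)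
  have cX : ∀ p ∈ regularSet Φ, ContDiffAt ℝ 2 (compX Φ) p := fun p hp =>
    contDiffAt_two (contDiffAt_compX hΦ.1 hp.1)
  have hTX := fderiv_fderiv_eq_zero hO cT (fun p' h => (vertical_derivatives hΦ h).1) hp
  have hTY := fderiv_fderiv_eq_zero hO cT (fun p' h => (base_derivatives hΦ h).2.1) hp
  have hXU := fderiv_fderiv_eq_zero hO cX (fun p' h => compX_bU_eq_zero hΦ h) hp
  -- The derivative of `X T_t = x` along `w`; it yields `X_x T_t = 1`, `X_y = 0` and `X_t T_t = -X
  -- T_tt`.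
  have hder : ∀ p ∈ regularSet Φ, ∀ w : Total,
      fderiv ℝ (compX Φ) p w * fderiv ℝ (compT Φ) p bT
        + compX Φ p * fderiv ℝ (fderiv ℝ (compT Φ)) p w bT = w.1.2.1 := by
    intro p hp w
    have d1 := ((cX p hp).differentiableAt (by simp)).hasFDerivAt
    have d2 := ((contDiffAt_fderiv (cT p hp)).differentiableAt (by simp)).hasFDerivAt.clm_apply
      (hasFDerivAt_const bT p)
    have d3 : HasFDerivAt (fun p : Total => p.1.2.1) _ p :=
      (d1.mul d2).congr_of_eventuallyEq (by
        filter_upwards [hO.mem_nhds hp] with p' hp' using (compX_eq hΦ hp').symm)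
    have d4 := congrArg (fun L : Total →L[ℝ] ℝ => L w) (d3.unique tX.hasFDerivAt)
    have d5 : tX w = w.1.2.1 := rfl
    simp only [add_apply, smul_apply, smul_eq_mul, ContinuousLinearMap.flip_apply, d5] at d4
    simp at d4
    linear_combination d4
  have hT0 : fderiv ℝ (compT Φ) p bT ≠ 0 := by
    intro h0
    have := compX_eq hΦ hp
    rw [h0, mul_zero] at this
    exact hp.2.1 this.symm
  have hXX : ∀ p ∈ regularSet Φ, fderiv ℝ (compX Φ) p bX * fderiv ℝ (compT Φ) p bT = 1 := by
    intro p hp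
    have h1 := hder p hp bX
    rw [fderiv_fderiv_eq_zero hO cT (fun p' h => (vertical_derivatives hΦ h).1) hp] at h1
    simpa using h1
  have hXXX : fderiv ℝ (fderiv ℝ (compX Φ)) p bX bX = 0 := by
    have d1 := ((contDiffAt_fderiv (cX p hp)).differentiableAt (by simp)).hasFDerivAt.clm_apply
      (hasFDerivAt_const bX p)
    have d2 := ((contDiffAt_fderiv (cT p hp)).differentiableAt (by simp)).hasFDerivAt.clm_apply
      (hasFDerivAt_const bT p)
    have d3 : HasFDerivAt (fun _ : Total => (1 : ℝ)) _ p :=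
      (d1.mul d2).congr_of_eventuallyEq (by
        filter_upwards [hO.mem_nhds hp] with p' hp' using (hXX p' hp').symm)
    have d4 := congrArg (fun L : Total →L[ℝ] ℝ => L bX) (d3.unique (hasFDerivAt_const _ p))
    simp [hTX] at d4
    exact d4.resolve_left hT0
  have hE : fderiv ℝ (compX Φ) p bX + q * fderiv ℝ (compX Φ) p bU ≠ 0 := by
    rw [compX_bU_eq_zero hΦ hp, mul_zero, add_zero]
    exact left_ne_zero_of_mul (ne_of_eq_of_ne (hXX p hp) one_ne_zero)
  have hη : fderiv ℝ (fderiv ℝ (compX Φ)) p (bX + q • bU) (bX + q • bU) = 0 := by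
    have h1 : fderiv ℝ (fderiv ℝ (compX Φ)) p (bX + q • bU)
        = fderiv ℝ (fderiv ℝ (compX Φ)) p bX := by
      rw [map_add, map_smul, hXU, smul_zero, add_zero]
    rw [h1, map_add, map_smul, fderiv_fderiv_symm (cX p hp) bX bU, hXU, hXXX]
    simp
  -- Jets with `u_t = u_y = 0`: the slope `q` is the one free parameter, and its powers are
  -- separated later.
  obtain ⟨vT, vX, vY, a1, a2, a3, a4, a5⟩ := image_jet_equations hΦ hp 0 q 0 hE
  have hXt := hder p hp bT
  have hXy := hder p hp bY
  have hXx := hXX p hp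
  rw [hTY] at hXy
  rw [hη] at a5
  obtain ⟨h1, h2, h3⟩ := base_derivatives hΦ hp
  have h4 := compX_eq hΦ hp
  rw [h1] at a1
  rw [h2, h3] at a3
  rw [compX_bU_eq_zero hΦ hp] at a1 a2 a3 a5
  simp only [zero_apply, mul_zero, add_zero, zero_mul, sub_zero, zero_div, mul_one, zero_add]
    at a1 a2 a3 a5 hXt hXy
  have hXy' := (mul_eq_zero.1 hXy).resolve_right hT0
  rw [hXy', mul_zero, zero_add] at a3
  generalize fderiv ℝ (fderiv ℝ (compU Φ)) p (bX + q • bU) (bX + q • bU) = M at *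
  generalize fderiv ℝ (fderiv ℝ (compT Φ)) p bT bT = Ttt at *
  generalize fderiv ℝ (compT Φ) p bT = Tt at *
  generalize fderiv ℝ (compX Φ) p bT = Xt at *
  generalize fderiv ℝ (compX Φ) p bX = Xx at *
  generalize compX Φ p = X at *
  rw [← a2, ← a1, ← a3, ← h4]
  have e : Xx ^ 2 * Tt ^ 2 = 1 := by rw [← mul_pow, hXx, one_pow]
  linear_combination Tt ^ 3 * a5 - Tt * (vT + X * vY) * e + vX * Xx * hXt - vX * Xt * hXx

end Determining

/-! ### The gauged equation for the coefficients of `U` -/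

/-- The equation for the last component of a symmetry, written for a function of `(t, x, y)`. -/
noncomputable def gaugedOp (m : ℝ) (h : Base → ℝ) (z : Base) : ℝ :=
  fderiv ℝ h z (1, 2 * m * z.2.1, z.2.1)
    - z.2.1 ^ 3 * fderiv ℝ (fderiv ℝ h) z (0, 1, 0) (0, 1, 0)

theorem gaugedOp_congr {u v : Base → ℝ} {m : ℝ} {z : Base} (h : u =ᶠ[𝓝 z] v) :
    gaugedOp m u z = gaugedOp m v z := by
  rw [gaugedOp, gaugedOp, h.fderiv_eq, h.fderiv.fderiv_eq]

/-- Substituting `h = a g` removes the drift: by `hm`, the term `2 m x a g_x` cancels the cross term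
`2 x³ a_x g_x`. -/
theorem gaugedOp_mul {a g : Base → ℝ} {m : ℝ} {z : Base} (ha : ContDiffAt ℝ 2 a z)
    (hg : ContDiffAt ℝ 2 g z)
    (hm : m * z.2.1 * a z = z.2.1 ^ 3 * fderiv ℝ a z (0, 1, 0)) :
    gaugedOp m (fun y => a y * g y) z = a z * kolmogorovOp g z + g z * gaugedOp m a z := by
  have h1 : fderiv ℝ (fun y => a y * g y) z = a z • fderiv ℝ g z + g z • fderiv ℝ a z :=
    fderiv_mul (ha.differentiableAt (by simp)) (hg.differentiableAt (by simp))
  simp only [gaugedOp, kolmogorovOp, fderiv_fderiv_mul ha hg, h1, add_apply, smul_apply,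
    smul_eq_mul]
  rw [base_decomp (fderiv ℝ a z) (1, 2 * m * z.2.1, z.2.1),
    base_decomp (fderiv ℝ g z) (1, 2 * m * z.2.1, z.2.1),
    base_decomp (fderiv ℝ g z) (1, 0, z.2.1)]
  simp only
  linear_combination 2 * fderiv ℝ g z (0, 1, 0) * hm

theorem gaugedOp_add_mul_const {a b : Base → ℝ} {m c : ℝ} {z : Base} (ha : ContDiffAt ℝ 2 a z)
    (hb : ContDiffAt ℝ 2 b z) :
    gaugedOp m (fun y => b y + c * a y) z = gaugedOp m b z + c * gaugedOp m a z := by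
  have hca : ContDiffAt ℝ 2 (fun y => c * a y) z := contDiffAt_const.mul ha
  have h1 : fderiv ℝ (fun y => b y + c * a y) z = fderiv ℝ b z + c • fderiv ℝ a z :=
    ((hb.differentiableAt (by simp)).hasFDerivAt.add
      ((ha.differentiableAt (by simp)).hasFDerivAt.const_mul c)).fderiv
  have h2 : fderiv ℝ (fderiv ℝ (fun y => c * a y)) z (0, 1, 0) (0, 1, 0)
      = c * fderiv ℝ (fderiv ℝ a) z (0, 1, 0) (0, 1, 0) :=
    fderiv_fderiv_clm_comp ha (c • ContinuousLinearMap.id ℝ ℝ) _ _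
  simp only [gaugedOp, fderiv_fderiv_add hb hca, h1, h2, add_apply, smul_apply, smul_eq_mul]
  ring

section Slices

variable {h : Total → ℝ} {z : Base} {u : ℝ}

theorem hasFDerivAt_slice (u : ℝ) (z : Base) :
    HasFDerivAt (fun z : Base => ((z, u) : Total)) (ContinuousLinearMap.inl ℝ Base ℝ) z :=
  hasFDerivAt_prodMk_left z u

theorem fderiv_slice (hh : DifferentiableAt ℝ h (z, u)) (w : Base) :
    fderiv ℝ (fun z => h (z, u)) z w = fderiv ℝ h (z, u) (w, 0) :=
  congrArg (fun L => L w) (hh.hasFDerivAt.comp z (hasFDerivAt_slice u z)).fderiv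

theorem fderiv_fderiv_slice (hh : ContDiffAt ℝ 2 h (z, u)) (w : Base) :
    fderiv ℝ (fderiv ℝ (fun z => h (z, u))) z w w = fderiv ℝ (fderiv ℝ h) (z, u) (w, 0) (w, 0) := by
  have h1 : fderiv ℝ (fun z : Base => ((z, u) : Total))
      = fun _ => ContinuousLinearMap.inl ℝ Base ℝ := funext fun z => (hasFDerivAt_slice u z).fderiv
  rw [fderiv_fderiv_comp (g := fun z : Base => ((z, u) : Total)) hh
    (contDiffAt_id.prodMk contDiffAt_const), h1]
  simp

end Slices

/-! ### Determining equations on the whole domain and the local structure -/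

section Local

variable {Φ : OpenPartialHomeomorph Total Total}

/-- The regular points are dense in the domain. -/
theorem eqOn_of_eqOn_regularSet {g h : Total → ℝ} (hg : ContinuousOn g Φ.source)
    (hh : ContinuousOn h Φ.source) (heq : EqOn g h (regularSet Φ)) : EqOn g h Φ.source := by
  intro p hp
  by_contra hne
  have hO : IsOpen (Φ.source ∩ (fun p => g p - h p) ⁻¹' {0}ᶜ) :=
    (hg.sub hh).isOpen_inter_preimage Φ.open_source isOpen_compl_singleton
  have hdense : Dense {p : Total | p.1.2.1 ≠ 0} := by
    have hop : IsOpenMap (fun p : Total => p.1.2.1) :=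
      isOpenMap_fst.comp (isOpenMap_snd.comp isOpenMap_fst)
    exact (dense_compl_singleton (0 : ℝ)).preimage hop
  have hx : IsOpen {p : Total | p.1.2.1 ≠ 0} := isOpen_ne_fun (by fun_prop) (by fun_prop)
  obtain ⟨p₁, hp₁, hp₁'⟩ := hdense.inter_open_nonempty _ hO ⟨p, hp, sub_ne_zero.2 hne⟩
  -- Density of `x ≠ 0` is used twice: in the domain for `x`, then in the image, which is open, for
  -- `X`.
  have hV := Φ.isOpen_image_of_subset_source (hO.inter hx)
    (fun _ hq => hq.1.1)
  obtain ⟨_, ⟨p₂, hp₂, rfl⟩, hp₂'⟩ := hdense.inter_open_nonempty _ hV ⟨_, p₁, ⟨hp₁, hp₁'⟩, rfl⟩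
  exact sub_ne_zero.1 (hp₂.1.2 : g p₂ - h p₂ ≠ 0) (heq ⟨hp₂.1.1, hp₂.2, hp₂'⟩)

theorem IsPointTransformation.continuousOn_fderiv {h : Total → ℝ}
    (hh : ContDiffOn ℝ ∞ h Φ.source) (w : Total) :
    ContinuousOn (fun p => fderiv ℝ h p w) Φ.source :=
  (hh.continuousOn_fderiv_of_isOpen Φ.open_source (by simp)).clm_apply continuousOn_const

theorem IsPointTransformation.continuousOn_fderiv_fderiv {h : Total → ℝ}
    (hh : ContDiffOn ℝ ∞ h Φ.source) (v w : Total) :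
    ContinuousOn (fun p => fderiv ℝ (fderiv ℝ h) p v w) Φ.source :=
  (((hh.fderiv_of_isOpen Φ.open_source (m := ∞) (by simp)).continuousOn_fderiv_of_isOpen
    Φ.open_source (by simp)).clm_apply continuousOn_const).clm_apply continuousOn_const

/-- The identities hold on the dense set of regular points and both sides are continuous. The last
three are the coefficients of `q⁰`, `q¹`, `q²` in `compU_equation`, separated by `q = 0, 1, -1`. -/
theorem determining_equations (hΦ : Φ ∈ symmetryPseudogroup) {p : Total} (hp : p ∈ Φ.source) :
    (fderiv ℝ (compT Φ) p bX = 0 ∧ fderiv ℝ (compT Φ) p bY = 0 ∧ fderiv ℝ (compT Φ) p bU = 0) ∧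
    (fderiv ℝ (compY Φ) p bT = 0 ∧ fderiv ℝ (compY Φ) p bX = 0 ∧ fderiv ℝ (compY Φ) p bY = 1 ∧
      fderiv ℝ (compY Φ) p bU = 0) ∧
    compX Φ p * fderiv ℝ (compT Φ) p bT = p.1.2.1 ∧ fderiv ℝ (compX Φ) p bU = 0 ∧
    fderiv ℝ (compU Φ) p bT + compX Φ p * fderiv ℝ (fderiv ℝ (compT Φ)) p bT bT
        * fderiv ℝ (compU Φ) p bX + p.1.2.1 * fderiv ℝ (compU Φ) p bY
      = p.1.2.1 ^ 3 * fderiv ℝ (fderiv ℝ (compU Φ)) p bX bX ∧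
    compX Φ p * fderiv ℝ (fderiv ℝ (compT Φ)) p bT bT * fderiv ℝ (compU Φ) p bU
      = 2 * p.1.2.1 ^ 3 * fderiv ℝ (fderiv ℝ (compU Φ)) p bX bU ∧
    fderiv ℝ (fderiv ℝ (compU Φ)) p bU bU = 0 := by
  have hT := contDiffOn_compT hΦ.1.1
  have hX := contDiffOn_compX hΦ.1.1
  have hY := contDiffOn_compY hΦ.1.1
  have hU := contDiffOn_compU hΦ.1.1
  have hXc := hX.continuousOn
  have hx : ContinuousOn (fun p : Total => p.1.2.1) Φ.source := by fun_prop
  have c1 := fun w => IsPointTransformation.continuousOn_fderiv hT w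
  have c2 := fun w => IsPointTransformation.continuousOn_fderiv hX w
  have c3 := fun w => IsPointTransformation.continuousOn_fderiv hY w
  have c4 := fun w => IsPointTransformation.continuousOn_fderiv hU w
  have d1 := fun v w => IsPointTransformation.continuousOn_fderiv_fderiv hT v w
  have d4 := fun v w => IsPointTransformation.continuousOn_fderiv_fderiv hU v w
  have k : ∀ c : ℝ, ContinuousOn (fun _ : Total => c) Φ.source := fun c => continuousOn_const
  have hUq : ∀ p ∈ regularSet Φ, ∀ q : ℝ,
      fderiv ℝ (compU Φ) p bT + compX Φ p * fderiv ℝ (fderiv ℝ (compT Φ)) p bT bT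
        * (fderiv ℝ (compU Φ) p bX + q * fderiv ℝ (compU Φ) p bU)
        + p.1.2.1 * fderiv ℝ (compU Φ) p bY
      = p.1.2.1 ^ 3 * (fderiv ℝ (fderiv ℝ (compU Φ)) p bX bX
        + 2 * q * fderiv ℝ (fderiv ℝ (compU Φ)) p bX bU
        + q ^ 2 * fderiv ℝ (fderiv ℝ (compU Φ)) p bU bU) := by
    intro p hp q
    rw [compU_equation hΦ hp q]
    simp only [map_add, map_smul, add_apply, smul_apply, smul_eq_mul]
    rw [fderiv_fderiv_symm (contDiffAt_two (contDiffAt_compU hΦ.1 hp.1)) bU bX]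
    ring
  refine ⟨⟨?_, ?_, ?_⟩, ⟨?_, ?_, ?_, ?_⟩, ?_, ?_, ?_, ?_, ?_⟩
  · exact eqOn_of_eqOn_regularSet (c1 bX) (k 0) (fun p hp => (vertical_derivatives hΦ hp).1) hp
  · exact eqOn_of_eqOn_regularSet (c1 bY) (k 0) (fun p hp => (base_derivatives hΦ hp).2.1) hp
  · exact eqOn_of_eqOn_regularSet (c1 bU) (k 0) (fun p hp => (vertical_derivatives hΦ hp).2.1) hp
  · exact eqOn_of_eqOn_regularSet (c3 bT) (k 0) (fun p hp => (base_derivatives hΦ hp).1) hp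
  · exact eqOn_of_eqOn_regularSet (c3 bX) (k 0)
      (fun p hp => (vertical_derivatives hΦ hp).2.2.1) hp
  · exact eqOn_of_eqOn_regularSet (c3 bY) (k 1) (fun p hp => (base_derivatives hΦ hp).2.2) hp
  · exact eqOn_of_eqOn_regularSet (c3 bU) (k 0)
      (fun p hp => (vertical_derivatives hΦ hp).2.2.2) hp
  · exact eqOn_of_eqOn_regularSet (hXc.mul (c1 bT)) hx (fun p hp => compX_eq hΦ hp) hp
  · exact eqOn_of_eqOn_regularSet (c2 bU) (k 0) (fun p hp => compX_bU_eq_zero hΦ hp) hp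
  · refine eqOn_of_eqOn_regularSet (((c4 bT).add ((hXc.mul (d1 bT bT)).mul (c4 bX))).add
      (hx.mul (c4 bY))) ((hx.pow 3).mul (d4 bX bX)) (fun p hp => ?_) hp
    have := hUq p hp 0
    simp only [Pi.add_apply, Pi.mul_apply, Pi.pow_apply]
    linear_combination this
  · refine eqOn_of_eqOn_regularSet ((hXc.mul (d1 bT bT)).mul (c4 bU))
      (((k 2).mul (hx.pow 3)).mul (d4 bX bU)) (fun p hp => ?_) hp
    have h1 := hUq p hp 1
    have h2 := hUq p hp (-1)
    simp only [Pi.mul_apply, Pi.pow_apply]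
    linear_combination (1 / 2) * h1 - (1 / 2) * h2
  · refine eqOn_of_eqOn_regularSet (d4 bU bU) (k 0) (fun p hp => ?_) hp
    have h0 := hUq p hp 0
    have h1 := hUq p hp 1
    have h2 := hUq p hp (-1)
    apply mul_left_cancel₀ (pow_ne_zero 3 hp.2.1)
    linear_combination h0 - (1 / 2) * h1 - (1 / 2) * h2

/-- Near every point of the domain, a point symmetry is fibre-preserving and affine along the
fibres. -/
theorem local_structure (hΦ : Φ ∈ symmetryPseudogroup) {t₀ x₀ y₀ u₀ r : ℝ} (hr : 0 < r)
    (hball : Metric.ball (((t₀, x₀, y₀), u₀) : Total) r ⊆ Φ.source) :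
    ∃ (τ : ℝ → ℝ) (lam : ℝ) (a b : Base → ℝ), ContDiffOn ℝ ∞ τ (Metric.ball t₀ r) ∧
      (∀ t ∈ Metric.ball t₀ r, deriv τ t ≠ 0) ∧
      ContDiffOn ℝ ∞ a (Metric.ball (t₀, x₀, y₀) r) ∧
      ContDiffOn ℝ ∞ b (Metric.ball (t₀, x₀, y₀) r) ∧
      (∀ z ∈ Metric.ball ((t₀, x₀, y₀) : Base) r, ∀ u ∈ Metric.ball u₀ r,
        Φ (z, u) = ((τ z.1, z.2.1 / deriv τ z.1, z.2.2 + lam), b z + (u - u₀) * a z)) ∧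
      ∀ z ∈ Metric.ball ((t₀, x₀, y₀) : Base) r, a z ≠ 0 ∧
        gaugedOp (deriv (deriv τ) z.1 / (2 * deriv τ z.1)) a z = 0 ∧
        gaugedOp (deriv (deriv τ) z.1 / (2 * deriv τ z.1)) b z = 0 ∧
        deriv (deriv τ) z.1 / (2 * deriv τ z.1) * z.2.1 * a z
          = z.2.1 ^ 3 * fderiv ℝ a z (0, 1, 0) := by
  set O := Metric.ball (((t₀, x₀, y₀), u₀) : Total) r with hOdef
  have hO : IsOpen O := Metric.isOpen_ball
  have hOc : Convex ℝ O := convex_ball _ _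
  have hmem : ∀ {z : Base} {u : ℝ}, z ∈ Metric.ball ((t₀, x₀, y₀) : Base) r →
      u ∈ Metric.ball u₀ r → (z, u) ∈ O := by
    intro z u hz hu
    rw [hOdef, ← ball_prod_same]
    exact ⟨hz, hu⟩
  have hmem' : ∀ {p : Total}, p ∈ O → p.1 ∈ Metric.ball ((t₀, x₀, y₀) : Base) r ∧
      p.2 ∈ Metric.ball u₀ r := by
    intro p hp
    rw [hOdef, ← ball_prod_same] at hp
    exact hp
  have hmt : ∀ {t : ℝ}, t ∈ Metric.ball t₀ r →
      ((t, x₀, y₀) : Base) ∈ Metric.ball ((t₀, x₀, y₀) : Base) r := by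
    intro t ht
    rw [← ball_prod_same]
    exact ⟨ht, Metric.mem_ball_self hr⟩
  have hmt' : ∀ {z : Base}, z ∈ Metric.ball ((t₀, x₀, y₀) : Base) r →
      z.1 ∈ Metric.ball t₀ r := by
    intro z hz
    rw [← ball_prod_same] at hz
    exact hz.1
  have hu₀ : u₀ ∈ Metric.ball u₀ r := Metric.mem_ball_self hr
  have hdet := fun p (hp : p ∈ O) => determining_equations hΦ (hball hp)
  have cT := fun p (hp : p ∈ O) => contDiffAt_compT hΦ.1 (hball hp)
  have cY := fun p (hp : p ∈ O) => contDiffAt_compY hΦ.1 (hball hp)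
  have cU := fun p (hp : p ∈ O) => contDiffAt_compU hΦ.1 (hball hp)
  -- Balls of the maximum norm are boxes, so `((t, x₀, y₀), u₀)` remains in `O` and `τ` represents
  -- `T` on all of `O`.
  set τ : ℝ → ℝ := fun t => compT Φ ((t, x₀, y₀), u₀) with hτ
  have hline : ∀ (x y u s : ℝ), HasDerivAt (fun s : ℝ => (((s, x, y), u) : Total)) bT s :=
    fun x y u s => (hasDerivAt_lineT x y s).prodMk (hasDerivAt_const s u)
  have hTτ : ∀ p ∈ O, compT Φ p = τ p.1.1 := by
    intro p hp
    have hp' := hmem (hmt (hmt' (hmem' hp).1)) hu₀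
    refine eq_of_fderiv_apply_eq_zero hOc (fun q hq => (cT q hq).differentiableAt (by simp))
      hp' hp fun q hq => ?_
    obtain ⟨⟨h1, h2, h3⟩, -⟩ := hdet q hq
    rw [total_decomp, h1, h2, h3]
    simp
  have hev : ∀ p ∈ O, ∀ᶠ s in 𝓝 p.1.1, (((s, p.1.2.1, p.1.2.2), p.2) : Total) ∈ O := fun p hp =>
    (hline p.1.2.1 p.1.2.2 p.2 p.1.1).continuousAt.eventually (hO.mem_nhds hp)
  have hdτ : ∀ p ∈ O, HasDerivAt τ (fderiv ℝ (compT Φ) p bT) p.1.1 := by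
    intro p hp
    have h1 : HasDerivAt (fun s : ℝ => compT Φ ((s, p.1.2.1, p.1.2.2), p.2))
        (fderiv ℝ (compT Φ) p bT) p.1.1 :=
      HasFDerivAt.comp_hasDerivAt (f := fun s : ℝ => (((s, p.1.2.1, p.1.2.2), p.2) : Total))
        p.1.1 ((cT p hp).differentiableAt (by simp)).hasFDerivAt (hline _ _ _ _)
    refine h1.congr_of_eventuallyEq ?_
    filter_upwards [hev p hp] with s hs using (hTτ _ hs).symm
  have hddτ : ∀ p ∈ O, HasDerivAt (deriv τ) (fderiv ℝ (fderiv ℝ (compT Φ)) p bT bT) p.1.1 := by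
    intro p hp
    have h0 := ((contDiffAt_fderiv (contDiffAt_two (cT p hp))).differentiableAt
      (by simp)).hasFDerivAt.clm_apply (hasFDerivAt_const bT p)
    have h1 := HasFDerivAt.comp_hasDerivAt
      (f := fun s : ℝ => (((s, p.1.2.1, p.1.2.2), p.2) : Total)) p.1.1 h0 (hline _ _ _ _)
    have h2 : HasDerivAt (fun s : ℝ => fderiv ℝ (compT Φ) ((s, p.1.2.1, p.1.2.2), p.2) bT)
      (fderiv ℝ (fderiv ℝ (compT Φ)) p bT bT) p.1.1 := h1.congr_deriv (by simp)
    refine h2.congr_of_eventuallyEq ?_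
    filter_upwards [hev p hp] with s hs using (hdτ _ hs).deriv
  have hYy : ∀ p ∈ O, compY Φ p = p.1.2.2 + (compY Φ ((t₀, x₀, y₀), u₀) - y₀) := by
    intro p hp
    have hd : ∀ q ∈ O, HasFDerivAt (fun q : Total => compY Φ q - q.1.2.2)
        (fderiv ℝ (compY Φ) q - tY) q := fun q hq =>
      ((cY q hq).differentiableAt (by simp)).hasFDerivAt.sub tY.hasFDerivAt
    have := eq_of_fderiv_apply_eq_zero hOc (fun q hq => (hd q hq).differentiableAt)
      (Metric.mem_ball_self hr) hp fun q hq => by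
        obtain ⟨-, ⟨h1, h2, h3, h4⟩, -⟩ := hdet q hq
        have e : ∀ w : Total, tY w = w.1.2.2 := fun w => rfl
        rw [(hd q hq).fderiv, sub_apply, total_decomp (fderiv ℝ (compY Φ) q), h1, h2, h3, h4, e]
        simp
    linarith
  have hT0 : ∀ p ∈ O, fderiv ℝ (compT Φ) p bT ≠ 0 := by
    intro p hp
    obtain ⟨⟨h1, h2, h3⟩, ⟨h4, h5, h6, h7⟩, -⟩ := hdet p hp
    have := jacobian_ne_zero hΦ.1 (hball hp) ⟨h1, h3, h5, h7⟩
    rw [h2, h6] at this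
    simpa using this
  set a : Base → ℝ := fun z => fderiv ℝ (compU Φ) (z, u₀) bU with ha
  set b : Base → ℝ := fun z => compU Φ (z, u₀) with hb
  have hU := contDiffOn_compU hΦ.1.1
  have hUO := hU.mono hball
  have hmaps : MapsTo (fun z : Base => ((z, u₀) : Total)) (Metric.ball (t₀, x₀, y₀) r) O :=
    fun z hz => hmem hz hu₀
  have hbs : ContDiffOn ℝ ∞ b (Metric.ball (t₀, x₀, y₀) r) :=
    hUO.comp (by fun_prop) hmaps
  have has : ContDiffOn ℝ ∞ a (Metric.ball (t₀, x₀, y₀) r) :=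
    ((hUO.fderiv_of_isOpen hO (m := ∞) (by simp)).clm_apply contDiffOn_const).comp
      (by fun_prop) hmaps
  have haU : ∀ p ∈ O, fderiv ℝ (compU Φ) p bU = a p.1 := by
    intro p hp
    have hd : ∀ q ∈ O, DifferentiableAt ℝ (fun q => fderiv ℝ (compU Φ) q bU) q := fun q hq =>
      ((contDiffAt_fderiv (contDiffAt_two (cU q hq))).differentiableAt (by simp)).clm_apply
        (differentiableAt_const _)
    refine eq_of_fderiv_apply_eq_zero hOc hd (hmem (hmem' hp).1 hu₀) hp fun q hq => ?_
    have e : p - (p.1, u₀) = (p.2 - u₀) • bU := by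
      ext <;> simp
    rw [fderiv_fderiv_apply (contDiffAt_two (cU q hq)), e, map_smul, smul_apply,
      (hdet q hq).2.2.2.2.2.2, smul_zero]
  have hUab : ∀ p ∈ O, compU Φ p = b p.1 + (p.2 - u₀) * a p.1 := by
    intro p hp
    have hd : ∀ q ∈ O, HasFDerivAt (fun q : Total => compU Φ q - (q.2 - u₀) * a p.1)
        (fderiv ℝ (compU Φ) q - a p.1 • tU) q := fun q hq =>
      ((cU q hq).differentiableAt (by simp)).hasFDerivAt.sub
        ((tU.hasFDerivAt.sub_const u₀).mul_const (a p.1))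
    -- The slope `a p.1` is frozen at the base point of `p`, so the comparison takes place inside
    -- that fibre.
    have hseg : Convex ℝ (O ∩ {q : Total | q.1 = p.1}) :=
      hOc.inter ((convex_singleton p.1).linear_preimage (LinearMap.fst ℝ Base ℝ))
    have := eq_of_fderiv_apply_eq_zero hseg (fun q hq => (hd q hq.1).differentiableAt)
      (p := (p.1, u₀)) (p' := p) ⟨hmem (hmem' hp).1 hu₀, rfl⟩ ⟨hp, rfl⟩ fun q hq => by
        have e : p - (p.1, u₀) = (p.2 - u₀) • bU := by
          ext <;> simp
        have e' : tU bU = 1 := rfl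
        rw [(hd q hq.1).fderiv, e, map_smul, sub_apply, smul_apply, haU q hq.1, e',
          show q.1 = p.1 from hq.2]
        simp
    simp only [sub_self, zero_mul, sub_zero] at this
    linarith
  have hU0 : ∀ p ∈ O, fderiv ℝ (compU Φ) p bU ≠ 0 := by
    intro p hp h0
    obtain ⟨⟨-, -, h3⟩, ⟨-, -, -, h7⟩, -, h8, -⟩ := hdet p hp
    have hd := hΦ.1.differentiableAt (hball hp)
    rw [fderiv_compT hd] at h3
    rw [fderiv_compX hd] at h8
    rw [fderiv_compY hd] at h7
    rw [fderiv_compU hd] at h0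
    have hz : fderiv ℝ Φ p bU = 0 := Prod.ext (Prod.ext h3 (Prod.ext h8 h7)) h0
    have hs : Function.Surjective (fderiv ℝ Φ p : Total →ₗ[ℝ] Total) := fun w =>
      ⟨_, hΦ.1.fderiv_symm_apply (hball hp) w⟩
    have := (injective_iff_map_eq_zero _).1 (LinearMap.injective_iff_surjective.2 hs) bU hz
    simpa using congrArg Prod.snd this
  have hgauged : ∀ p ∈ O, gaugedOp (deriv (deriv τ) p.1.1 / (2 * deriv τ p.1.1))
      (fun z => compU Φ (z, p.2)) p.1 = 0 := by
    intro p hp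
    obtain ⟨-, -, h1, -, h2, -⟩ := hdet p hp
    have hne := hT0 p hp
    rw [gaugedOp, fderiv_fderiv_slice (contDiffAt_two (cU p hp)),
      fderiv_slice ((cU p hp).differentiableAt (by simp)), total_decomp, (hdτ p hp).deriv,
      (hddτ p hp).deriv]
    have hX : compX Φ p = p.1.2.1 / fderiv ℝ (compT Φ) p bT := by
      rw [← h1]; field_simp
    rw [hX] at h2
    simp only [smul_eq_mul]
    have e : ((0, 1, 0), 0) = bX := rfl
    rw [← h2]
    field_simp
    ring
  have hτs : ContDiffOn ℝ ∞ τ (Metric.ball t₀ r) := by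
    refine ((contDiffOn_compT hΦ.1.1).mono hball).comp
      (f := fun t : ℝ => (((t, x₀, y₀), u₀) : Total)) (by fun_prop) ?_
    exact fun t ht => hmem (hmt ht) hu₀
  refine ⟨τ, compY Φ ((t₀, x₀, y₀), u₀) - y₀, a, b, hτs, ?_, has, hbs, ?_, ?_⟩
  · intro t ht
    have hp := hmem (hmt ht) hu₀
    rw [(hdτ _ hp).deriv]
    exact hT0 _ hp
  · intro z hz u hu
    have hp := hmem hz hu
    refine Prod.ext (Prod.ext (hTτ _ hp) (Prod.ext ?_ (hYy _ hp))) (hUab _ hp)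
    rw [(hdτ _ hp).deriv, eq_div_iff (hT0 _ hp)]
    exact (hdet _ hp).2.2.1
  · intro z hz
    have hp := hmem hz hu₀
    have hn := Metric.isOpen_ball.mem_nhds hz
    have ca := contDiffAt_two (has.contDiffAt hn)
    have cb := contDiffAt_two (hbs.contDiffAt hn)
    have g0 := hgauged _ hp
    have hu₁ : u₀ + r / 2 ∈ Metric.ball u₀ r := by
      rw [mem_ball_iff_norm, add_sub_cancel_left, Real.norm_eq_abs, abs_of_pos] <;> linarith
    -- The gauged equation at two heights: it holds for `b` and for `b + (r / 2) a`, hence for `a`.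
    have g1 := hgauged _ (hmem hz hu₁)
    have e1 : (fun z => compU Φ (z, u₀ + r / 2)) =ᶠ[𝓝 z] fun z => b z + r / 2 * a z := by
      filter_upwards [hn] with z' hz'
      rw [hUab _ (hmem hz' hu₁)]
      simp
    refine ⟨hU0 _ hp, ?_, g0, ?_⟩
    · simp only at g0 g1
      rw [gaugedOp_congr e1, gaugedOp_add_mul_const ca cb, show gaugedOp _ b z = 0 from g0] at g1
      simpa [hr.ne'] using g1
    · obtain ⟨-, -, h1, -, -, h2, -⟩ := hdet _ hp
      have hne := hT0 _ hp
      have hX : compX Φ (z, u₀) = z.2.1 / fderiv ℝ (compT Φ) (z, u₀) bT := by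
        rw [← h1]; field_simp
      have e2 : fderiv ℝ a z (0, 1, 0) = fderiv ℝ (fderiv ℝ (compU Φ)) (z, u₀) bX bU := by
        rw [ha, fderiv_slice (h := fun p => fderiv ℝ (compU Φ) p bU),
          fderiv_fderiv_apply (contDiffAt_two (cU _ hp))]
        exact ((contDiffAt_fderiv (contDiffAt_two (cU _ hp))).differentiableAt (by simp)).clm_apply
          (differentiableAt_const _)
      have h3 := (hdτ _ hp).deriv
      have h4 := (hddτ _ hp).deriv
      simp only at h3 h4
      rw [e2, h3, h4]
      rw [hX] at h2
      have h5 : fderiv ℝ (compU Φ) (z, u₀) bU = a z := rfl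
      rw [h5] at h2
      simp only at h2
      have h6 : z.2.1 ^ 3 * fderiv ℝ (fderiv ℝ (compU Φ)) (z, u₀) bX bU
        = (1 / 2) * (z.2.1 / fderiv ℝ (compT Φ) (z, u₀) bT
          * fderiv ℝ (fderiv ℝ (compT Φ)) (z, u₀) bT bT * a z) := by linear_combination -(1 / 2) * h2
      rw [h6]
      field_simp

end Local

/-! ### Integration of the determining equations -/

theorem quadratic_coefficients_eq_zero {A B C x₀ r : ℝ} (hr : 0 < r)
    (h : ∀ x ∈ Metric.ball x₀ r, A + B * x + C * x ^ 2 = 0) : A = 0 ∧ B = 0 ∧ C = 0 := by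
  have h0 := h x₀ (Metric.mem_ball_self hr)
  have hr2 : |r / 2| < r := by rw [abs_of_pos] <;> linarith
  have h1 := h (x₀ + r / 2) (by rwa [mem_ball_iff_norm, add_sub_cancel_left, Real.norm_eq_abs])
  have h2 := h (x₀ - r / 2) (by
    rwa [mem_ball_iff_norm, sub_sub_cancel_left, Real.norm_eq_abs, abs_neg])
  have hC : C = 0 := by
    apply mul_left_cancel₀ (pow_ne_zero 2 hr.ne')
    linear_combination 2 * h1 + 2 * h2 - 4 * h0
  subst hC
  have hB : B = 0 := by
    apply mul_left_cancel₀ hr.ne'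
    linear_combination h1 - h2
  subst hB
  exact ⟨by linarith, rfl, rfl⟩

theorem mem_ball_base {t₀ x₀ y₀ r : ℝ} {z : Base} :
    z ∈ Metric.ball ((t₀, x₀, y₀) : Base) r ↔
      z.1 ∈ Metric.ball t₀ r ∧ z.2.1 ∈ Metric.ball x₀ r ∧ z.2.2 ∈ Metric.ball y₀ r := by
  rw [← ball_prod_same, ← ball_prod_same]
  rfl

/-- Extension of a condition on the coefficients along the lines in the direction of `x`. -/
theorem coefficients_eq_zero_of_invariant {k : Base → ℝ} {c₀ c₁ : ℝ → ℝ} {t₀ x₀ y₀ r : ℝ}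
    (hr : 0 < r)
    (hk : ∀ z ∈ Metric.ball ((t₀, x₀, y₀) : Base) r, ContDiffAt ℝ 2 k z)
    (hkx : ∀ z ∈ Metric.ball ((t₀, x₀, y₀) : Base) r, fderiv ℝ k z (0, 1, 0) = 0)
    (h : ∀ z ∈ Metric.ball ((t₀, x₀, y₀) : Base) r, c₀ z.1 * k z
      + (fderiv ℝ k z (1, 0, 0) + c₁ z.1 * k z) * z.2.1
      + fderiv ℝ k z (0, 0, 1) * z.2.1 ^ 2 = 0) {z : Base}
    (hz : z ∈ Metric.ball ((t₀, x₀, y₀) : Base) r) :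
    c₀ z.1 * k z = 0 ∧ fderiv ℝ k z (1, 0, 0) + c₁ z.1 * k z = 0 ∧
      fderiv ℝ k z (0, 0, 1) = 0 := by
  refine quadratic_coefficients_eq_zero (x₀ := x₀) hr fun x hx => ?_
  have hz' := mem_ball_base.1 hz
  have hm : ((z.1, x, z.2.2) : Base) ∈ Metric.ball ((t₀, x₀, y₀) : Base) r :=
    mem_ball_base.2 ⟨hz'.1, hx, hz'.2.2⟩
  have e : ((z.1, x, z.2.2) : Base) - z = (x - z.2.1) • (0, 1, 0) := by
    ext <;> simp
  have h1 := fderiv_eq_of_fderiv_apply_eq_zero Metric.isOpen_ball (convex_ball _ _) hk hkx hz hm e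
  have h2 := eq_of_fderiv_apply_eq_zero (convex_ball _ _)
    (fun q hq => (hk q hq).differentiableAt (by simp)) hz hm fun q hq => by
      rw [e, map_smul, hkx q hq, smul_zero]
  have h3 := h _ hm
  rw [h1, h2] at h3
  exact h3

/-- Off `x = 0` the last hypothesis in `h` reads `a_x = m a / x²`, so `k = a exp (m / x)` does not
depend on `x`. Multiplied by `x exp (m / x)`, the gauged equation becomes `(m² - m') k + (k_t + 2 m
k) x + k_y x² = 0`, where each coefficient must vanish. -/
theorem invariant_factor_of_ne_zero {a : Base → ℝ} {m : ℝ → ℝ} {t₀ x₀ y₀ r : ℝ} (hr : 0 < r)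
    (hm : ContDiffOn ℝ ∞ m (Metric.ball t₀ r))
    (ha : ContDiffOn ℝ ∞ a (Metric.ball (t₀, x₀, y₀) r))
    (h : ∀ z ∈ Metric.ball ((t₀, x₀, y₀) : Base) r, a z ≠ 0 ∧ gaugedOp (m z.1) a z = 0 ∧
        m z.1 * z.2.1 * a z = z.2.1 ^ 3 * fderiv ℝ a z (0, 1, 0))
    (hx : ∀ z ∈ Metric.ball ((t₀, x₀, y₀) : Base) r, z.2.1 ≠ 0) :
    ∃ k : Base → ℝ, ∀ z ∈ Metric.ball ((t₀, x₀, y₀) : Base) r,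
      DifferentiableAt ℝ k z ∧ fderiv ℝ k z (0, 1, 0) = 0 ∧ fderiv ℝ k z (0, 0, 1) = 0 ∧
        fderiv ℝ k z (1, 0, 0) = -2 * m z.1 * k z ∧ deriv m z.1 = m z.1 ^ 2 ∧ k z ≠ 0 ∧
        a z = k z * Real.exp (-m z.1 * z.2.1⁻¹) := by
  set B := Metric.ball ((t₀, x₀, y₀) : Base) r with hB
  have hBo : IsOpen B := Metric.isOpen_ball
  set e : Base → ℝ := fun z => Real.exp (m z.1 * z.2.1⁻¹) with he
  set k : Base → ℝ := fun z => a z * e z with hk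
  have hm1 : ∀ z ∈ B, z.1 ∈ Metric.ball t₀ r := fun z hz => (mem_ball_base.1 hz).1
  have hmB : ContDiffOn ℝ ∞ (fun z : Base => m z.1) B := hm.comp (by fun_prop) hm1
  have hinv : ContDiffOn ℝ ∞ (fun z : Base => z.2.1⁻¹) B :=
    ContDiffOn.inv (by fun_prop) hx
  have heB : ContDiffOn ℝ ∞ e B := (hmB.mul hinv).exp
  have hkB : ContDiffOn ℝ ∞ k B := ha.mul heB
  have hder : ∀ z ∈ B, fderiv ℝ k z = e z • (fderiv ℝ a z
      + a z • ((deriv m z.1 * z.2.1⁻¹) • dT - (m z.1 * (z.2.1 ^ 2)⁻¹) • dX)) := by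
    intro z hz
    have d1 : HasFDerivAt (fun z : Base => m z.1) (deriv m z.1 • dT) z :=
      (((hm.contDiffAt (Metric.isOpen_ball.mem_nhds (hm1 z hz))).differentiableAt
        (by simp)).hasDerivAt).comp_hasFDerivAt z dT.hasFDerivAt
    have d2 : HasFDerivAt (fun z : Base => z.2.1⁻¹) (-(z.2.1 ^ 2)⁻¹ • dX) z :=
      (hasDerivAt_inv (hx z hz)).comp_hasFDerivAt z dX.hasFDerivAt
    have d3 := ((ha.contDiffAt (hBo.mem_nhds hz)).differentiableAt (by simp)).hasFDerivAt
    refine (d3.mul (d1.mul d2).exp).fderiv.trans ?_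
    refine ContinuousLinearMap.ext fun w => ?_
    simp [he]
    ring
  have hax : ∀ z ∈ B, fderiv ℝ a z (0, 1, 0) = a z * (m z.1 * (z.2.1 ^ 2)⁻¹) := by
    intro z hz
    have hx' := hx z hz
    have := (h z hz).2.2
    apply mul_left_cancel₀ (pow_ne_zero 3 hx')
    rw [← this]
    field_simp
  have haxx : ∀ z ∈ B, fderiv ℝ (fderiv ℝ a) z (0, 1, 0) (0, 1, 0)
      = a z * (m z.1 ^ 2 * (z.2.1 ^ 4)⁻¹ - 2 * m z.1 * (z.2.1 ^ 3)⁻¹) := by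
    intro z hz
    have ca := contDiffAt_two (ha.contDiffAt (hBo.mem_nhds hz))
    have hx' := hx z hz
    rw [← fderiv_fderiv_apply ca]
    have e1 : (fun y => fderiv ℝ a y (0, 1, 0))
        =ᶠ[𝓝 z] fun z => a z * (m z.1 * (z.2.1 ^ 2)⁻¹) := by
      filter_upwards [hBo.mem_nhds hz] with y hy using hax y hy
    rw [e1.fderiv_eq]
    have d1 : HasFDerivAt (fun z : Base => m z.1) (deriv m z.1 • dT) z :=
      (((hm.contDiffAt (Metric.isOpen_ball.mem_nhds (hm1 z hz))).differentiableAt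
        (by simp)).hasDerivAt).comp_hasFDerivAt z dT.hasFDerivAt
    have d2 : HasFDerivAt (fun z : Base => (z.2.1 ^ 2)⁻¹)
        ((-(2 * z.2.1) / (z.2.1 ^ 2) ^ 2) • dX) z := by
      have h0 : HasDerivAt (fun x : ℝ => (x ^ 2)⁻¹) (-(2 * z.2.1) / (z.2.1 ^ 2) ^ 2) z.2.1 :=
        ((hasDerivAt_pow 2 z.2.1).inv (pow_ne_zero 2 hx')).congr_deriv (by simp)
      exact HasDerivAt.comp_hasFDerivAt (f := fun z : Base => z.2.1) z h0 dX.hasFDerivAt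
    have d3 := (ca.differentiableAt (by simp)).hasFDerivAt
    refine (congrArg (fun L : Base →L[ℝ] ℝ => L (0, 1, 0)) (d3.mul (d1.mul d2)).fderiv).trans ?_
    simp [hax z hz]
    field_simp
    ring
  have hkx : ∀ z ∈ B, fderiv ℝ k z (0, 1, 0) = 0 := by
    intro z hz
    rw [hder z hz]
    simp [hax z hz]
  have key := fun z (hz : z ∈ B) => coefficients_eq_zero_of_invariant (k := k)
    (c₀ := fun t => m t ^ 2 - deriv m t) (c₁ := fun t => 2 * m t) hr
    (fun z hz => contDiffAt_two (hkB.contDiffAt (hBo.mem_nhds hz))) hkx (by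
      intro z hz
      have hx' := hx z hz
      have hg := (h z hz).2.1
      rw [gaugedOp, base_decomp, hax z hz, haxx z hz] at hg
      rw [hder z hz]
      simp only [one_mul] at hg
      have hat : fderiv ℝ a z (1, 0, 0) = z.2.1 ^ 3 * (a z * (m z.1 ^ 2 * (z.2.1 ^ 4)⁻¹
        - 2 * m z.1 * (z.2.1 ^ 3)⁻¹)) - 2 * m z.1 * z.2.1 * (a z * (m z.1 * (z.2.1 ^ 2)⁻¹))
        - z.2.1 * fderiv ℝ a z (0, 0, 1) := by linear_combination hg
      simp [hat, hk]
      field_simp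
      ring) hz
  refine ⟨k, fun z hz => ?_⟩
  obtain ⟨k1, k2, k3⟩ := key z hz
  have hk0 : k z ≠ 0 := mul_ne_zero (h z hz).1 (Real.exp_ne_zero _)
  refine ⟨(hkB.contDiffAt (hBo.mem_nhds hz)).differentiableAt (by simp), hkx z hz, k3,
    by linarith, ?_, hk0, ?_⟩
  · have := (mul_eq_zero.1 k1).resolve_right hk0
    linarith
  · rw [hk, he]
    simp only
    rw [mul_assoc, ← Real.exp_add]
    simp

/-- Differentiating `m x a = x³ a_x` at `x = 0` gives `m a = 0`, so `m` vanishes. Then `a_x = 0` off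
`x = 0`, by continuity everywhere, and the gauged equation reduces to `a_t + x a_y = 0`. -/
theorem invariant_factor_of_eq_zero {a : Base → ℝ} {m : ℝ → ℝ} {t₀ y₀ r : ℝ} (hr : 0 < r)
    (ha : ContDiffOn ℝ ∞ a (Metric.ball (t₀, 0, y₀) r))
    (h : ∀ z ∈ Metric.ball ((t₀, 0, y₀) : Base) r, a z ≠ 0 ∧ gaugedOp (m z.1) a z = 0 ∧
        m z.1 * z.2.1 * a z = z.2.1 ^ 3 * fderiv ℝ a z (0, 1, 0)) :
    ∀ z ∈ Metric.ball ((t₀, 0, y₀) : Base) r,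
      fderiv ℝ a z (0, 1, 0) = 0 ∧ fderiv ℝ a z (0, 0, 1) = 0 ∧ fderiv ℝ a z (1, 0, 0) = 0 ∧
        m z.1 = 0 ∧ deriv m z.1 = 0 := by
  set B := Metric.ball ((t₀, 0, y₀) : Base) r with hB
  have hBo : IsOpen B := Metric.isOpen_ball
  have ca : ∀ z ∈ B, ContDiffAt ℝ 2 a z := fun z hz =>
    contDiffAt_two (ha.contDiffAt (hBo.mem_nhds hz))
  have hdd : ∀ z ∈ B, HasDerivAt (fun x : ℝ => fderiv ℝ a (z.1, x, z.2.2) (0, 1, 0))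
      (fderiv ℝ (fderiv ℝ a) z (0, 1, 0) (0, 1, 0)) z.2.1 := by
    intro z hz
    have h0 := ((contDiffAt_fderiv (ca z hz)).differentiableAt
      (by simp)).hasFDerivAt.clm_apply (hasFDerivAt_const ((0, 1, 0) : Base) z)
    have h1 := HasFDerivAt.comp_hasDerivAt (f := fun x : ℝ => ((z.1, x, z.2.2) : Base)) z.2.1 h0
      (hasDerivAt_lineX z.1 z.2.2 z.2.1)
    exact h1.congr_deriv (by simp)
  have hev : ∀ z ∈ B, ∀ᶠ x in 𝓝 z.2.1, ((z.1, x, z.2.2) : Base) ∈ B := fun z hz =>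
    (hasDerivAt_lineX z.1 z.2.2 z.2.1).continuousAt.eventually (hBo.mem_nhds hz)
  have hm0 : ∀ t ∈ Metric.ball t₀ r, m t = 0 := by
    intro t ht
    have hz : ((t, 0, y₀) : Base) ∈ B :=
      mem_ball_base.2 ⟨ht, Metric.mem_ball_self hr, Metric.mem_ball_self hr⟩
    have d1 : HasDerivAt (fun x : ℝ => a (t, x, y₀)) (fderiv ℝ a (t, 0, y₀) (0, 1, 0)) 0 :=
      HasFDerivAt.comp_hasDerivAt (f := fun x : ℝ => ((t, x, y₀) : Base)) 0
        ((ca _ hz).differentiableAt (by simp)).hasFDerivAt (hasDerivAt_lineX t y₀ 0)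
    have d2 := ((hasDerivAt_id (0 : ℝ)).const_mul (m t)).mul d1
    have d3 := (hasDerivAt_pow 3 (0 : ℝ)).mul (hdd _ hz)
    have heq : (fun x : ℝ => x ^ 3 * fderiv ℝ a (t, x, y₀) (0, 1, 0))
        =ᶠ[𝓝 0] fun x => m t * id x * a (t, x, y₀) := by
      filter_upwards [hev _ hz] with x hx using (h _ hx).2.2.symm
    have := (d2.congr_of_eventuallyEq heq).unique d3
    simpa [(h _ hz).1] using this
  have hax : ∀ z ∈ B, fderiv ℝ a z (0, 1, 0) = 0 := by
    have hne : ∀ z ∈ B, z.2.1 ≠ 0 → fderiv ℝ a z (0, 1, 0) = 0 := by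
      intro z hz hx
      have := (h z hz).2.2
      rw [hm0 z.1 (mem_ball_base.1 hz).1, zero_mul, zero_mul] at this
      exact (mul_eq_zero.1 this.symm).resolve_left (pow_ne_zero 3 hx)
    intro z hz
    by_cases hx : z.2.1 = 0
    · have h1 := ((hdd z hz).continuousAt.tendsto).mono_left
        (nhdsWithin_le_nhds (s := {z.2.1}ᶜ))
      refine tendsto_nhds_unique h1 ((tendsto_const_nhds (x := (0 : ℝ))).congr' ?_)
      filter_upwards [nhdsWithin_le_nhds (hev z hz), self_mem_nhdsWithin] with x hxB hx'
      refine (hne _ hxB ?_).symm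
      rw [hx] at hx'
      exact hx'
    · exact hne z hz hx
  intro z hz
  have key := coefficients_eq_zero_of_invariant (k := a) (c₀ := fun _ => 0) (c₁ := fun _ => 0) hr
    ca hax (by
      intro z hz
      have hg := (h z hz).2.1
      have hxx : fderiv ℝ (fderiv ℝ a) z (0, 1, 0) = 0 := fderiv_fderiv_eq_zero hBo ca hax hz
      rw [gaugedOp, base_decomp, hax z hz, hxx] at hg
      simp only [one_mul, zero_apply, mul_zero, sub_zero, add_zero] at hg
      linear_combination z.2.1 * hg) hz
  have ht := (mem_ball_base.1 hz).1
  refine ⟨hax z hz, key.2.2, by simpa using key.2.1, hm0 _ ht, ?_⟩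
  have : m =ᶠ[𝓝 z.1] fun _ => 0 := by
    filter_upwards [Metric.isOpen_ball.mem_nhds ht] with t ht' using hm0 t ht'
  rw [this.deriv_eq]
  simp

theorem exists_affine_of_deriv_eq_const {g : ℝ → ℝ} {c t₀ r : ℝ}
    (hg : ∀ t ∈ Metric.ball t₀ r, HasDerivAt g c t) :
    ∃ d, ∀ t ∈ Metric.ball t₀ r, g t = c * t + d := by
  have hd : ∀ t ∈ Metric.ball t₀ r, HasDerivAt (fun t => g t - c * t) 0 t := by
    intro t ht
    exact ((hg t ht).sub ((hasDerivAt_id t).const_mul c)).congr_deriv (by simp)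
  obtain ⟨d, hd'⟩ := Metric.isOpen_ball.exists_is_const_of_deriv_eq_zero
    (convex_ball t₀ r).isPreconnected
    (fun t ht => (hd t ht).differentiableAt.differentiableWithinAt) (fun t ht => (hd t ht).deriv)
  exact ⟨d, fun t ht => by linarith [hd' t ht]⟩

theorem exists_const_of_deriv_eq_zero {g : ℝ → ℝ} {t₀ r : ℝ}
    (hg : ∀ t ∈ Metric.ball t₀ r, HasDerivAt g 0 t) :
    ∃ d, ∀ t ∈ Metric.ball t₀ r, g t = d := by
  obtain ⟨d, hd⟩ := exists_affine_of_deriv_eq_const hg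
  exact ⟨d, fun t ht => by simpa using hd t ht⟩

/-- Functions with vanishing Schwarzian derivative are linear fractional. -/
theorem exists_mobius {τ : ℝ → ℝ} {t₀ r : ℝ} (hr : 0 < r)
    (hτ : ContDiffOn ℝ ∞ τ (Metric.ball t₀ r)) (h0 : ∀ t ∈ Metric.ball t₀ r, deriv τ t ≠ 0)
    (hS : ∀ t ∈ Metric.ball t₀ r, HasDerivAt (fun t => deriv (deriv τ) t / (2 * deriv τ t))
      ((deriv (deriv τ) t / (2 * deriv τ t)) ^ 2) t) :
    ∃ α β γ δ : ℝ, (α * δ - β * γ = 1 ∨ α * δ - β * γ = -1) ∧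
      ∀ t ∈ Metric.ball t₀ r, γ * t + δ ≠ 0 ∧ τ t = (α * t + β) / (γ * t + δ) ∧
        deriv τ t = (α * δ - β * γ) / (γ * t + δ) ^ 2 ∧
        deriv (deriv τ) t / (2 * deriv τ t) = -γ / (γ * t + δ) := by
  set I := Metric.ball t₀ r
  have hI : IsOpen I := Metric.isOpen_ball
  set m : ℝ → ℝ := fun t => deriv (deriv τ) t / (2 * deriv τ t) with hm
  have hτ1 : ContDiffOn ℝ ∞ (deriv τ) I := hτ.deriv_of_isOpen hI (by simp)
  have d1 : ∀ t ∈ I, HasDerivAt τ (deriv τ t) t := fun t ht =>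
    ((hτ.contDiffAt (hI.mem_nhds ht)).differentiableAt (by simp)).hasDerivAt
  have d2 : ∀ t ∈ I, HasDerivAt (deriv τ) (2 * m t * deriv τ t) t := by
    intro t ht
    have := ((hτ1.contDiffAt (hI.mem_nhds ht)).differentiableAt (by simp)).hasDerivAt
    refine this.congr_deriv ?_
    have := h0 t ht
    simp only [hm]
    field_simp
  -- `w = |τ'| ^ (-1/2)` linearizes the Schwarzian equation: `w' = -m w` and `(m w)' = 0`, so `w` is
  -- affine, and so is `τ w`. Their quotient is `τ`, and this scaling makes the determinant `τ' w² =
  -- ±1`.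
  set w : ℝ → ℝ := fun t => (deriv τ t ^ 2) ^ (-(1 / 4) : ℝ) with hw
  have hwpos : ∀ t ∈ I, 0 < w t := fun t ht =>
    Real.rpow_pos_of_pos (sq_pos_of_ne_zero (h0 t ht)) _
  have hw4 : ∀ t ∈ I, w t ^ 4 * deriv τ t ^ 2 = 1 := by
    intro t ht
    have hp : 0 < deriv τ t ^ 2 := sq_pos_of_ne_zero (h0 t ht)
    have : w t ^ 4 = (deriv τ t ^ 2)⁻¹ := by
      rw [hw, ← Real.rpow_natCast, ← Real.rpow_mul hp.le, ← Real.rpow_neg_one]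
      norm_num
    rw [this, inv_mul_cancel₀ hp.ne']
  have dw : ∀ t ∈ I, HasDerivAt w (-(m t * w t)) t := by
    intro t ht
    have hp : deriv τ t ^ 2 ≠ 0 := pow_ne_zero 2 (h0 t ht)
    have := ((d2 t ht).pow 2).rpow_const (p := -(1 / 4)) (Or.inl hp)
    refine this.congr_deriv ?_
    have hne := h0 t ht
    simp only [Pi.pow_apply]
    rw [Real.rpow_sub_one hp]
    change _ = -(m t * (deriv τ t ^ 2) ^ (-(1 / 4) : ℝ))
    field_simp
    norm_num
    ring
  have dmw : ∀ t ∈ I, HasDerivAt (fun t => m t * w t) 0 t := fun t ht =>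
    ((hS t ht).mul (dw t ht)).congr_deriv (by ring)
  obtain ⟨c, hc⟩ := exists_const_of_deriv_eq_zero dmw
  obtain ⟨δ, hδ⟩ := exists_affine_of_deriv_eq_const (g := w) (c := -c) fun t ht => by
    have := dw t ht
    rwa [hc t ht] at this
  have dτw : ∀ t ∈ I, HasDerivAt (fun t => deriv τ t * w t - τ t * c) 0 t := by
    intro t ht
    refine (((d2 t ht).mul (dw t ht)).sub ((d1 t ht).mul_const c)).congr_deriv ?_
    linear_combination deriv τ t * hc t ht
  obtain ⟨α, hα⟩ := exists_const_of_deriv_eq_zero dτw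
  obtain ⟨β, hβ⟩ := exists_affine_of_deriv_eq_const (g := fun t => τ t * w t) (c := α)
    fun t ht => by
      refine ((d1 t ht).mul (dw t ht)).congr_deriv ?_
      linear_combination hα t ht - τ t * hc t ht
  have hdet : ∀ t ∈ I, α * δ - β * -c = deriv τ t * w t ^ 2 := by
    intro t ht
    have e1 := hα t ht
    have e2 := hβ t ht
    have e3 := hδ t ht
    linear_combination -α * e3 - c * e2 - w t * e1
  refine ⟨α, β, -c, δ, ?_, fun t ht => ?_⟩
  · have ht := Metric.mem_ball_self (x := t₀) hr
    have h1 : (α * δ - β * -c) ^ 2 = 1 := by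
      rw [hdet t₀ ht, ← hw4 t₀ ht]
      ring
    have h2 : (α * δ - β * -c - 1) * (α * δ - β * -c + 1) = 0 := by linear_combination h1
    exact (mul_eq_zero.1 h2).imp sub_eq_zero.1 eq_neg_of_add_eq_zero_left
  · have hwt := (hwpos t ht).ne'
    rw [← hδ t ht, hdet t ht]
    have e2 := hβ t ht
    have e3 := hc t ht
    refine ⟨hwt, ?_, ?_, ?_⟩
    · rw [eq_div_iff hwt, ← e2]
    · field_simp
    · rw [eq_div_iff hwt, neg_neg, ← e3]

/-- The coefficient of `u` in a point symmetry. -/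
noncomputable def symmetryFactor (α β γ δ σ : ℝ) (z : Base) : ℝ :=
  σ * ((γ * z.1 + δ) ^ 2 / (α * δ - β * γ)) * Real.exp (γ * z.2.1⁻¹ / (γ * z.1 + δ))

/-- With `m = -γ / (γ t + δ)` the equations for `k` say that `k / (γ t + δ)²` has zero gradient. The
alternative `hx` selects one of the two preceding lemmas; in the case `x₀ = 0` the vanishing of `m`
means `γ = 0`. -/
theorem exists_constants {τ : ℝ → ℝ} {a : Base → ℝ} {t₀ x₀ y₀ r : ℝ} (hr : 0 < r)
    (hτ : ContDiffOn ℝ ∞ τ (Metric.ball t₀ r)) (h0 : ∀ t ∈ Metric.ball t₀ r, deriv τ t ≠ 0)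
    (ha : ContDiffOn ℝ ∞ a (Metric.ball (t₀, x₀, y₀) r))
    (h : ∀ z ∈ Metric.ball ((t₀, x₀, y₀) : Base) r, a z ≠ 0 ∧
        gaugedOp (deriv (deriv τ) z.1 / (2 * deriv τ z.1)) a z = 0 ∧
        deriv (deriv τ) z.1 / (2 * deriv τ z.1) * z.2.1 * a z
          = z.2.1 ^ 3 * fderiv ℝ a z (0, 1, 0))
    (hx : x₀ = 0 ∨ ∀ z ∈ Metric.ball ((t₀, x₀, y₀) : Base) r, z.2.1 ≠ 0) :
    ∃ α β γ δ σ : ℝ, AdmissibleConstants α β γ δ σ ∧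
      Metric.ball ((t₀, x₀, y₀) : Base) r ⊆ naturalDomain γ δ ∧
      (∀ t ∈ Metric.ball t₀ r, τ t = (α * t + β) / (γ * t + δ) ∧
        deriv τ t = (α * δ - β * γ) / (γ * t + δ) ^ 2) ∧
      ∀ z ∈ Metric.ball ((t₀, x₀, y₀) : Base) r, a z = symmetryFactor α β γ δ σ z := by
  set m : ℝ → ℝ := fun t => deriv (deriv τ) t / (2 * deriv τ t) with hm
  set B := Metric.ball ((t₀, x₀, y₀) : Base) r with hB
  have hBo : IsOpen B := Metric.isOpen_ball
  have hI : IsOpen (Metric.ball t₀ r) := Metric.isOpen_ball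
  have hτ1 : ContDiffOn ℝ ∞ (deriv τ) (Metric.ball t₀ r) := hτ.deriv_of_isOpen hI (by simp)
  have hτ2 : ContDiffOn ℝ ∞ (deriv (deriv τ)) (Metric.ball t₀ r) :=
    hτ1.deriv_of_isOpen hI (by simp)
  have hms : ContDiffOn ℝ ∞ m (Metric.ball t₀ r) :=
    hτ2.div (contDiffOn_const.mul hτ1) fun t ht => mul_ne_zero two_ne_zero (h0 t ht)
  have hfactor : ∃ k : Base → ℝ, ∀ z ∈ B,
      DifferentiableAt ℝ k z ∧ fderiv ℝ k z (0, 1, 0) = 0 ∧ fderiv ℝ k z (0, 0, 1) = 0 ∧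
        fderiv ℝ k z (1, 0, 0) = -2 * m z.1 * k z ∧ deriv m z.1 = m z.1 ^ 2 ∧ k z ≠ 0 ∧
        a z = k z * Real.exp (-m z.1 * z.2.1⁻¹) ∧ (m z.1 = 0 ∨ z.2.1 ≠ 0) := by
    rcases hx with rfl | hx
    · have h1 := invariant_factor_of_eq_zero (m := m) hr ha h
      refine ⟨a, fun z hz => ?_⟩
      obtain ⟨e1, e2, e3, e4, e5⟩ := h1 z hz
      refine ⟨(ha.contDiffAt (hBo.mem_nhds hz)).differentiableAt (by simp), e1, e2, ?_, ?_,
        (h z hz).1, ?_, Or.inl e4⟩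
      · rw [e3, e4]; simp
      · rw [e4, e5]; simp
      · rw [e4]; simp
    · obtain ⟨k, hk⟩ := invariant_factor_of_ne_zero hr hms ha h hx
      refine ⟨k, fun z hz => ?_⟩
      obtain ⟨e1, e2, e3, e4, e5, e6, e7⟩ := hk z hz
      exact ⟨e1, e2, e3, e4, e5, e6, e7, Or.inr (hx z hz)⟩
  obtain ⟨k, hk⟩ := hfactor
  have hmt : ∀ t ∈ Metric.ball t₀ r, ((t, x₀, y₀) : Base) ∈ B := fun t ht =>
    mem_ball_base.2 ⟨ht, Metric.mem_ball_self hr, Metric.mem_ball_self hr⟩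
  obtain ⟨α, β, γ, δ, hdet, hT⟩ := exists_mobius hr hτ h0 fun t ht => by
    have h1 := ((hms.contDiffAt (hI.mem_nhds ht)).differentiableAt (by simp)).hasDerivAt
    rwa [(hk _ (hmt t ht)).2.2.2.2.1] at h1
  have hε : (α * δ - β * γ) ^ 2 = 1 := by
    rcases hdet with h1 | h1 <;> rw [h1] <;> norm_num
  have hW : ∀ z ∈ B, γ * z.1 + δ ≠ 0 := fun z hz => (hT z.1 (mem_ball_base.1 hz).1).1
  have hmW : ∀ z ∈ B, m z.1 = -γ / (γ * z.1 + δ) := fun z hz =>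
    (hT z.1 (mem_ball_base.1 hz).1).2.2.2
  have hd : ∀ z ∈ B, HasFDerivAt (fun z : Base => k z * ((γ * z.1 + δ) ^ 2)⁻¹)
      (0 : Base →L[ℝ] ℝ) z := by
    intro z hz
    obtain ⟨e1, e2, e3, e4, -⟩ := hk z hz
    have hne := hW z hz
    have d1 : HasDerivAt (fun t : ℝ => ((γ * t + δ) ^ 2)⁻¹)
        (-(2 * (γ * z.1 + δ) * γ) / ((γ * z.1 + δ) ^ 2) ^ 2) z.1 :=
      (((((hasDerivAt_id z.1).const_mul γ).add_const δ).pow 2).inv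
        (pow_ne_zero 2 hne)).congr_deriv (by simp)
    have d2 : HasFDerivAt (fun z : Base => ((γ * z.1 + δ) ^ 2)⁻¹)
        ((-(2 * (γ * z.1 + δ) * γ) / ((γ * z.1 + δ) ^ 2) ^ 2) • dT) z :=
      HasDerivAt.comp_hasFDerivAt (f := fun z : Base => z.1) z d1 dT.hasFDerivAt
    refine (e1.hasFDerivAt.mul d2).congr_fderiv (ContinuousLinearMap.ext fun v => ?_)
    rw [hmW z hz] at e4
    simp only [add_apply, smul_apply, smul_eq_mul, dT_apply, zero_apply]
    rw [base_decomp (fderiv ℝ k z) v, e2, e3, e4]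
    field_simp
    ring
  obtain ⟨σ', hσ'⟩ : ∃ σ', ∀ z ∈ B, k z * ((γ * z.1 + δ) ^ 2)⁻¹ = σ' := by
    refine ⟨_, fun z hz => eq_of_fderiv_apply_eq_zero (convex_ball _ _)
      (fun q hq => (hd q hq).differentiableAt) (Metric.mem_ball_self hr) hz fun q hq => ?_⟩
    rw [(hd q hq).fderiv]
    simp
  have hkσ : ∀ z ∈ B, k z = σ' * (γ * z.1 + δ) ^ 2 := by
    intro z hz
    rw [← hσ' z hz, mul_assoc, inv_mul_cancel₀ (pow_ne_zero 2 (hW z hz)), mul_one]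
  have hσ0 : σ' ≠ 0 := by
    have hz := Metric.mem_ball_self (x := ((t₀, x₀, y₀) : Base)) hr
    have h1 := (hk _ hz).2.2.2.2.2.1
    rw [hkσ _ hz] at h1
    exact left_ne_zero_of_mul h1
  have hε0 : α * δ - β * γ ≠ 0 := by
    intro h1
    rw [h1] at hε
    norm_num at hε
  -- The explicit factor of `u` contains a division by the determinant, which `σ` has to compensate.
  refine ⟨α, β, γ, δ, σ' * (α * δ - β * γ), ⟨hdet, mul_ne_zero hσ0 hε0⟩, fun z hz => ?_,
    fun t ht => ⟨(hT t ht).2.1, (hT t ht).2.2.1⟩, fun z hz => ?_⟩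
  · refine ⟨hW z hz, (hk z hz).2.2.2.2.2.2.2.imp_left fun h1 => ?_⟩
    rw [hmW z hz] at h1
    have := (div_eq_zero_iff.1 h1).resolve_right (hW z hz)
    linarith
  · rw [(hk z hz).2.2.2.2.2.2.1, hkσ z hz, hmW z hz, symmetryFactor]
    congr 1
    · generalize α * δ - β * γ = ε at hε0
      field_simp
    · congr 1
      ring

/-! ### The explicit transformations preserve the equation -/

/-- The transformation of the independent variables. -/
noncomputable def baseMap (α β γ δ lam : ℝ) (z : Base) : Base :=
  ((α * z.1 + β) / (γ * z.1 + δ), (γ * z.1 + δ) ^ 2 / (α * δ - β * γ) * z.2.1, z.2.2 + lam)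

theorem symmetryMap_apply (α β γ δ lam σ : ℝ) (f : Base → ℝ) (p : Total) :
    symmetryMap α β γ δ lam σ f p
      = (baseMap α β γ δ lam p.1, symmetryFactor α β γ δ σ p.1 * (p.2 + f p.1)) := rfl

section Constants

variable {α β γ δ lam σ : ℝ} {z : Base}

theorem AdmissibleConstants.sq_eq_one (h : AdmissibleConstants α β γ δ σ) :
    (α * δ - β * γ) ^ 2 = 1 := by
  rcases h.1 with h1 | h1 <;> rw [h1] <;> norm_num

theorem AdmissibleConstants.ne_zero (h : AdmissibleConstants α β γ δ σ) :
    α * δ - β * γ ≠ 0 := by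
  rcases h.1 with h1 | h1 <;> rw [h1] <;> norm_num

theorem isOpen_naturalDomain (γ δ : ℝ) : IsOpen (naturalDomain γ δ) := by
  have h1 : IsOpen {z : Base | γ * z.1 + δ ≠ 0} := isOpen_ne_fun (by fun_prop) (by fun_prop)
  by_cases h : γ = 0
  · convert h1 using 1
    ext z
    simp [naturalDomain, h]
  · have h2 : IsOpen {z : Base | z.2.1 ≠ 0} := isOpen_ne_fun (by fun_prop) (by fun_prop)
    convert h1.inter h2 using 1
    ext z
    simp [naturalDomain, h]

theorem symmetryFactor_ne_zero (h : AdmissibleConstants α β γ δ σ) (hz : γ * z.1 + δ ≠ 0) :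
    symmetryFactor α β γ δ σ z ≠ 0 :=
  mul_ne_zero (mul_ne_zero h.2 (div_ne_zero (pow_ne_zero 2 hz) h.ne_zero)) (Real.exp_ne_zero _)

theorem contDiffAt_baseMap (h : α * δ - β * γ ≠ 0) (hz : γ * z.1 + δ ≠ 0) :
    ContDiffAt ℝ ∞ (baseMap α β γ δ lam) z := by
  refine ContDiffAt.prodMk (ContDiffAt.div (by fun_prop) (by fun_prop) hz)
    (ContDiffAt.prodMk ?_ (by fun_prop))
  have h1 : ContDiffAt ℝ ∞ (fun z : Base => (γ * z.1 + δ) ^ 2 / (α * δ - β * γ)) z :=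
    ContDiffAt.div (by fun_prop) contDiffAt_const h
  exact h1.mul (by fun_prop)

/-- The inverse comes from the adjugate matrix, whose determinant is the same; the first identity
makes the two factors of `x` reciprocal. -/
theorem baseMap_baseMap (h : α * δ - β * γ ≠ 0) (hz : γ * z.1 + δ ≠ 0) :
    -γ * (baseMap α β γ δ lam z).1 + α = (α * δ - β * γ) / (γ * z.1 + δ) ∧
      baseMap δ (-β) (-γ) α (-lam) (baseMap α β γ δ lam z) = z := by
  have h1 : -γ * (baseMap α β γ δ lam z).1 + α = (α * δ - β * γ) / (γ * z.1 + δ) := by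
    simp only [baseMap]
    field_simp
    ring
  refine ⟨h1, ?_⟩
  have h3 : δ * α - -β * -γ = α * δ - β * γ := by ring
  refine Prod.ext ?_ (Prod.ext ?_ ?_)
  · rw [baseMap]
    simp only [h1]
    rw [div_eq_iff (div_ne_zero h hz)]
    simp only [baseMap]
    rw [mul_div_assoc', mul_div_assoc', div_add' _ _ _ hz]
    congr 1
    ring
  · rw [baseMap]
    simp only [h1, h3]
    simp only [baseMap]
    generalize α * δ - β * γ = ε at *
    field_simp
  · simp [baseMap]

theorem symmetryFactor_of_eq_zero :
    symmetryFactor α β 0 δ σ = fun _ => σ * (δ ^ 2 / (α * δ)) := by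
  ext z
  simp [symmetryFactor]

theorem hasFDerivAt_symmetryFactor (h : α * δ - β * γ ≠ 0) (hz : γ * z.1 + δ ≠ 0)
    (hx : z.2.1 ≠ 0) :
    HasFDerivAt (symmetryFactor α β γ δ σ)
      (symmetryFactor α β γ δ σ z •
        ((2 * γ / (γ * z.1 + δ) - γ ^ 2 * z.2.1⁻¹ / (γ * z.1 + δ) ^ 2) • dT
          - (γ * (z.2.1 ^ 2)⁻¹ / (γ * z.1 + δ)) • dX)) z := by
  have d0 : HasFDerivAt (fun z : Base => γ * z.1 + δ) (γ • dT) z :=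
    (dT.hasFDerivAt.const_mul γ).add_const δ
  have d1 : HasFDerivAt (fun z : Base => σ * ((γ * z.1 + δ) ^ 2 / (α * δ - β * γ)))
      ((σ * (2 * (γ * z.1 + δ) * γ / (α * δ - β * γ))) • dT) z := by
    refine (((d0.pow 2).mul_const (α * δ - β * γ)⁻¹).const_mul σ).congr_fderiv ?_
    refine ContinuousLinearMap.ext fun v => ?_
    simp
    ring
  have d2 : HasFDerivAt (fun z : Base => z.2.1⁻¹) (-(z.2.1 ^ 2)⁻¹ • dX) z :=
    HasDerivAt.comp_hasFDerivAt (f := fun z : Base => z.2.1) z (hasDerivAt_inv hx) dX.hasFDerivAt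
  have d3 : HasFDerivAt (fun z : Base => (γ * z.1 + δ)⁻¹)
      (-((γ * z.1 + δ) ^ 2)⁻¹ • (γ • dT)) z :=
    HasDerivAt.comp_hasFDerivAt (f := fun z : Base => γ * z.1 + δ) z (hasDerivAt_inv hz) d0
  refine (d1.mul ((d2.const_mul γ).mul d3).exp).congr_fderiv ?_
  refine ContinuousLinearMap.ext fun v => ?_
  simp [symmetryFactor]
  generalize α * δ - β * γ = ε at *
  simp only [div_eq_mul_inv]
  generalize Real.exp _ = E
  field_simp
  ring

theorem contDiffAt_symmetryFactor (h : AdmissibleConstants α β γ δ σ)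
    (hz : z ∈ naturalDomain γ δ) : ContDiffAt ℝ ∞ (symmetryFactor α β γ δ σ) z := by
  by_cases hγ : γ = 0
  · subst hγ
    rw [symmetryFactor_of_eq_zero]
    exact contDiffAt_const
  · have hx := hz.2.resolve_left hγ
    have h1 : ContDiffAt ℝ ∞ (fun z : Base => z.2.1⁻¹) z := ContDiffAt.inv (by fun_prop) hx
    have h2 : ContDiffAt ℝ ∞ (fun z : Base => (γ * z.1 + δ) ^ 2 / (α * δ - β * γ)) z :=
      ContDiffAt.div (by fun_prop) (by fun_prop) h.ne_zero
    exact (contDiffAt_const.mul h2).mul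
      ((contDiffAt_const.mul h1).div (by fun_prop) hz.1).exp

/-- The coefficient of `u` satisfies the gauge conditions. -/
theorem symmetryFactor_gauge (h : AdmissibleConstants α β γ δ σ) (hz : z ∈ naturalDomain γ δ) :
    gaugedOp (-γ / (γ * z.1 + δ)) (symmetryFactor α β γ δ σ) z = 0 ∧
      -γ / (γ * z.1 + δ) * z.2.1 * symmetryFactor α β γ δ σ z
        = z.2.1 ^ 3 * fderiv ℝ (symmetryFactor α β γ δ σ) z (0, 1, 0) := by
  by_cases hγ : γ = 0
  · subst hγ
    rw [symmetryFactor_of_eq_zero]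
    have e : fderiv ℝ (fun _ : Base => σ * (δ ^ 2 / (α * δ))) = fun _ => 0 := by
      ext1 z; simp
    simp [gaugedOp, e]
  · have hx := hz.2.resolve_left hγ
    have hz1 := hz.1
    have hd := hasFDerivAt_symmetryFactor (σ := σ) h.ne_zero hz.1 hx
    have hev : (fun z => fderiv ℝ (symmetryFactor α β γ δ σ) z (0, 1, 0)) =ᶠ[𝓝 z]
        fun z => symmetryFactor α β γ δ σ z * (-(γ * (z.2.1 ^ 2)⁻¹) * (γ * z.1 + δ)⁻¹) := by
      filter_upwards [(isOpen_naturalDomain γ δ).mem_nhds hz] with y hy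
      rw [(hasFDerivAt_symmetryFactor (σ := σ) h.ne_zero hy.1 (hy.2.resolve_left hγ)).fderiv]
      simp only [smul_apply, sub_apply, dT_apply, dX_apply, smul_eq_mul]
      ring
    have hxx : fderiv ℝ (fderiv ℝ (symmetryFactor α β γ δ σ)) z (0, 1, 0) (0, 1, 0)
        = symmetryFactor α β γ δ σ z * (γ ^ 2 * (z.2.1 ^ 4)⁻¹ / (γ * z.1 + δ) ^ 2
          + 2 * γ * (z.2.1 ^ 3)⁻¹ / (γ * z.1 + δ)) := by
      rw [← fderiv_fderiv_apply (contDiffAt_two (contDiffAt_symmetryFactor h hz)), hev.fderiv_eq]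
      have d2 : HasFDerivAt (fun z : Base => (z.2.1 ^ 2)⁻¹)
          ((-(2 * z.2.1) / (z.2.1 ^ 2) ^ 2) • dX) z := by
        have h0 : HasDerivAt (fun x : ℝ => (x ^ 2)⁻¹) (-(2 * z.2.1) / (z.2.1 ^ 2) ^ 2) z.2.1 :=
          ((hasDerivAt_pow 2 z.2.1).inv (pow_ne_zero 2 hx)).congr_deriv (by simp)
        exact HasDerivAt.comp_hasFDerivAt (f := fun z : Base => z.2.1) z h0 dX.hasFDerivAt
      have d0 : HasFDerivAt (fun z : Base => γ * z.1 + δ) (γ • dT) z :=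
        (dT.hasFDerivAt.const_mul γ).add_const δ
      have d3 : HasFDerivAt (fun z : Base => (γ * z.1 + δ)⁻¹)
          (-((γ * z.1 + δ) ^ 2)⁻¹ • (γ • dT)) z :=
        HasDerivAt.comp_hasFDerivAt (f := fun z : Base => γ * z.1 + δ) z (hasDerivAt_inv hz1) d0
      refine (congrArg (fun L : Base →L[ℝ] ℝ => L (0, 1, 0))
        (hd.mul ((d2.const_mul γ).neg.mul d3)).fderiv).trans ?_
      simp
      field_simp
      ring
    constructor
    · rw [gaugedOp, hxx, hd.fderiv]
      simp
      field_simp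
      ring
    · rw [hd.fderiv]
      simp
      field_simp

/-- The transformation of the equation under the change of the independent variables. -/
theorem gaugedOp_comp_baseMap (h : (α * δ - β * γ) ^ 2 = 1) (hz : γ * z.1 + δ ≠ 0) {v : Base → ℝ}
    (hv : ContDiffAt ℝ 2 v (baseMap α β γ δ lam z)) :
    gaugedOp (-γ / (γ * z.1 + δ)) (fun z => v (baseMap α β γ δ lam z)) z
      = (α * δ - β * γ) / (γ * z.1 + δ) ^ 2 * kolmogorovOp v (baseMap α β γ δ lam z) := by
  have hε : α * δ - β * γ ≠ 0 := by
    intro h0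
    rw [h0] at h
    norm_num at h
  have hF := contDiffAt_baseMap (lam := lam) hε hz
  have hdv := hv.differentiableAt (by simp)
  have hdF := hF.differentiableAt (by simp)
  have hd : DifferentiableAt ℝ (fun z => v (baseMap α β γ δ lam z)) z := hdv.comp z hdF
  have c2 : ContDiffAt ℝ 2 (fun z => v (baseMap α β γ δ lam z)) z :=
    hv.comp z (contDiffAt_two hF)
  have lT : HasDerivAt (fun s : ℝ => baseMap α β γ δ lam (s, z.2.1, z.2.2))
      ((α * δ - β * γ) / (γ * z.1 + δ) ^ 2,
        2 * (γ * z.1 + δ) * γ / (α * δ - β * γ) * z.2.1, 0) z.1 := by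
    have e0 := ((hasDerivAt_id z.1).const_mul γ).add_const δ
    have e1 := (((hasDerivAt_id z.1).const_mul α).add_const β).div e0 hz
    have e2 := ((e0.pow 2).div_const (α * δ - β * γ)).mul_const z.2.1
    have e3 := e1.prodMk (e2.prodMk (hasDerivAt_const z.1 (z.2.2 + lam)))
    refine e3.congr_deriv (Prod.ext ?_ (Prod.ext ?_ rfl))
    · simp only [id, mul_one]
      congr 1
      ring
    · simp
  have lX : ∀ r : ℝ, HasDerivAt (fun s : ℝ => baseMap α β γ δ lam (z.1, s, z.2.2))
      (0, (γ * z.1 + δ) ^ 2 / (α * δ - β * γ), 0) r := fun r =>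
    HasDerivAt.congr_deriv
      (f := fun s : ℝ => baseMap α β γ δ lam (z.1, s, z.2.2))
      ((hasDerivAt_const r ((α * z.1 + β) / (γ * z.1 + δ))).prodMk (((hasDerivAt_id r).const_mul
        ((γ * z.1 + δ) ^ 2 / (α * δ - β * γ))).prodMk (hasDerivAt_const r (z.2.2 + lam))))
      (Prod.ext rfl (Prod.ext (mul_one _) rfl))
  have lY : HasDerivAt (fun s : ℝ => baseMap α β γ δ lam (z.1, z.2.1, s)) (0, 0, 1) z.2.2 :=
    (hasDerivAt_const z.2.2 ((α * z.1 + β) / (γ * z.1 + δ))).prodMk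
      ((hasDerivAt_const z.2.2 ((γ * z.1 + δ) ^ 2 / (α * δ - β * γ) * z.2.1)).prodMk
        ((hasDerivAt_id z.2.2).add_const lam))
  -- Each derivative is taken along a coordinate line and along its image curve. Images of `x`-lines
  -- are straight, so `kXX` has no first-order term; the `v_x` produced by the `t`-dependence of the
  -- factor of `x` is cancelled by the drift of `gaugedOp`.
  have kT : fderiv ℝ (fun z => v (baseMap α β γ δ lam z)) z (1, 0, 0) = _ :=
    (deriv_comp_line (hasDerivAt_lineT z.2.1 z.2.2 z.1) hd).symm.trans (deriv_comp_line lT hdv)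
  have kX : fderiv ℝ (fun z => v (baseMap α β γ δ lam z)) z (0, 1, 0) = _ :=
    (deriv_comp_line (hasDerivAt_lineX z.1 z.2.2 z.2.1) hd).symm.trans
      (deriv_comp_line (lX _) hdv)
  have kY : fderiv ℝ (fun z => v (baseMap α β γ δ lam z)) z (0, 0, 1) = _ :=
    (deriv_comp_line (hasDerivAt_lineY z.1 z.2.1 z.2.2) hd).symm.trans (deriv_comp_line lY hdv)
  have kXX : fderiv ℝ (fderiv ℝ (fun z => v (baseMap α β γ δ lam z))) z (0, 1, 0) (0, 1, 0) = _ :=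
    (deriv_deriv_comp_line (h := fun z => v (baseMap α β γ δ lam z))
      (c := fun s : ℝ => ((z.1, s, z.2.2) : Base)) (s := z.2.1)
      (hasDerivAt_lineX z.1 z.2.2) c2).symm.trans
      (deriv_deriv_comp_line (h := v)
        (c := fun s : ℝ => baseMap α β γ δ lam (z.1, s, z.2.2)) (s := z.2.1) lX hv)
  have e0 : ((0, (γ * z.1 + δ) ^ 2 / (α * δ - β * γ), 0) : Base)
      = ((γ * z.1 + δ) ^ 2 / (α * δ - β * γ)) • (0, 1, 0) := by
    simp
  rw [gaugedOp, kolmogorovOp, base_decomp (fderiv ℝ (fun z => v (baseMap α β γ δ lam z)) z),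
    kT, kX, kY, kXX, e0, base_decomp _ (_, _, (0 : ℝ))]
  change _ = _ * (_ - (baseMap α β γ δ lam z).2.1 ^ 3 * _)
  have e1 : (baseMap α β γ δ lam z).2.1 = (γ * z.1 + δ) ^ 2 / (α * δ - β * γ) * z.2.1 := rfl
  simp only [e1, map_smul, smul_apply, smul_eq_mul]
  generalize fderiv ℝ v (baseMap α β γ δ lam z) = L
  generalize fderiv ℝ (fderiv ℝ v) (baseMap α β γ δ lam z) (0, 1, 0) (0, 1, 0) = M
  generalize α * δ - β * γ = ε at *
  have e2 : L (1, 0, (γ * z.1 + δ) ^ 2 / ε * z.2.1)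
      = L (1, 0, 0) + (γ * z.1 + δ) ^ 2 / ε * z.2.1 * L (0, 0, 1) := by
    rw [base_decomp L (1, 0, (γ * z.1 + δ) ^ 2 / ε * z.2.1)]
    ring
  rw [e2]
  field_simp
  ring_nf

/-- The equation is satisfied by a function at a point if and only if it is satisfied by its image
under the transformation at the corresponding point. -/
theorem kolmogorovOp_image_iff (h : AdmissibleConstants α β γ δ σ) (hz : z ∈ naturalDomain γ δ)
    {u v f : Base → ℝ} (hv : ContDiffAt ℝ 2 v (baseMap α β γ δ lam z)) (hu : ContDiffAt ℝ 2 u z)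
    (hf : ContDiffAt ℝ 2 f z) (hf0 : kolmogorovOp f z = 0)
    (heq : ∀ᶠ y in 𝓝 z, v (baseMap α β γ δ lam y) = symmetryFactor α β γ δ σ y * (u y + f y)) :
    kolmogorovOp v (baseMap α β γ δ lam z) = 0 ↔ kolmogorovOp u z = 0 := by
  obtain ⟨g1, g2⟩ := symmetryFactor_gauge h hz
  -- The gauged operator on `v ∘ baseMap = a (u + f)`, with `a` the symmetry factor, is computed in
  -- two ways: a nonzero multiple of the equation for `v`, and `a` times the equation for `u`.
  have h1 := gaugedOp_comp_baseMap h.sq_eq_one hz.1 hv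
  rw [gaugedOp_congr heq, gaugedOp_mul (contDiffAt_two (contDiffAt_symmetryFactor h hz))
    (hu.add hf) g2, g1, kolmogorovOp_add hu hf, hf0] at h1
  have hc : (α * δ - β * γ) / (γ * z.1 + δ) ^ 2 ≠ 0 :=
    div_ne_zero h.ne_zero (pow_ne_zero 2 hz.1)
  have ha := symmetryFactor_ne_zero h hz.1
  simp only [mul_zero, add_zero] at h1
  constructor
  · intro h0
    rw [h0, mul_zero] at h1
    exact (mul_eq_zero.1 h1).resolve_left ha
  · intro h0
    rw [h0, mul_zero] at h1
    exact (mul_eq_zero.1 h1.symm).resolve_left hc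

end Constants

/-! ### Every symmetry has the explicit form locally -/

section Form

variable {Φ : OpenPartialHomeomorph Total Total}

/-- Every point symmetry is locally of the explicit form. -/
theorem exists_local_form (hΦ : Φ ∈ symmetryPseudogroup) {p : Total} (hp : p ∈ Φ.source) :
    ∃ Ω : Set Total, IsOpen Ω ∧ p ∈ Ω ∧ Ω ⊆ Φ.source ∧
      ∃ (α β γ δ lam σ : ℝ) (f : Base → ℝ), HasSymmetryForm Φ Ω α β γ δ lam σ f := by
  obtain ⟨⟨t₀, x₀, y₀⟩, u₀⟩ := p
  obtain ⟨R, hR, hRball⟩ := Metric.isOpen_iff.1 Φ.open_source _ hp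
  obtain ⟨r, hr, hball, hx⟩ : ∃ r > 0, Metric.ball (((t₀, x₀, y₀), u₀) : Total) r ⊆ Φ.source ∧
      (x₀ = 0 ∨ ∀ z ∈ Metric.ball ((t₀, x₀, y₀) : Base) r, z.2.1 ≠ 0) := by
    by_cases hx : x₀ = 0
    · exact ⟨R, hR, hRball, Or.inl hx⟩
    -- A radius of at most `|x₀|` keeps the ball off `x = 0`.
    · refine ⟨min R |x₀|, lt_min hR (abs_pos.2 hx),
        (Metric.ball_subset_ball (min_le_left _ _)).trans hRball, Or.inr fun z hz h0 => ?_⟩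
      have h1 := (mem_ball_base.1 hz).2.1
      rw [h0, Metric.mem_ball, Real.dist_eq, zero_sub, abs_neg] at h1
      exact absurd (h1.trans_le (min_le_right _ _)) (lt_irrefl _)
  obtain ⟨τ, lam, a, b, hτ, hτ0, ha, hb, hform, hab⟩ := local_structure hΦ hr hball
  obtain ⟨α, β, γ, δ, σ, hadm, hnat, hτ', ha'⟩ := exists_constants hr hτ hτ0 ha
    (fun z hz => ⟨(hab z hz).1, (hab z hz).2.1, (hab z hz).2.2.2⟩) hx
  have hfst : Prod.fst '' Metric.ball (((t₀, x₀, y₀), u₀) : Total) r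
      = Metric.ball ((t₀, x₀, y₀) : Base) r := by
    rw [← ball_prod_same]
    exact fst_image_prod _ ⟨u₀, Metric.mem_ball_self hr⟩
  have hBo : IsOpen (Metric.ball ((t₀, x₀, y₀) : Base) r) := Metric.isOpen_ball
  -- From `b + (u - u₀) a = a (u + b / a - u₀)` one reads off `f = b / a - u₀`. The constant is
  -- written as an affine function of `x` to fit `isSolutionOn_affine`, and `b / a` is a solution by
  -- `gaugedOp_mul`.
  refine ⟨_, Metric.isOpen_ball, Metric.mem_ball_self hr, hball, α, β, γ, δ, lam, σ,
    fun z => b z / a z + (-u₀ + 0 * (z.2.1 - 0)), hadm, ?_, ?_, ?_⟩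
  · rw [hfst]
    exact hnat
  · rw [hfst]
    refine IsSolutionOn.add ?_ (isSolutionOn_affine _ _ _ hBo)
    rw [isSolutionOn_iff]
    have hg : ContDiffOn ℝ ∞ (fun z => b z / a z) (Metric.ball (t₀, x₀, y₀) r) :=
      hb.div ha fun z hz => (hab z hz).1
    refine ⟨hBo, hg, fun z hz => ?_⟩
    obtain ⟨k1, k2, k3, k4⟩ := hab z hz
    have hn := hBo.mem_nhds hz
    have h1 := gaugedOp_mul (contDiffAt_two (ha.contDiffAt hn))
      (contDiffAt_two (hg.contDiffAt hn)) k4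
    have e : (fun y => a y * (b y / a y)) =ᶠ[𝓝 z] b := by
      filter_upwards [hn] with y hy using mul_div_cancel₀ _ (hab y hy).1
    rw [gaugedOp_congr e, k2, k3, mul_zero, add_zero] at h1
    exact (mul_eq_zero.1 h1.symm).resolve_left k1
  · rintro ⟨z, u⟩ hzu
    rw [← ball_prod_same] at hzu
    have hz : z ∈ Metric.ball ((t₀, x₀, y₀) : Base) r := hzu.1
    obtain ⟨e1, e2⟩ := hτ' z.1 (mem_ball_base.1 hz).1
    have hw : γ * z.1 + δ ≠ 0 := (hnat hz).1
    have ha0 := (hab z hz).1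
    have hε := hadm.ne_zero
    rw [hform z hz u hzu.2, symmetryMap_apply, ← ha' z hz, e1, e2]
    refine Prod.ext (Prod.ext rfl (Prod.ext ?_ rfl)) ?_
    · simp only [baseMap]
      generalize α * δ - β * γ = ε at hε
      field_simp
    · simp only
      field_simp
      ring

end Form

/-! ### Inverses, and sufficiency of the local form -/

/-- The inverse of the explicit transformation. -/
noncomputable def symmetryInv (α β γ δ lam σ : ℝ) (f : Base → ℝ) (q : Total) : Total :=
  (baseMap δ (-β) (-γ) α (-lam) q.1,
    q.2 / symmetryFactor α β γ δ σ (baseMap δ (-β) (-γ) α (-lam) q.1)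
      - f (baseMap δ (-β) (-γ) α (-lam) q.1))

section Inverse

variable {α β γ δ lam σ : ℝ} {f : Base → ℝ} {p q : Total}

theorem symmetryInv_symmetryMap (h : AdmissibleConstants α β γ δ σ) (hp : γ * p.1.1 + δ ≠ 0) :
    symmetryInv α β γ δ lam σ f (symmetryMap α β γ δ lam σ f p) = p := by
  rw [symmetryMap_apply, symmetryInv]
  simp only [(baseMap_baseMap h.ne_zero hp).2]
  rw [mul_div_cancel_left₀ _ (symmetryFactor_ne_zero h hp), add_sub_cancel_right]

theorem symmetryMap_symmetryInv (h : AdmissibleConstants α β γ δ σ) (hq : -γ * q.1.1 + α ≠ 0) :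
    γ * (baseMap δ (-β) (-γ) α (-lam) q.1).1 + δ ≠ 0 ∧
      symmetryMap α β γ δ lam σ f (symmetryInv α β γ δ lam σ f q) = q := by
  have h0 : δ * α - -β * -γ ≠ 0 := by
    have := h.ne_zero
    rwa [show δ * α - -β * -γ = α * δ - β * γ by ring]
  obtain ⟨h1, h2⟩ := baseMap_baseMap (lam := -lam) h0 hq
  simp only [neg_neg] at h1 h2
  have h3 : γ * (baseMap δ (-β) (-γ) α (-lam) q.1).1 + δ ≠ 0 := by
    rw [h1]
    exact div_ne_zero h0 hq
  refine ⟨h3, ?_⟩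
  rw [symmetryMap_apply, symmetryInv]
  simp only [h2]
  rw [sub_add_cancel, mul_div_cancel₀ _ (symmetryFactor_ne_zero h h3)]

theorem contDiffAt_symmetryMap (h : AdmissibleConstants α β γ δ σ)
    (hp : p.1 ∈ naturalDomain γ δ) (hf : ContDiffAt ℝ ∞ f p.1) :
    ContDiffAt ℝ ∞ (symmetryMap α β γ δ lam σ f) p := by
  have h1 : ContDiffAt ℝ ∞ (Prod.fst : Total → Base) p := contDiffAt_fst
  have h2 : ContDiffAt ℝ ∞ (Prod.snd : Total → ℝ) p := contDiffAt_snd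
  exact ((contDiffAt_baseMap (lam := lam) h.ne_zero hp.1).comp p h1).prodMk
    (((contDiffAt_symmetryFactor h hp).comp p h1).mul (h2.add (hf.comp p h1)))

theorem contDiffAt_symmetryInv (h : AdmissibleConstants α β γ δ σ) (hq : -γ * q.1.1 + α ≠ 0)
    (hp : baseMap δ (-β) (-γ) α (-lam) q.1 ∈ naturalDomain γ δ)
    (hf : ContDiffAt ℝ ∞ f (baseMap δ (-β) (-γ) α (-lam) q.1)) :
    ContDiffAt ℝ ∞ (symmetryInv α β γ δ lam σ f) q := by
  have h0 : δ * α - -β * -γ ≠ 0 := by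
    have := h.ne_zero
    rwa [show δ * α - -β * -γ = α * δ - β * γ by ring]
  have h1 : ContDiffAt ℝ ∞ (fun q : Total => baseMap δ (-β) (-γ) α (-lam) q.1) q :=
    (contDiffAt_baseMap h0 hq).comp q contDiffAt_fst
  have h2 : ContDiffAt ℝ ∞ (Prod.snd : Total → ℝ) q := contDiffAt_snd
  exact h1.prodMk ((h2.div (ContDiffAt.comp (g := symmetryFactor α β γ δ σ) q
    (contDiffAt_symmetryFactor h hp) h1) (symmetryFactor_ne_zero h hp.1)).sub
      (ContDiffAt.comp (g := f) q hf h1))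

end Inverse

theorem HasSymmetryForm.mono {Φ : Total → Total} {Ω Ω' : Set Total} {α β γ δ lam σ : ℝ}
    {f : Base → ℝ} (h : HasSymmetryForm Φ Ω α β γ δ lam σ f) (hΩ : Ω' ⊆ Ω) (ho : IsOpen Ω') :
    HasSymmetryForm Φ Ω' α β γ δ lam σ f :=
  ⟨h.1, (image_mono hΩ).trans h.2.1, h.2.2.1.mono (image_mono hΩ) (isOpenMap_fst _ ho),
    h.2.2.2.mono hΩ⟩

section Local

variable {Φ : OpenPartialHomeomorph Total Total} {Ω : Set Total} {α β γ δ lam σ : ℝ}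
  {f : Base → ℝ} {p : Total}

theorem HasSymmetryForm.contDiffAt {Φ : Total → Total} (h : HasSymmetryForm Φ Ω α β γ δ lam σ f)
    (ho : IsOpen Ω) (hp : p ∈ Ω) : ContDiffAt ℝ ∞ Φ p := by
  obtain ⟨hadm, hnat, hf, heq⟩ := h
  have hp1 := mem_image_of_mem Prod.fst hp
  refine (contDiffAt_symmetryMap (lam := lam) hadm (hnat hp1)
    (hf.2.1.contDiffAt (hf.1.mem_nhds hp1))).congr_of_eventuallyEq ?_
  exact heq.eventuallyEq_of_mem (ho.mem_nhds hp)

theorem HasSymmetryForm.contDiffAt_symm (h : HasSymmetryForm Φ Ω α β γ δ lam σ f)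
    (ho : IsOpen Ω) (hΩ : Ω ⊆ Φ.source) (hp : p ∈ Ω) : ContDiffAt ℝ ∞ Φ.symm (Φ p) := by
  obtain ⟨hadm, hnat, hf, heq⟩ := h
  have hp1 := mem_image_of_mem Prod.fst hp
  have hw := (hnat hp1).1
  obtain ⟨h1, h2⟩ := baseMap_baseMap (lam := lam) hadm.ne_zero hw
  have e : Φ.symm =ᶠ[𝓝 (Φ p)] symmetryInv α β γ δ lam σ f := by
    filter_upwards [(Φ.isOpen_image_of_subset_source ho hΩ).mem_nhds (mem_image_of_mem Φ hp)]
    rintro _ ⟨p', hp', rfl⟩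
    rw [Φ.left_inv (hΩ hp'), heq hp',
      symmetryInv_symmetryMap hadm (hnat (mem_image_of_mem Prod.fst hp')).1]
  refine ContDiffAt.congr_of_eventuallyEq ?_ e
  rw [heq hp, symmetryMap_apply]
  refine contDiffAt_symmetryInv hadm ?_ ?_ ?_
  · rw [h1]
    exact div_ne_zero hadm.ne_zero hw
  · rw [h2]
    exact hnat hp1
  · rw [h2]
    exact hf.2.1.contDiffAt (hf.1.mem_nhds hp1)

/-- As `Φ` maps one graph onto the other, comparing components gives `v ∘ baseMap = a (u + f)` near
`z`, with `a` the symmetry factor: the input of `kolmogorovOp_image_iff`. -/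
theorem HasSymmetryForm.kolmogorovOp_iff {Φ : Total → Total}
    (h : HasSymmetryForm Φ Ω α β γ δ lam σ f)
    (ho : IsOpen Ω) {u v : Base → ℝ} {W V : Set Base} (hW : IsOpen W) (hV : IsOpen V)
    (hu : ContDiffOn ℝ ∞ u W) (hv : ContDiffOn ℝ ∞ v V)
    (hg : Φ '' graphOver u W = graphOver v V) {z : Base} (hz : z ∈ W) (hzΩ : (z, u z) ∈ Ω) :
    (Φ (z, u z)).1 ∈ V ∧ (kolmogorovOp v (Φ (z, u z)).1 = 0 ↔ kolmogorovOp u z = 0) := by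
  obtain ⟨hadm, hnat, hf, heq⟩ := h
  have hp1 : z ∈ Prod.fst '' Ω := mem_image_of_mem Prod.fst hzΩ
  have key : ∀ y ∈ W, (y, u y) ∈ Ω → baseMap α β γ δ lam y ∈ V ∧
      v (baseMap α β γ δ lam y) = symmetryFactor α β γ δ σ y * (u y + f y) := by
    intro y hy hyΩ
    have h1 : Φ (y, u y) ∈ graphOver v V := by
      rw [← hg]
      exact mem_image_of_mem _ (mem_image_of_mem _ hy)
    obtain ⟨Z, hZ, h2⟩ := h1
    rw [heq hyΩ, symmetryMap_apply, Prod.ext_iff] at h2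
    simp only at h2
    rw [← h2.1, ← h2.2]
    exact ⟨hZ, rfl⟩
  have hzV := (key z hz hzΩ).1
  rw [heq hzΩ, symmetryMap_apply]
  refine ⟨hzV, kolmogorovOp_image_iff hadm (hnat hp1)
    (contDiffAt_two (hv.contDiffAt (hV.mem_nhds hzV)))
    (contDiffAt_two (hu.contDiffAt (hW.mem_nhds hz)))
    (contDiffAt_two (hf.2.1.contDiffAt (hf.1.mem_nhds hp1)))
    ((isSolutionOn_iff.1 hf).2.2 z hp1) ?_⟩
  have hc : ContinuousAt (fun y => ((y, u y) : Total)) z :=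
    continuousAt_id.prodMk (hu.contDiffAt (hW.mem_nhds hz)).continuousAt
  filter_upwards [hW.mem_nhds hz, hc.preimage_mem_nhds (ho.mem_nhds hzΩ)] with y hy hyΩ
  exact (key y hy hyΩ).2

/-- A transformation that is locally of the explicit form is a point symmetry. -/
theorem mem_symmetryPseudogroup_of_local
    (h : ∀ p ∈ Φ.source, ∃ Ω : Set Total, IsOpen Ω ∧ p ∈ Ω ∧ Ω ⊆ Φ.source ∧
      ∃ (α β γ δ lam σ : ℝ) (f : Base → ℝ), HasSymmetryForm Φ Ω α β γ δ lam σ f) :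
    Φ ∈ symmetryPseudogroup := by
  refine ⟨⟨fun p hp => ?_, fun q hq => ?_⟩, fun u v W V hW hV hu hv hs hg => ?_⟩
  · obtain ⟨Ω, ho, hpΩ, -, α, β, γ, δ, lam, σ, f, hform⟩ := h p hp
    exact (hform.contDiffAt ho hpΩ).contDiffWithinAt
  · obtain ⟨Ω, ho, hpΩ, hΩ, α, β, γ, δ, lam, σ, f, hform⟩ := h _ (Φ.map_target hq)
    have h1 := hform.contDiffAt_symm ho hΩ hpΩ
    rw [Φ.right_inv hq] at h1
    exact h1.contDiffWithinAt
  -- The equivalence is pointwise, so the constants may change from point to point. Every point of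
  -- `V` is reached because the graph of `v` is the whole image.
  · have key : ∀ z ∈ W, (Φ (z, u z)).1 ∈ V ∧
        (kolmogorovOp v (Φ (z, u z)).1 = 0 ↔ kolmogorovOp u z = 0) := by
      intro z hz
      obtain ⟨Ω, ho, hpΩ, -, α, β, γ, δ, lam, σ, f, hform⟩ := h (z, u z) (hs (mem_image_of_mem _ hz))
      exact hform.kolmogorovOp_iff ho hW hV hu hv hg hz hpΩ
    rw [isSolutionOn_iff, isSolutionOn_iff]
    constructor
    · rintro ⟨-, -, h1⟩
      refine ⟨hV, hv, fun Z hZ => ?_⟩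
      have h2 : (Z, v Z) ∈ Φ '' graphOver u W := by
        rw [hg]
        exact mem_image_of_mem _ hZ
      obtain ⟨_, ⟨z, hz, rfl⟩, h3⟩ := h2
      have h4 := (key z hz).2.2 (h1 z hz)
      simp only at h3
      rwa [h3] at h4
    · rintro ⟨-, -, h1⟩
      exact ⟨hW, hu, fun z hz => (key z hz).2.1 (h1 _ (key z hz).1)⟩

end Local

/-- All admissible constants and all solutions occur. -/
theorem exists_mem_symmetryPseudogroup {α β γ δ σ : ℝ} (lam : ℝ) {f : Base → ℝ} {W : Set Base}
    (h : AdmissibleConstants α β γ δ σ) (hW : W ⊆ naturalDomain γ δ) (hf : IsSolutionOn f W) :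
    ∃ Φ ∈ symmetryPseudogroup, Φ.source = W ×ˢ (univ : Set ℝ) ∧
      HasSymmetryForm Φ Φ.source α β γ δ lam σ f := by
  have h0 : δ * α - -β * -γ ≠ 0 := by
    have := h.ne_zero
    rwa [show δ * α - -β * -γ = α * δ - β * γ by ring]
  have hfz : ∀ z ∈ W, ContDiffAt ℝ ∞ f z := fun z hz => hf.2.1.contDiffAt (hf.1.mem_nhds hz)
  have hopen : IsOpen {Z : Base | -γ * Z.1 + α ≠ 0 ∧ baseMap δ (-β) (-γ) α (-lam) Z ∈ W} := by
    have h1 : IsOpen {Z : Base | -γ * Z.1 + α ≠ 0} := isOpen_ne_fun (by fun_prop) (by fun_prop)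
    have h2 : ContinuousOn (baseMap δ (-β) (-γ) α (-lam)) {Z : Base | -γ * Z.1 + α ≠ 0} :=
      fun Z hZ => (contDiffAt_baseMap h0 hZ).continuousAt.continuousWithinAt
    exact h2.isOpen_inter_preimage h1 hf.1
  let Φ : OpenPartialHomeomorph Total Total :=
    { toFun := symmetryMap α β γ δ lam σ f
      invFun := symmetryInv α β γ δ lam σ f
      source := W ×ˢ univ
      target := {Z : Base | -γ * Z.1 + α ≠ 0 ∧ baseMap δ (-β) (-γ) α (-lam) Z ∈ W} ×ˢ univ
      map_source' := fun p hp => by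
        obtain ⟨h1, h2⟩ := baseMap_baseMap (lam := lam) h.ne_zero (hW hp.1).1
        refine ⟨⟨?_, ?_⟩, mem_univ _⟩
        · rw [symmetryMap_apply, h1]
          exact div_ne_zero h.ne_zero (hW hp.1).1
        · rw [symmetryMap_apply, h2]
          exact hp.1
      map_target' := fun q hq => ⟨hq.1.2, mem_univ _⟩
      left_inv' := fun p hp => symmetryInv_symmetryMap h (hW hp.1).1
      right_inv' := fun q hq => (symmetryMap_symmetryInv h hq.1.1).2
      open_source := hf.1.prod isOpen_univ
      open_target := hopen.prod isOpen_univ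
      continuousOn_toFun := fun p hp =>
        (contDiffAt_symmetryMap h (hW hp.1) (hfz _ hp.1)).continuousAt.continuousWithinAt
      continuousOn_invFun := fun q hq => (contDiffAt_symmetryInv h hq.1.1 (hW hq.1.2)
        (hfz _ hq.1.2)).continuousAt.continuousWithinAt }
  have hfst : Prod.fst '' Φ.source = W := fst_image_prod W univ_nonempty
  have hform : HasSymmetryForm Φ Φ.source α β γ δ lam σ f := by
    refine ⟨h, ?_, ?_, fun p _ => rfl⟩
    · rwa [hfst]
    · rwa [hfst]
  exact ⟨Φ, mem_symmetryPseudogroup_of_local fun p hp =>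
    ⟨Φ.source, Φ.open_source, hp, Subset.rfl, α, β, γ, δ, lam, σ, f, hform⟩, rfl, hform⟩

/-! ### Uniqueness of the constants and of `f` -/

section Uniqueness

variable {α β γ δ lam σ α' β' γ' δ' lam' σ' : ℝ} {f f' : Base → ℝ} {Ω : Set Total}

theorem symmetryMap_neg (α β γ δ lam σ : ℝ) (f : Base → ℝ) :
    symmetryMap (-α) (-β) (-γ) (-δ) lam σ f = symmetryMap α β γ δ lam σ f := by
  ext1 p
  have h1 : ∀ s a b : ℝ, -a * s + -b = -(a * s + b) := fun s a b => by ring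
  have h2 : ∀ s : ℝ, -γ * s / -(γ * p.1.1 + δ) = γ * s / (γ * p.1.1 + δ) := fun s => by
    rw [neg_mul, neg_div_neg_eq]
  simp only [symmetryMap_apply, baseMap, symmetryFactor, h1, h2, neg_div_neg_eq, neg_mul_neg,
    neg_sq]

theorem HasSymmetryForm.neg {Φ : Total → Total} (h : HasSymmetryForm Φ Ω α β γ δ lam σ f) :
    HasSymmetryForm Φ Ω (-α) (-β) (-γ) (-δ) lam σ f := by
  obtain ⟨h1, h2, h3, h4⟩ := h
  refine ⟨?_, fun z hz => ?_, h3, ?_⟩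
  · rwa [AdmissibleConstants, neg_mul_neg, neg_mul_neg]
  · obtain ⟨k1, k2⟩ := h2 hz
    refine ⟨?_, k2.imp_left neg_eq_zero.2⟩
    rw [neg_mul, ← neg_add]
    exact neg_ne_zero.2 k1
  · rwa [symmetryMap_neg]

theorem HasSymmetryForm.congr {Φ : Total → Total} (h : HasSymmetryForm Φ Ω α β γ δ lam σ f)
    (hf : EqOn f' f (Prod.fst '' Ω)) : HasSymmetryForm Φ Ω α β γ δ lam σ f' := by
  obtain ⟨h1, h2, h3, h4⟩ := h
  refine ⟨h1, h2, h3.congr hf, fun p hp => ?_⟩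
  rw [h4 hp, symmetryMap_apply, symmetryMap_apply, hf (mem_image_of_mem _ hp)]

/-- The last two constants and the solution are determined by the first four constants. -/
theorem HasSymmetryForm.eq_of_eq {Φ : Total → Total} (ho : IsOpen Ω) {p : Total} (hp : p ∈ Ω)
    (h : HasSymmetryForm Φ Ω α β γ δ lam σ f) (h' : HasSymmetryForm Φ Ω α β γ δ lam' σ' f') :
    lam' = lam ∧ σ' = σ ∧ EqOn f' f (Prod.fst '' Ω) := by
  have hσ : ∀ σ z, symmetryFactor α β γ δ σ z = σ * symmetryFactor α β γ δ 1 z := fun σ z => by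
    rw [symmetryFactor, symmetryFactor]
    ring
  have key : ∀ q ∈ Ω, lam' = lam ∧ symmetryFactor α β γ δ 1 q.1 ≠ 0 ∧
      σ' * (q.2 + f' q.1) = σ * (q.2 + f q.1) := by
    intro q hq
    have h1 := (h'.2.2.2 hq).symm.trans (h.2.2.2 hq)
    rw [symmetryMap_apply, symmetryMap_apply, Prod.ext_iff] at h1
    obtain ⟨h1, h2⟩ := h1
    have h3 : q.1.2.2 + lam' = q.1.2.2 + lam := congrArg (fun z : Base => z.2.2) h1
    have h4 : symmetryFactor α β γ δ 1 q.1 ≠ 0 :=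
      symmetryFactor_ne_zero ⟨h.1.1, one_ne_zero⟩ (h.2.1 (mem_image_of_mem _ hq)).1
    refine ⟨add_left_cancel h3, h4, mul_left_cancel₀ h4 ?_⟩
    simp only at h2
    rw [hσ σ, hσ σ'] at h2
    linear_combination h2
  -- Subtracting the identities at two points of one fibre eliminates `f` and `f'` and leaves `σ' s
  -- = σ s` with `s ≠ 0`.
  have hc : ContinuousAt (fun s : ℝ => ((p.1, p.2 + s) : Total)) 0 := by fun_prop
  have hn : ∀ᶠ s in 𝓝[≠] (0 : ℝ), ((p.1, p.2 + s) : Total) ∈ Ω :=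
    nhdsWithin_le_nhds (hc.preimage_mem_nhds (by simpa using ho.mem_nhds hp))
  obtain ⟨s, hs, hs0⟩ := (hn.and self_mem_nhdsWithin).exists
  have e : σ' = σ := by
    have h1 := (key _ hs).2.2
    have h2 := (key _ hp).2.2
    simp only at h1
    exact mul_right_cancel₀ hs0 (by linear_combination h1 - h2)
  refine ⟨(key p hp).1, e, ?_⟩
  rintro _ ⟨q, hq, rfl⟩
  have h1 := (key q hq).2.2
  rw [e] at h1
  exact add_left_cancel (mul_left_cancel₀ h.1.2 h1)

/-- The constants of the explicit form are determined up to sign. -/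
theorem HasSymmetryForm.unique {Φ : Total → Total} (ho : IsOpen Ω) {p : Total} (hp : p ∈ Ω)
    (h : HasSymmetryForm Φ Ω α β γ δ lam σ f) (h' : HasSymmetryForm Φ Ω α' β' γ' δ' lam' σ' f') :
    ((α' = α ∧ β' = β ∧ γ' = γ ∧ δ' = δ) ∨ (α' = -α ∧ β' = -β ∧ γ' = -γ ∧ δ' = -δ)) ∧
      lam' = lam ∧ σ' = σ ∧ EqOn f' f (Prod.fst '' Ω) := by
  suffices hs : (α' = α ∧ β' = β ∧ γ' = γ ∧ δ' = δ) ∨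
      (α' = -α ∧ β' = -β ∧ γ' = -γ ∧ δ' = -δ) by
    refine ⟨hs, ?_⟩
    rcases hs with ⟨rfl, rfl, rfl, rfl⟩ | ⟨rfl, rfl, rfl, rfl⟩
    · exact h.eq_of_eq ho hp h'
    · exact h.neg.eq_of_eq ho hp h'
  obtain ⟨r, hr, hball⟩ := Metric.isOpen_iff.1 ho p hp
  obtain ⟨⟨t₀, x₀, y₀⟩, u₀⟩ := p
  -- A nonzero `x` is needed to cancel it from the second component.
  obtain ⟨x₁, hx₁, hx0⟩ : ∃ x₁ ∈ Metric.ball x₀ r, x₁ ≠ 0 := by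
    by_cases h0 : x₀ = 0
    · refine ⟨r / 2, ?_, by positivity⟩
      rw [h0, Metric.mem_ball, Real.dist_eq, sub_zero, abs_of_pos (by positivity)]
      linarith
    · exact ⟨x₀, Metric.mem_ball_self hr, h0⟩
  have key : ∀ s ∈ Metric.ball t₀ r, γ * s + δ ≠ 0 ∧ γ' * s + δ' ≠ 0 ∧
      (α' * s + β') / (γ' * s + δ') = (α * s + β) / (γ * s + δ) ∧
      (γ' * s + δ') ^ 2 / (α' * δ' - β' * γ') = (γ * s + δ) ^ 2 / (α * δ - β * γ) := by
    intro s hs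
    have hq : (((s, x₁, y₀), u₀) : Total) ∈ Ω := by
      apply hball
      rw [← ball_prod_same]
      exact ⟨mem_ball_base.2 ⟨hs, hx₁, Metric.mem_ball_self hr⟩, Metric.mem_ball_self hr⟩
    have hq1 := mem_image_of_mem Prod.fst hq
    have h1 := (h'.2.2.2 hq).symm.trans (h.2.2.2 hq)
    rw [symmetryMap_apply, symmetryMap_apply, Prod.ext_iff] at h1
    exact ⟨(h.2.1 hq1).1, (h'.2.1 hq1).1, congrArg (fun z : Base => z.1) h1.1,
      mul_right_cancel₀ hx0 (congrArg (fun z : Base => z.2.1) h1.1)⟩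
  -- Both determinants are `±1` and the squares above them are positive, so equal quotients force
  -- equal signs.
  have hε : α' * δ' - β' * γ' = α * δ - β * γ := by
    obtain ⟨k1, k2, -, k3⟩ := key t₀ (Metric.mem_ball_self hr)
    have p1 := pow_pos (abs_pos.2 k1) 2
    have p2 := pow_pos (abs_pos.2 k2) 2
    rw [sq_abs] at p1 p2
    rcases h.1.1 with e1 | e1 <;> rcases h'.1.1 with e2 | e2 <;> rw [e1, e2] at k3 ⊢ <;>
      simp only [div_neg, div_one] at k3 <;> linarith
  have hsq : δ' ^ 2 - δ ^ 2 = 0 ∧ 2 * (γ' * δ' - γ * δ) = 0 ∧ γ' ^ 2 - γ ^ 2 = 0 := by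
    refine quadratic_coefficients_eq_zero hr (x₀ := t₀) fun s hs => ?_
    have k := (key s hs).2.2.2
    rw [hε, div_left_inj' h.1.ne_zero] at k
    linear_combination k
  have hlin : ∀ c : ℝ, (∀ s, γ' * s + δ' = c * (γ * s + δ)) → α' = c * α ∧ β' = c * β := by
    intro c hc
    have k := quadratic_coefficients_eq_zero (A := β' - c * β) (B := α' - c * α) (C := 0) hr
      (x₀ := t₀) fun s hs => by
        obtain ⟨k1, k2, k3, -⟩ := key s hs
        rw [hc s] at k2 k3
        rw [div_eq_div_iff k2 k1] at k3
        refine (mul_eq_zero.1 ?_).resolve_right k1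
        linear_combination k3
    exact ⟨sub_eq_zero.1 k.2.1, sub_eq_zero.1 k.1⟩
  have hsgn : (γ' = γ ∧ δ' = δ) ∨ (γ' = -γ ∧ δ' = -δ) := by
    obtain ⟨k1, k2, k3⟩ := hsq
    -- If the signs for `γ` and `δ` disagree, the middle coefficient gives `γ δ = 0`, and the sign
    -- of the vanishing one can be switched.
    rcases sq_eq_sq_iff_eq_or_eq_neg.1 (sub_eq_zero.1 k1) with e1 | e1 <;>
      rcases sq_eq_sq_iff_eq_or_eq_neg.1 (sub_eq_zero.1 k3) with e2 | e2
    · exact Or.inl ⟨e2, e1⟩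
    · rw [e1, e2] at k2
      rcases mul_eq_zero.1 (show γ * δ = 0 by linarith) with h0 | h0
      · left; simp [e1, e2, h0]
      · right; simp [e1, e2, h0]
    · rw [e1, e2] at k2
      rcases mul_eq_zero.1 (show γ * δ = 0 by linarith) with h0 | h0
      · right; simp [e1, e2, h0]
      · left; simp [e1, e2, h0]
    · exact Or.inr ⟨e2, e1⟩
  rcases hsgn with ⟨e1, e2⟩ | ⟨e1, e2⟩
  · have k := hlin 1 fun s => by rw [e1, e2, one_mul]
    exact Or.inl ⟨by simpa using k.1, by simpa using k.2, e1, e2⟩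
  · have k := hlin (-1) fun s => by rw [e1, e2]; ring
    exact Or.inr ⟨by simpa using k.1, by simpa using k.2, e1, e2⟩

theorem hasSymmetryForm_iff {Φ : Total → Total} (ho : IsOpen Ω) (hne : Ω.Nonempty)
    (h : HasSymmetryForm Φ Ω α β γ δ lam σ f) :
    HasSymmetryForm Φ Ω α' β' γ' δ' lam' σ' f' ↔
      ((α' = α ∧ β' = β ∧ γ' = γ ∧ δ' = δ) ∨ (α' = -α ∧ β' = -β ∧ γ' = -γ ∧ δ' = -δ)) ∧
        lam' = lam ∧ σ' = σ ∧ EqOn f' f (Prod.fst '' Ω) := by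
  obtain ⟨p, hp⟩ := hne
  refine ⟨h.unique ho hp, ?_⟩
  rintro ⟨⟨rfl, rfl, rfl, rfl⟩ | ⟨rfl, rfl, rfl, rfl⟩, rfl, rfl, hf⟩
  · exact h.congr hf
  · exact h.neg.congr hf

end Uniqueness

/-! ### From local to global form -/

section Global

variable {Φ : OpenPartialHomeomorph Total Total}

/-- Near the point `p`, the transformation is of the explicit form with the given constants. -/
def HasLocalForm (Φ : OpenPartialHomeomorph Total Total) (α β γ δ lam σ : ℝ) (p : Total) : Prop :=
  ∃ Ω : Set Total, IsOpen Ω ∧ p ∈ Ω ∧ Ω ⊆ Φ.source ∧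
    ∃ f : Base → ℝ, HasSymmetryForm Φ Ω α β γ δ lam σ f

/-- On the overlap with `Ω`, uniqueness identifies the given constants with those of `Ω` up to a
common sign of the first four, so they are valid on all of `Ω`. -/
theorem HasLocalForm.of_mem {Ω : Set Total} {α β γ δ lam σ α' β' γ' δ' lam' σ' : ℝ}
    {f : Base → ℝ} {p q : Total} (h : HasSymmetryForm Φ Ω α β γ δ lam σ f) (ho : IsOpen Ω)
    (hΩ : Ω ⊆ Φ.source) (hp : p ∈ Ω) (hq : q ∈ Ω)
    (hloc : HasLocalForm Φ α' β' γ' δ' lam' σ' p) : HasLocalForm Φ α' β' γ' δ' lam' σ' q := by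
  obtain ⟨Ω', ho', hp', -, f', h'⟩ := hloc
  have hi := ho.inter ho'
  obtain ⟨⟨rfl, rfl, rfl, rfl⟩ | ⟨rfl, rfl, rfl, rfl⟩, rfl, rfl, -⟩ :=
    (h.mono inter_subset_left hi).unique hi ⟨hp, hp'⟩ (h'.mono inter_subset_right hi)
  · exact ⟨Ω, ho, hq, hΩ, f, h⟩
  · exact ⟨Ω, ho, hq, hΩ, f, h.neg⟩

/-- The truth value of having local form with given constants is locally constant, hence constant on
the connected source. The function `f` is then recovered from `Φ` as `U / a - u`, with `a` the
symmetry factor; this is locally constant along fibres, so connected fibres let it descend to the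
base. -/
theorem exists_hasSymmetryForm_source (hΦ : Φ ∈ symmetryPseudogroup)
    (hconn : IsPreconnected Φ.source)
    (hfib : ∀ z : Base, IsPreconnected {u : ℝ | (z, u) ∈ Φ.source}) :
    ∃ (α β γ δ lam σ : ℝ) (f : Base → ℝ), HasSymmetryForm Φ Φ.source α β γ δ lam σ f := by
  rcases Φ.source.eq_empty_or_nonempty with he | ⟨p₀, hp₀⟩
  · refine ⟨1, 0, 0, 1, 0, 1, 0, ⟨by norm_num, one_ne_zero⟩, ?_, ?_, ?_⟩
    · rw [he]
      simp
    · rw [he, image_empty, isSolutionOn_iff]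
      simp
    · rw [he]
      exact eqOn_empty _ _
  obtain ⟨Ω₀, ho₀, hpΩ₀, hΩ₀, α, β, γ, δ, lam, σ, f₀, h₀⟩ := exists_local_form hΦ hp₀
  have hloc : ∀ p ∈ Φ.source, HasLocalForm Φ α β γ δ lam σ p := by
    intro p hp
    refine (hconn.induction₂
      (fun p q => HasLocalForm Φ α β γ δ lam σ p ↔ HasLocalForm Φ α β γ δ lam σ q)
      (fun x hx => ?_) (fun _ _ _ _ _ _ h1 h2 => h1.trans h2) (fun _ _ _ _ h1 => h1.symm) hp₀ hp).1
      ⟨Ω₀, ho₀, hpΩ₀, hΩ₀, f₀, h₀⟩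
    obtain ⟨Ω, ho, hxΩ, hΩ, α', β', γ', δ', lam', σ', f, h⟩ := exists_local_form hΦ hx
    filter_upwards [nhdsWithin_le_nhds (ho.mem_nhds hxΩ)] with q hq
    exact ⟨HasLocalForm.of_mem h ho hΩ hxΩ hq, HasLocalForm.of_mem h ho hΩ hq hxΩ⟩
  let g : Total → ℝ := fun p => (Φ p).2 / symmetryFactor α β γ δ σ p.1 - p.2
  have hg : ∀ {Ω : Set Total} {f : Base → ℝ}, HasSymmetryForm Φ Ω α β γ δ lam σ f →
      ∀ p ∈ Ω, g p = f p.1 := by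
    intro Ω f h p hp
    simp only [g]
    rw [h.2.2.2 hp, symmetryMap_apply, mul_div_cancel_left₀ _ (symmetryFactor_ne_zero h.1
      (h.2.1 (mem_image_of_mem _ hp)).1), add_sub_cancel_left]
  have hgc : ∀ z u u', (z, u) ∈ Φ.source → (z, u') ∈ Φ.source → g (z, u) = g (z, u') := by
    intro z u u' hu hu'
    refine (hfib z).induction₂ (fun u u' => g (z, u) = g (z, u'))
      (fun s hs => ?_) (fun _ _ _ _ _ _ h1 h2 => h1.trans h2) (fun _ _ _ _ h1 => h1.symm) hu hu'
    obtain ⟨Ω, ho, hsΩ, hΩ, f, h⟩ := hloc _ hs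
    have hc : ContinuousAt (fun s : ℝ => ((z, s) : Total)) s := by fun_prop
    filter_upwards [nhdsWithin_le_nhds (hc.preimage_mem_nhds (ho.mem_nhds hsΩ))] with s' hs'
    rw [hg h _ hsΩ, hg h _ hs']
  classical
  let F : Base → ℝ := fun z => if hz : ∃ u, (z, u) ∈ Φ.source then g (z, hz.choose) else 0
  have hF : ∀ p ∈ Φ.source, F p.1 = g p := by
    intro p hp
    have hz : ∃ u, (p.1, u) ∈ Φ.source := ⟨p.2, hp⟩
    simp only [F, dif_pos hz]
    exact hgc _ _ _ hz.choose_spec hp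
  have hFΩ : ∀ {Ω : Set Total} {f : Base → ℝ}, Ω ⊆ Φ.source →
      HasSymmetryForm Φ Ω α β γ δ lam σ f → HasSymmetryForm Φ Ω α β γ δ lam σ F := by
    intro Ω f hΩ h
    refine h.congr ?_
    rintro _ ⟨p, hp, rfl⟩
    rw [hF p (hΩ hp), hg h p hp]
  have hlocF : ∀ p ∈ Φ.source, ∃ Ω : Set Total, IsOpen Ω ∧ p ∈ Ω ∧
      HasSymmetryForm Φ Ω α β γ δ lam σ F := by
    intro p hp
    obtain ⟨Ω, ho, hpΩ, hΩ, f, h⟩ := hloc p hp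
    exact ⟨Ω, ho, hpΩ, hFΩ hΩ h⟩
  refine ⟨α, β, γ, δ, lam, σ, F, h₀.1, ?_, ?_, fun p hp => ?_⟩
  · rintro _ ⟨p, hp, rfl⟩
    obtain ⟨Ω, -, hpΩ, h⟩ := hlocF p hp
    exact h.2.1 (mem_image_of_mem _ hpΩ)
  · rw [isSolutionOn_iff]
    refine ⟨isOpenMap_fst _ Φ.open_source, ?_, ?_⟩
    · rintro _ ⟨p, hp, rfl⟩
      obtain ⟨Ω, -, hpΩ, h⟩ := hlocF p hp
      exact (h.2.2.1.2.1.contDiffAt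
        (h.2.2.1.1.mem_nhds (mem_image_of_mem _ hpΩ))).contDiffWithinAt
    · rintro _ ⟨p, hp, rfl⟩
      obtain ⟨Ω, -, hpΩ, h⟩ := hlocF p hp
      exact (isSolutionOn_iff.1 h.2.2.1).2.2 _ (mem_image_of_mem _ hpΩ)
  · obtain ⟨Ω, -, hpΩ, h⟩ := hlocF p hp
    exact h.2.2.2 hpΩ

end Global

end KolmogorovCubic

open KolmogorovCubic in
theorem mainTheorem10 :
    -- a local diffeomorphism is a point symmetry iff it is locally of the stated form
    (∀ Φ : OpenPartialHomeomorph Total Total,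
      Φ ∈ symmetryPseudogroup ↔
        ∀ p ∈ Φ.source, ∃ Ω : Set Total, IsOpen Ω ∧ p ∈ Ω ∧ Ω ⊆ Φ.source ∧
          ∃ (α β γ δ lam σ : ℝ) (f : Base → ℝ), HasSymmetryForm Φ Ω α β γ δ lam σ f) ∧
    -- on a connected domain with connected fibres over `(t, x, y)` the form is global
    (∀ Φ : OpenPartialHomeomorph Total Total,
      IsPreconnected Φ.source → (∀ z : Base, IsPreconnected {u : ℝ | (z, u) ∈ Φ.source}) →
        (Φ ∈ symmetryPseudogroup ↔
          ∃ (α β γ δ lam σ : ℝ) (f : Base → ℝ),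
            HasSymmetryForm Φ Φ.source α β γ δ lam σ f)) ∧
    -- all admissible constants and all solutions `f` occur
    (∀ (α β γ δ lam σ : ℝ) (f : Base → ℝ) (W : Set Base),
      AdmissibleConstants α β γ δ σ → W ⊆ naturalDomain γ δ → IsSolutionOn f W →
        ∃ Φ ∈ symmetryPseudogroup, Φ.source = W ×ˢ (Set.univ : Set ℝ) ∧
          HasSymmetryForm Φ Φ.source α β γ δ lam σ f) ∧
    -- `α, β, γ, δ` are determined up to a simultaneous change of sign, the rest is determined
    (∀ (Φ : Total → Total) (Ω : Set Total) (α β γ δ lam σ : ℝ) (f : Base → ℝ),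
      IsOpen Ω → Ω.Nonempty → HasSymmetryForm Φ Ω α β γ δ lam σ f →
        ∀ (α' β' γ' δ' lam' σ' : ℝ) (f' : Base → ℝ),
          HasSymmetryForm Φ Ω α' β' γ' δ' lam' σ' f' ↔
            ((α' = α ∧ β' = β ∧ γ' = γ ∧ δ' = δ) ∨
              (α' = -α ∧ β' = -β ∧ γ' = -γ ∧ δ' = -δ)) ∧
            lam' = lam ∧ σ' = σ ∧ Set.EqOn f' f (Prod.fst '' Ω)) := by
  refine ⟨fun Φ => ⟨fun h p hp => exists_local_form h hp, mem_symmetryPseudogroup_of_local⟩,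
    fun Φ hconn hfib => ⟨fun h => exists_hasSymmetryForm_source h hconn hfib, ?_⟩,
    fun α β γ δ lam σ f W h hW hf => exists_mem_symmetryPseudogroup lam h hW hf,
    fun Φ Ω α β γ δ lam σ f ho hne h α' β' γ' δ' lam' σ' f' => hasSymmetryForm_iff ho hne h⟩
  rintro ⟨α, β, γ, δ, lam, σ, f, h⟩
  exact mem_symmetryPseudogroup_of_local fun p hp =>
    ⟨Φ.source, Φ.open_source, hp, Set.Subset.rfl, α, β, γ, δ, lam, σ, f, h⟩
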